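/- **Setting.** Let $D=\{1,\dots,d\}$, $d\ge 2$, and let $(\Omega,\mathcal F,\mathbb P)$ be a probability space with a filtration $(\mathcal F_t)_{t\ge0}$. Let $\varepsilon$ be an adapted right-continuous $D$-valued pure jump process, with switching times $0=\tau_0<\tau_1<\tau_2<\cdots\to\infty$, $\varepsilon(\tau_{n})\ne\varepsilon(\tau_{n-1})$, $T_n=\tau_n-\tau_{n-1}$, $N(t)=\max\{n:\tau_n\le t\}$, and $\mathbb P(\varepsilon(0)=i)>0$ for all $i\in D$. Put $$\overline F_{ij}(t)=\mathbb P(\tau_1>t,\ \varepsilon(\tau_1)=j\mid\varepsilon(0)=i),\qquad \overline F_i(t)=\mathbb P(\tau_1>t\mid\varepsilon(0)=i),$$ $$\overline F_{ij}(t\mid s)=\mathbb P(\tau_1>t,\ \varepsilon(\tau_1)=j\mid\tau_1>s,\ \varepsilon(0)=i),\qquad \overline F_i(t\mid s)=\mathbb P(\tau_1>t\mid\tau_1>s,\ \varepsilon(0)=i).$$ Assume that $\varepsilon$ is a (time-homogeneous) semi-Markov process: for all $n\ge1$, $t\ge0$, $i,j\in D$, on the event $\{\varepsilon(\tau_{n-1})=i\}$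 the conditional probability of $\{T_n>t,\ \varepsilon(\tau_n)=j\}$ given $(\tau_k,\varepsilon(\tau_k))_{0\le k\le n-1}$ is $\overline F_{ij}(t)$. Assume that the functions $\overline F_{ij}$ are differentiable on $(0,\infty)$ and put $f_{ij}=-\overline F_{ij}'$, $f_i=-\overline F_i'$, $f_{ij}(t\mid s)=-\partial_t\overline F_{ij}(t\mid s)$, $f_i(t\mid s)=-\partial_t\overline F_i(t\mid s)$. Let $B$ be an $(\mathcal F_t)$-Brownian motion independent of $\varepsilon$. For $i\in D$ let $c_i,h_i,\sigma_i$ be deterministic measurable functions on $[0,\infty)$ such that $c_i$, $\sigma_i^2$ and $h_if_i$ are integrable on $[0,t]$ for every $t\ge0$. For $z\in\{c,\sigma\}$ let $z^\dagger(t)=z_{\varepsilon(\tau_{n-1})}(t-\tau_{n-1})$ for $\tau_{n-1}\le t<\tau_n$, and let $$X(t)=\int_0^tc^\dagger(u)\,du+\sum_{n=1}^{N(t)}h_{\varepsilon(\tau_{n-1})}(T_n)+\int_0^t\sigma^\dagger(u)\,dB(u),\qquad t\ge0,$$ where the last integral is an Itô integral. Put $$\mu_i(t)=\mathbb E[X(t)\mid\varepsilon(0)=i],\qquad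 \mu_i(t\mid s)=\mathbb E[X(t)\mid\varepsilon(0)=i,\ N(s)=0],$$ $$a_i(t)=\int_0^t\big[c_i(u)\overline F_i(u)+h_i(u)f_i(u)\big]du,$$ $$a_i(t\mid s)=\int_0^sc_i(u)\,du+\int_s^t\big[c_i(u)\overline F_i(u\mid s)+h_i(u)f_i(u\mid s)\big]du.$$ **Proposition 2.1.** For every $t\ge0$ and $i\in D$ the variable $X(t)$ is integrable given $\varepsilon(0)=i$. The functions $\mu_i$ are locally integrable on $[0,\infty)$ and satisfy the system of Volterra integral equations $$\mu_i(t)=a_i(t)+\sum_{j\in D\setminus\{i\}}\int_0^t\mu_j(t-u)f_{ij}(u)\,du,\qquad t\ge0,\ i\in D,\tag{1}$$ in which all the integrals exist. If locally integrable functions $m_i$, $i\in D$, on $[0,\infty)$ solve system (1) (with $m$ in place of $\mu$, all the integrals existing) — for example $m_i=\mu_i$ — then, for all $i\in D$ and $0\le s\le t$ with $\overline F_i(s)>0$, the variable $X(t)$ is integrable given $\varepsilon(0)=i$, $N(s)=0$, and the conditional expectations are given by $$\mu_i(t\mid s)=a_i(t\mid s)+\sum_{j\in D\setminus\{i\}}\int_s^tm_j(t-u)f_{ij}(u\mid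 s)\,du,$$ in which all the integrals exist. -/

import Mathlib

open MeasureTheory ProbabilityTheory Filter Topology
open scoped NNReal ENNReal

noncomputable section

namespace RegimeSwitching

/-! ### The switching process -/

/-- The switching data on `Ω` with `d` regimes: the switching times `0 = τ 0 < τ 1 < ⋯ → ∞` and the
successive regimes `J n`; every switching changes the regime. -/
structure Switching (d : ℕ) (Ω : Type*) [MeasurableSpace Ω] where
  τ : ℕ → Ω → ℝ
  J : ℕ → Ω → Fin d
  measurable_τ : ∀ n, Measurable (τ n)
  measurable_J : ∀ n, Measurable (J n)
  τ_zero : ∀ ω, τ 0 ω = 0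
  strictMono_τ : ∀ ω, StrictMono fun n => τ n ω
  tendsto_τ : ∀ ω, Tendsto (fun n => τ n ω) atTop atTop
  J_succ_ne : ∀ n ω, J (n + 1) ω ≠ J n ω

variable {d : ℕ} {Ω : Type*} [mΩ : MeasurableSpace Ω]

namespace Switching

/-- The inter-switching time `T n = τ n - τ (n - 1)`, shifted: `M.gap n = T (n + 1)`. -/
def gap (M : Switching d Ω) (n : ℕ) (ω : Ω) : ℝ := M.τ (n + 1) ω - M.τ n ω

/-- The counting process `N(t) = max {n | τ n ≤ t}`. -/
def count (M : Switching d Ω) (t : ℝ) (ω : Ω) : ℕ := sSup {n | M.τ n ω ≤ t}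

/-- The switching process `ε`, right-continuous, equal to `J n` on `[τ n, τ (n + 1))`. -/
def state (M : Switching d Ω) (t : ℝ) (ω : Ω) : Fin d := M.J (M.count t ω) ω

/-- The event `{ε(0) = i}`. -/
def start (M : Switching d Ω) (i : Fin d) : Set Ω := {ω | M.state 0 ω = i}

/-- The event `{ε(0) = i, N(s) = 0}`. -/
def noSwitch (M : Switching d Ω) (i : Fin d) (s : ℝ) : Set Ω := M.start i ∩ {ω | M.count s ω = 0}

/-- `F̄_ij(t) = P(τ₁ > t, ε(τ₁) = j | ε(0) = i)`. -/
def survivalTo (M : Switching d Ω) (P : Measure Ω) (i j : Fin d) (t : ℝ) : ℝ :=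
  (cond P (M.start i)).real {ω | t < M.τ 1 ω ∧ M.J 1 ω = j}

/-- `F̄_i(t) = P(τ₁ > t | ε(0) = i)`. -/
def survival (M : Switching d Ω) (P : Measure Ω) (i : Fin d) (t : ℝ) : ℝ :=
  (cond P (M.start i)).real {ω | t < M.τ 1 ω}

/-- `F̄_ij(t | s) = P(τ₁ > t, ε(τ₁) = j | τ₁ > s, ε(0) = i)`. -/
def condSurvivalTo (M : Switching d Ω) (P : Measure Ω) (i j : Fin d) (s t : ℝ) : ℝ :=
  (cond P (M.start i ∩ {ω | s < M.τ 1 ω})).real {ω | t < M.τ 1 ω ∧ M.J 1 ω = j}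

/-- `F̄_i(t | s) = P(τ₁ > t | τ₁ > s, ε(0) = i)`. -/
def condSurvival (M : Switching d Ω) (P : Measure Ω) (i : Fin d) (s t : ℝ) : ℝ :=
  (cond P (M.start i ∩ {ω | s < M.τ 1 ω})).real {ω | t < M.τ 1 ω}

/-- `f_ij = - dF̄_ij/dt`. -/
def densityTo (M : Switching d Ω) (P : Measure Ω) (i j : Fin d) (t : ℝ) : ℝ :=
  -deriv (M.survivalTo P i j) t

/-- `f_i = - dF̄_i/dt`. -/
def density (M : Switching d Ω) (P : Measure Ω) (i : Fin d) (t : ℝ) : ℝ :=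
  -deriv (M.survival P i) t

/-- `f_ij(t | s) = - ∂F̄_ij(t | s)/∂t`. -/
def condDensityTo (M : Switching d Ω) (P : Measure Ω) (i j : Fin d) (s t : ℝ) : ℝ :=
  -deriv (M.condSurvivalTo P i j s) t

/-- `f_i(t | s) = - ∂F̄_i(t | s)/∂t`. -/
def condDensity (M : Switching d Ω) (P : Measure Ω) (i : Fin d) (s t : ℝ) : ℝ :=
  -deriv (M.condSurvival P i s) t

/-- The information carried by the first `n` switchings. -/
abbrev history (M : Switching d Ω) (n : ℕ) : MeasurableSpace Ω :=
  MeasurableSpace.comap (fun ω (k : Fin (n + 1)) => (M.J k ω, M.τ k ω)) inferInstance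

/-- `ε` is a (time-homogeneous) semi-Markov process: on `{ε(τ n) = i}`, the conditional probability
of `{T (n + 1) > t, ε(τ (n + 1)) = j}` given the first `n` switchings is `F̄_ij(t)`. -/
def IsSemiMarkov (M : Switching d Ω) (P : Measure Ω) : Prop :=
  ∀ (n : ℕ) (i j : Fin d) (t : ℝ), 0 ≤ t → ∀ A : Set Ω, MeasurableSet[M.history n] A →
    P.real (A ∩ {ω | M.J n ω = i} ∩ {ω | t < M.gap n ω ∧ M.J (n + 1) ω = j}) =
      P.real (A ∩ {ω | M.J n ω = i}) * M.survivalTo P i j t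

/-- The piecewise deterministic process `z†(t) = ∑ₙ z_{ε(τ n)}(t - τ n) 1_{[τ n, τ (n + 1))}(t)`. -/
def switched (M : Switching d Ω) (z : Fin d → ℝ → ℝ) (t : ℝ) (ω : Ω) : ℝ :=
  ∑' n, (Set.Ico (M.τ n ω) (M.τ (n + 1) ω)).indicator (fun u => z (M.J n ω) (u - M.τ n ω)) t

/-- The telegraph process `T^c(t) = ∫₀ᵗ c†(u) du`. -/
def telegraph (M : Switching d Ω) (c : Fin d → ℝ → ℝ) (t : ℝ) (ω : Ω) : ℝ :=
  ∫ u in (0 : ℝ)..t, M.switched c u ω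

/-- The jump process `N^h(t) = ∑_{n = 1}^{N(t)} h_{ε(τ (n - 1))}(T n)`. -/
def jump (M : Switching d Ω) (h : Fin d → ℝ → ℝ) (t : ℝ) (ω : Ω) : ℝ :=
  ∑ n ∈ Finset.range (M.count t ω), h (M.J n ω) (M.gap n ω)

end Switching

/-! ### Brownian motion relative to a filtration and the Itô integral -/

/-- `B` is a Brownian motion with respect to the filtration `ℱ`. -/
structure IsFilteredBrownian (ℱ : Filtration ℝ≥0 mΩ) (P : Measure Ω) (B : ℝ≥0 → Ω → ℝ) :
    Prop where
  isBrownian : IsBrownianReal B P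
  adapted : Adapted ℱ B
  indep_increment : ∀ s t : ℝ≥0, s ≤ t →
    Indep (MeasurableSpace.comap (fun ω => B t ω - B s ω) inferInstance) (ℱ s) P

/-- A bounded simple predictable process `∑_{k < n} ξ_k 1_{(p_k, p_{k+1}]}` with `ξ_k` being
`ℱ_{p_k}`-measurable. -/
structure SimplePredictable (ℱ : Filtration ℝ≥0 mΩ) where
  n : ℕ
  p : ℕ → ℝ≥0
  mono : Monotone p
  ξ : ℕ → Ω → ℝ
  measurable_ξ : ∀ k, Measurable[ℱ (p k)] (ξ k)
  bounded_ξ : ∀ k, ∃ C : ℝ, ∀ ω, |ξ k ω| ≤ C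

namespace SimplePredictable

variable {ℱ : Filtration ℝ≥0 mΩ}

def eval (S : SimplePredictable ℱ) (u : ℝ) (ω : Ω) : ℝ :=
  ∑ k ∈ Finset.range S.n, (Set.Ioc (S.p k : ℝ) (S.p (k + 1))).indicator (fun _ => S.ξ k ω) u

/-- `∫₀ᵗ S dB`. -/
def integral (S : SimplePredictable ℱ) (B : ℝ≥0 → Ω → ℝ) (t : ℝ≥0) (ω : Ω) : ℝ :=
  ∑ k ∈ Finset.range S.n, S.ξ k ω * (B (min (S.p (k + 1)) t) ω - B (min (S.p k) t) ω)

end SimplePredictable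

/-- `Y` is (a version of) the Itô integral `∫₀ᵗ H dB`: there are simple predictable processes that
converge to `H` in `L²(P ⊗ du)` on `Ω × (0, t]` and whose integrals converge to `Y` in `L²(P)`.
By the Itô isometry, `Y` is determined by `H` up to almost sure equality. -/
def IsItoIntegral (ℱ : Filtration ℝ≥0 mΩ) (P : Measure Ω) (B : ℝ≥0 → Ω → ℝ)
    (H : ℝ → Ω → ℝ) (t : ℝ≥0) (Y : Ω → ℝ) : Prop :=
  AEStronglyMeasurable Y P ∧
  ∃ S : ℕ → SimplePredictable ℱ,
    Tendsto (fun k => eLpNorm (fun q : Ω × ℝ => (S k).eval q.2 q.1 - H q.2 q.1) 2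
      (P.prod (volume.restrict (Set.Ioc 0 (t : ℝ))))) atTop (𝓝 0) ∧
    Tendsto (fun k => eLpNorm (fun ω => (S k).integral B t ω - Y ω) 2 P) atTop (𝓝 0)

/-! ### The regime switching jump-diffusion process -/

/-- The jump-diffusion process with regime switching `X = T^c + N^h + W^σ`, on the probability space
`(Ω, P)` with the filtration `ℱ`. -/
structure JumpDiffusion (d : ℕ) {Ω : Type*} [mΩ : MeasurableSpace Ω] (P : Measure Ω)
    (ℱ : Filtration ℝ≥0 mΩ) where
  /-- switching times and regimes -/
  M : Switching d Ω
  semiMarkov : M.IsSemiMarkov P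
  adapted_state : Adapted ℱ fun (t : ℝ≥0) ω => M.state t ω
  /-- every initial regime has positive probability, so that one can condition on it -/
  start_ne_zero : ∀ i, P (M.start i) ≠ 0
  differentiable : ∀ i j t, 0 < t → DifferentiableAt ℝ (M.survivalTo P i j) t
  B : ℝ≥0 → Ω → ℝ
  brownian : IsFilteredBrownian ℱ P B
  /-- `B` and `ε` are independent -/
  indep : IndepFun (fun ω (t : ℝ≥0) => B t ω) (fun ω (t : ℝ≥0) => M.state t ω) P
  /-- velocities -/
  c : Fin d → ℝ → ℝ
  /-- jump amplitudes -/
  h : Fin d → ℝ → ℝ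
  /-- diffusion coefficients -/
  σ : Fin d → ℝ → ℝ
  measurable_c : ∀ i, Measurable (c i)
  measurable_h : ∀ i, Measurable (h i)
  measurable_σ : ∀ i, Measurable (σ i)
  integrable_c : ∀ i t, 0 ≤ t → IntervalIntegrable (c i) volume 0 t
  integrable_σ : ∀ i t, 0 ≤ t → IntervalIntegrable (fun u => σ i u ^ 2) volume 0 t
  /-- the Wiener part `W^σ` -/
  W : ℝ → Ω → ℝ
  isIto : ∀ t : ℝ≥0, IsItoIntegral ℱ P B (M.switched σ) t (W t)

namespace JumpDiffusion

variable {P : Measure Ω} {ℱ : Filtration ℝ≥0 mΩ}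

/-- `X(t) = T^c(t) + N^h(t) + W^σ(t)`. -/
def X (D : JumpDiffusion d P ℱ) (t : ℝ) (ω : Ω) : ℝ :=
  D.M.telegraph D.c t ω + D.M.jump D.h t ω + D.W t ω

/-- `μ_i(t) = E[X(t) | ε(0) = i]`. -/
def mean (D : JumpDiffusion d P ℱ) (i : Fin d) (t : ℝ) : ℝ :=
  ∫ ω, D.X t ω ∂(cond P (D.M.start i))

/-- `μ_i(t | s) = E[X(t) | ε(0) = i, N(s) = 0]`. -/
def condMean (D : JumpDiffusion d P ℱ) (i : Fin d) (s t : ℝ) : ℝ :=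
  ∫ ω, D.X t ω ∂(cond P (D.M.noSwitch i s))

/-- `a_i(t) = ∫₀ᵗ (c_i F̄_i + h_i f_i) du`. -/
def a (D : JumpDiffusion d P ℱ) (i : Fin d) (t : ℝ) : ℝ :=
  ∫ u in (0 : ℝ)..t, (D.c i u * D.M.survival P i u + D.h i u * D.M.density P i u)

/-- `a_i(t | s) = ∫₀ˢ c_i du + ∫ₛᵗ (c_i F̄_i(· | s) + h_i f_i(· | s)) du`. -/
def condA (D : JumpDiffusion d P ℱ) (i : Fin d) (s t : ℝ) : ℝ :=
  (∫ u in (0 : ℝ)..s, D.c i u) +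
    ∫ u in s..t, (D.c i u * D.M.condSurvival P i s u + D.h i u * D.M.condDensity P i s u)

/-- The locally integrable functions `m_i` satisfy
`m_i(t) = a_i(t) + ∑_{j ≠ i} ∫₀ᵗ m_j(t - u) f_ij(u) du` for all `t ≥ 0` and all `i`, where all
the integrals exist. -/
structure SolvesVolterra (D : JumpDiffusion d P ℱ) (m : Fin d → ℝ → ℝ) : Prop where
  locallyIntegrable : ∀ i t, 0 ≤ t → IntervalIntegrable (m i) volume 0 t
  integrable : ∀ i j t, j ≠ i → 0 ≤ t →
    IntervalIntegrable (fun u => m j (t - u) * D.M.densityTo P i j u) volume 0 t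
  eq : ∀ i t, 0 ≤ t → m i t = D.a i t +
    ∑ j ∈ Finset.univ.erase i, ∫ u in (0 : ℝ)..t, m j (t - u) * D.M.densityTo P i j u

end JumpDiffusion

end RegimeSwitching

end

set_option linter.unusedSectionVars false

namespace RegimeSwitching

/-! ### Paths of the switching process -/

namespace Switching

variable {d : ℕ} {Ω : Type*} [mΩ : MeasurableSpace Ω] (M : Switching d Ω)

/-! Write X as the switching part T^c + N^h plus the Wiener part W^σ.

Switching part. It is the sum over n of the contributions of the successive sojourns
(`hasSum_sojourn`), the n-th being a function of `J n`, `t - τ n` and `gap n`. The semi-Markov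
hypothesis determines the whole conditional law of the next sojourn and regime
(`semiMarkov_measure`), so expectations are carried from one switching to the previous one by the
renewal operator K (`renew`). There are finitely many regimes and τ 1 > 0, so q = max_i E[exp(-τ 1)
| ε(0) = i] < 1, and K contracts by q for the weighted sup norm with weight exp(-r). Hence the n-th
sojourn contributes at most const · q^n · exp(t) in absolute mean; this gives integrability and
allows termwise integration. The mean is the series of K^n applied to the mean of one sojourn. Over
the event {ε(0) = i, τ 1 > s}, the first sojourn yields the terms in c and h, and the later ones
restart afresh at τ 1 and yield the convolution with the means (`setIntegral_switch`). The case s =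
0 is the Volterra system.

Arbitrary solutions. The difference of two solutions satisfies the homogeneous system. K also
contracts by q in L¹ with weight exp(-t), so the difference vanishes almost everywhere, hence
everywhere, since the right-hand side does not see null sets (`eq_zero_of_renewal`). So m equals μ
on [0, ∞).

Wiener part. With A = {ε(0) = i, N(s) = 0}, the claim is that W(t) has integral zero over A
(`setIntegral_W_noSwitch`). After time s this is the martingale property, as A lies in ℱ_s. Before
s, A need not lie in the past, and independence of B and ε does not make an increment independent of
A jointly with the coefficient multiplying it. But on A the integrand is the deterministic σ_i. From
an approximating simple process S one subtracts the deterministic step function formed by the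
conditional means of its coefficients given A; this leaves the integral over A unchanged, because
increments of B are independent of A. An L² estimate restricted to the time before the first
switching (`setIntegral_sq_le_lintegral`) bounds what remains by the distance there between S and
its mean, and both are close to σ_i (`sq_setIntegral_noSwitch_le`). -/

lemma bddAbove_count (t : ℝ) (ω : Ω) : BddAbove {n | M.τ n ω ≤ t} := by
  obtain ⟨N, hN⟩ := ((M.tendsto_τ ω).eventually_gt_atTop t).exists
  refine ⟨N, fun n (hn : M.τ n ω ≤ t) => ?_⟩
  by_contra! h
  have := (M.strictMono_τ ω) h
  simp only at this
  linarith

lemma le_count_iff {t : ℝ} (ht : 0 ≤ t) (n : ℕ) (ω : Ω) : n ≤ M.count t ω ↔ M.τ n ω ≤ t := by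
  have hne : {n | M.τ n ω ≤ t}.Nonempty := ⟨0, by simp [M.τ_zero, ht]⟩
  have hmem := Nat.sSup_mem hne (M.bddAbove_count t ω)
  constructor
  · intro h
    exact ((M.strictMono_τ ω).monotone h).trans hmem
  · intro h
    exact le_csSup (M.bddAbove_count t ω) h

lemma tau_nonneg (n : ℕ) (ω : Ω) : 0 ≤ M.τ n ω := by
  rw [← M.τ_zero ω]
  exact (M.strictMono_τ ω).monotone (Nat.zero_le n)

lemma tau_lt_succ (n : ℕ) (ω : Ω) : M.τ n ω < M.τ (n + 1) ω := M.strictMono_τ ω (Nat.lt_succ_self n)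

lemma gap_pos (n : ℕ) (ω : Ω) : 0 < M.gap n ω := sub_pos.2 (M.tau_lt_succ n ω)

lemma tau_one_pos (ω : Ω) : 0 < M.τ 1 ω := by
  have := M.tau_lt_succ 0 ω
  rwa [M.τ_zero] at this

lemma gap_zero (ω : Ω) : M.gap 0 ω = M.τ 1 ω := by simp [gap, M.τ_zero]

lemma count_eq_zero_iff {t : ℝ} (ht : 0 ≤ t) (ω : Ω) : M.count t ω = 0 ↔ t < M.τ 1 ω := by
  rw [← not_le, ← M.le_count_iff ht, not_le, Nat.lt_one_iff]

lemma count_eq {t : ℝ} {n : ℕ} {ω : Ω} (h1 : M.τ n ω ≤ t) (h2 : t < M.τ (n + 1) ω) :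
    M.count t ω = n := by
  have ht : 0 ≤ t := (M.tau_nonneg n ω).trans h1
  apply le_antisymm
  · rw [← Nat.lt_succ_iff, ← not_le, M.le_count_iff ht]
    exact not_le.2 h2
  · exact (M.le_count_iff ht n ω).2 h1

lemma state_zero (ω : Ω) : M.state 0 ω = M.J 0 ω := by
  rw [state, (M.count_eq_zero_iff le_rfl ω).2 (M.tau_one_pos ω)]

lemma start_eq (i : Fin d) : M.start i = {ω | M.J 0 ω = i} := by
  simp [start, state_zero]

lemma noSwitch_eq (i : Fin d) {s : ℝ} (hs : 0 ≤ s) :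
    M.noSwitch i s = M.start i ∩ {ω | s < M.τ 1 ω} := by
  simp [noSwitch, M.count_eq_zero_iff hs]

lemma measurableSet_start (i : Fin d) : MeasurableSet (M.start i) := by
  rw [start_eq]
  exact M.measurable_J 0 (measurableSet_singleton i)

lemma measurableSet_tau_gt (s : ℝ) : MeasurableSet {ω | s < M.τ 1 ω} :=
  M.measurable_τ 1 measurableSet_Ioi

lemma measurable_gap (n : ℕ) : Measurable (M.gap n) :=
  (M.measurable_τ (n + 1)).sub (M.measurable_τ n)

lemma switched_apply (z : Fin d → ℝ → ℝ) {n : ℕ} {u : ℝ} {ω : Ω} (h1 : M.τ n ω ≤ u)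
    (h2 : u < M.τ (n + 1) ω) : M.switched z u ω = z (M.J n ω) (u - M.τ n ω) := by
  rw [switched, tsum_eq_single n]
  · exact Set.indicator_of_mem (Set.mem_Ico.2 ⟨h1, h2⟩) _
  · intro k hk
    apply Set.indicator_of_notMem
    rintro ⟨h3, h4⟩
    apply hk
    rw [← M.count_eq h1 h2, M.count_eq h3 h4]

lemma measurable_history_J (n : ℕ) (k : Fin (n + 1)) :
    Measurable[M.history n] (M.J k) := by
  have : Measurable[M.history n] (fun ω (k : Fin (n + 1)) => (M.J k ω, M.τ k ω)) :=
    comap_measurable _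
  exact (measurable_fst.comp (measurable_pi_apply k)).comp this

lemma measurable_history_τ (n : ℕ) (k : Fin (n + 1)) :
    Measurable[M.history n] (M.τ k) := by
  have : Measurable[M.history n] (fun ω (k : Fin (n + 1)) => (M.J k ω, M.τ k ω)) :=
    comap_measurable _
  exact (measurable_snd.comp (measurable_pi_apply k)).comp this

lemma history_le (n : ℕ) : M.history n ≤ mΩ := by
  rw [history, ← measurable_iff_comap_le]
  exact measurable_pi_lambda _ fun k => (M.measurable_J k).prodMk (M.measurable_τ k)

lemma history_mono {m n : ℕ} (h : m ≤ n) : M.history m ≤ M.history n := by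
  rw [history, ← @measurable_iff_comap_le _ _ (M.history n)]
  refine @measurable_pi_lambda _ _ _ (M.history n) _ _ fun k => ?_
  have hk : (k : ℕ) < n + 1 := by omega
  exact (M.measurable_history_J n ⟨k, hk⟩).prodMk (M.measurable_history_τ n ⟨k, hk⟩)

/-! ### Contribution of a single sojourn -/

/-- The contribution to `T^c + N^h` of a sojourn of length `v` in the regime `j`, observed up to
the time `r` after its beginning. -/
noncomputable def sojourn (c h : Fin d → ℝ → ℝ) (j : Fin d) (r v : ℝ) : ℝ :=
  if 0 ≤ r ∧ 0 < v then (∫ u in (0 : ℝ)..min r v, c j u) + if v ≤ r then h j v else 0 else 0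

variable {c h : Fin d → ℝ → ℝ}

lemma intervalIntegrable_of_zero {f : ℝ → ℝ}
    (hf : ∀ t, 0 ≤ t → IntervalIntegrable f volume 0 t) {a b : ℝ} (ha : 0 ≤ a) (hb : 0 ≤ b) :
    IntervalIntegrable f volume a b := (hf a ha).symm.trans (hf b hb)

lemma integral_switched (hc : ∀ i t, 0 ≤ t → IntervalIntegrable (c i) volume 0 t) (n : ℕ) (ω : Ω)
    {x : ℝ} (h1 : M.τ n ω ≤ x) (h2 : x ≤ M.τ (n + 1) ω) :
    IntervalIntegrable (fun u => M.switched c u ω) volume (M.τ n ω) x ∧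
      ∫ u in (M.τ n ω)..x, M.switched c u ω = ∫ u in (0 : ℝ)..(x - M.τ n ω), c (M.J n ω) u := by
  have hae : ∀ᵐ u ∂volume, u ∈ Set.uIoc (M.τ n ω) x →
      c (M.J n ω) (u - M.τ n ω) = M.switched c u ω := by
    -- If `x = τ (n + 1)` the regime has already changed at `x`; this single point is discarded.
    have : ∀ᵐ u : ℝ ∂volume, u ≠ x := by simp [ae_iff]
    filter_upwards [this] with u hu hmem
    rw [Set.uIoc_of_le h1] at hmem
    rw [M.switched_apply c hmem.1.le ((lt_of_le_of_ne hmem.2 hu).trans_le h2)]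
  have hi : IntervalIntegrable (fun u => c (M.J n ω) (u - M.τ n ω)) volume (M.τ n ω) x := by
    have := (hc (M.J n ω) (x - M.τ n ω) (sub_nonneg.2 h1)).comp_sub_right (M.τ n ω)
    simpa using this
  constructor
  · exact hi.congr_ae ((ae_restrict_iff' measurableSet_uIoc).2 hae)
  · rw [← intervalIntegral.integral_congr_ae hae, intervalIntegral.integral_comp_sub_right]
    simp

lemma integral_switched_tau (hc : ∀ i t, 0 ≤ t → IntervalIntegrable (c i) volume 0 t) (n : ℕ)
    (ω : Ω) :
    IntervalIntegrable (fun u => M.switched c u ω) volume 0 (M.τ n ω) ∧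
      ∫ u in (0 : ℝ)..(M.τ n ω), M.switched c u ω =
        ∑ k ∈ Finset.range n, ∫ u in (0 : ℝ)..(M.gap k ω), c (M.J k ω) u := by
  induction n with
  | zero => simp [M.τ_zero]
  | succ n ih =>
    obtain ⟨h1, h2⟩ := M.integral_switched hc n ω (M.tau_lt_succ n ω).le le_rfl
    refine ⟨ih.1.trans h1, ?_⟩
    rw [← intervalIntegral.integral_add_adjacent_intervals ih.1 h1, ih.2, h2, Finset.sum_range_succ]
    rfl

lemma sojourn_eq_zero {j : Fin d} {r v : ℝ} (hr : r < 0) : sojourn c h j r v = 0 := by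
  simp [sojourn, not_le.2 hr]

/-- Cut [0, t] at the switching times: the first N(t) sojourns are complete and end with their jump,
while the current one is truncated at t and carries none. -/
lemma telegraph_add_jump (hc : ∀ i t, 0 ≤ t → IntervalIntegrable (c i) volume 0 t) {t : ℝ}
    (ht : 0 ≤ t) (ω : Ω) :
    M.telegraph c t ω + M.jump h t ω =
      ∑ n ∈ Finset.range (M.count t ω + 1), sojourn c h (M.J n ω) (t - M.τ n ω) (M.gap n ω) := by
  set N := M.count t ω with hN
  have h1 : M.τ N ω ≤ t := (M.le_count_iff ht N ω).1 le_rfl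
  have h2 : t < M.τ (N + 1) ω := by
    rw [← not_le, ← M.le_count_iff ht]; omega
  obtain ⟨ha, hb⟩ := M.integral_switched hc N ω h1 h2.le
  obtain ⟨hc', hd⟩ := M.integral_switched_tau hc N ω
  rw [telegraph, jump, ← hN, ← intervalIntegral.integral_add_adjacent_intervals hc' ha, hb, hd,
    Finset.sum_range_succ, add_right_comm, ← Finset.sum_add_distrib]
  congr 1
  · refine Finset.sum_congr rfl fun k hk => ?_
    have hk' : M.τ (k + 1) ω ≤ t :=
      (M.le_count_iff ht _ ω).1 (Nat.succ_le_of_lt (Finset.mem_range.1 hk))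
    have hg : M.gap k ω ≤ t - M.τ k ω := by rw [gap]; linarith
    rw [sojourn, if_pos ⟨(M.gap_pos k ω).le.trans hg, M.gap_pos k ω⟩, min_eq_right hg, if_pos hg]
  · have hg : t - M.τ N ω < M.gap N ω := by rw [gap]; linarith
    rw [sojourn, if_pos ⟨sub_nonneg.2 h1, M.gap_pos N ω⟩, min_eq_left hg.le, if_neg (not_le.2 hg), add_zero]

/-- A sojourn that begins after t contributes 0, so the sum with a random number of terms becomes a
series over all n, ready for termwise integration. -/
lemma hasSum_sojourn (hc : ∀ i t, 0 ≤ t → IntervalIntegrable (c i) volume 0 t) {t : ℝ}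
    (ht : 0 ≤ t) (ω : Ω) :
    HasSum (fun n => sojourn c h (M.J n ω) (t - M.τ n ω) (M.gap n ω))
      (M.telegraph c t ω + M.jump h t ω) := by
  rw [M.telegraph_add_jump hc ht]
  apply hasSum_sum_of_ne_finset_zero
  intro n hn
  apply sojourn_eq_zero
  rw [Finset.mem_range, not_lt, Nat.succ_le_iff, ← not_le, M.le_count_iff ht] at hn
  linarith

/-- Integrability is known on the half-line only, hence the cut-off `max x 0`; the integral is then
continuous in `x`. -/
lemma measurable_primitive {f : ℝ → ℝ} (hf : ∀ t, 0 ≤ t → IntervalIntegrable f volume 0 t) :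
    Measurable fun x => ∫ u in (0 : ℝ)..max x 0, f u := by
  have hcont : ∀ T, 0 ≤ T → ContinuousOn (fun x => ∫ u in (0 : ℝ)..x, f u) (Set.Icc 0 T) := by
    intro T hT
    have := intervalIntegral.continuousOn_primitive_interval (μ := volume) (f := f) (a := 0) (b := T)
      (by rw [Set.uIcc_of_le hT]; exact (intervalIntegrable_iff_integrableOn_Icc_of_le hT).1 (hf T hT))
    rwa [Set.uIcc_of_le hT] at this
  have : Continuous fun x => ∫ u in (0 : ℝ)..max x 0, f u := by
    rw [continuous_iff_continuousAt]
    intro x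
    have hT : (0 : ℝ) ≤ max x 0 + 1 := by positivity
    have h1 : ContinuousOn (fun x => ∫ u in (0 : ℝ)..max x 0, f u) (Set.Iic (max x 0 + 1)) := by
      refine (hcont _ hT).comp (continuous_id.max continuous_const).continuousOn ?_
      intro y hy
      exact ⟨le_max_right _ _, max_le hy hT⟩
    exact h1.continuousAt (Iic_mem_nhds (by linarith [le_max_left x 0]))
  exact this.measurable

lemma measurable_sojourn (hc : ∀ i t, 0 ≤ t → IntervalIntegrable (c i) volume 0 t)
    (hh : ∀ i, Measurable (h i)) (j : Fin d) :
    Measurable fun q : ℝ × ℝ => sojourn c h j q.1 q.2 := by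
  have : (fun q : ℝ × ℝ => sojourn c h j q.1 q.2) =
      fun q : ℝ × ℝ => if 0 ≤ q.1 ∧ 0 < q.2 then
        (∫ u in (0 : ℝ)..max (min q.1 q.2) 0, c j u) + if q.2 ≤ q.1 then h j q.2 else 0 else 0 := by
    ext q
    by_cases hq : 0 ≤ q.1 ∧ 0 < q.2
    · rw [sojourn, if_pos hq, if_pos hq, max_eq_left (le_min hq.1 hq.2.le)]
    · rw [sojourn, if_neg hq, if_neg hq]
  rw [this]
  refine Measurable.ite ((measurableSet_le measurable_const measurable_fst).inter
    (measurableSet_lt measurable_const measurable_snd)) ?_ measurable_const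
  refine Measurable.add ?_ ?_
  · exact (measurable_primitive (hc j)).comp (measurable_fst.min measurable_snd)
  · exact Measurable.ite (measurableSet_le measurable_snd measurable_fst)
      ((hh j).comp measurable_snd) measurable_const

end Switching

end RegimeSwitching

namespace RegimeSwitching

/-! ### Measures determined by their survival functions -/

/-- Only t ≥ 0 is available from the semi-Markov property; the absence of mass on (-∞, 0] supplies
the rest. -/
lemma ext_of_Ioi_pos {μ ν : Measure ℝ} [IsFiniteMeasure μ] (hμ : μ (Set.Iic 0) = 0)
    (hν : ν (Set.Iic 0) = 0) (h : ∀ t, 0 ≤ t → μ (Set.Ioi t) = ν (Set.Ioi t)) : μ = ν := by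
  have huniv : ∀ κ : Measure ℝ, κ (Set.Iic 0) = 0 → κ Set.univ = κ (Set.Ioi 0) := by
    intro κ hκ
    rw [← measure_add_measure_compl (measurableSet_Iic (a := (0 : ℝ))), hκ, zero_add, Set.compl_Iic]
  have htot : μ Set.univ = ν Set.univ := by rw [huniv μ hμ, huniv ν hν, h 0 le_rfl]
  have hfin : IsFiniteMeasure ν := ⟨by rw [← htot]; exact measure_lt_top _ _⟩
  apply Measure.ext_of_Iic
  intro a
  rcases lt_or_ge a 0 with ha | ha
  · rw [measure_mono_null (Set.Iic_subset_Iic.2 ha.le) hμ,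
      measure_mono_null (Set.Iic_subset_Iic.2 ha.le) hν]
  · rw [← Set.compl_Ioi, measure_compl measurableSet_Ioi (measure_ne_top _ _),
      measure_compl measurableSet_Ioi (measure_ne_top _ _), htot, h a ha]

lemma ext_of_Ioi_pos_prod {d : ℕ} {μ ν : Measure (ℝ × Fin d)} [IsFiniteMeasure μ]
    (hμ : μ (Set.Iic 0 ×ˢ Set.univ) = 0) (hν : ν (Set.Iic 0 ×ˢ Set.univ) = 0)
    (h : ∀ t j, 0 ≤ t → μ (Set.Ioi t ×ˢ {j}) = ν (Set.Ioi t ×ˢ {j})) : μ = ν := by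
  have key : ∀ j (S : Set ℝ), MeasurableSet S → μ (S ×ˢ {j}) = ν (S ×ˢ {j}) := by
    intro j S hS
    have hrep : ∀ κ : Measure (ℝ × Fin d), ∀ T : Set ℝ, MeasurableSet T →
        (κ.restrict (Prod.snd ⁻¹' {j})).map Prod.fst T = κ (T ×ˢ {j}) := by
      intro κ T hT
      rw [Measure.map_apply measurable_fst hT, Measure.restrict_apply (measurable_fst hT)]
      rfl
    have hz : ∀ κ : Measure (ℝ × Fin d), κ (Set.Iic 0 ×ˢ Set.univ) = 0 →
        (κ.restrict (Prod.snd ⁻¹' {j})).map Prod.fst (Set.Iic 0) = 0 := by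
      intro κ hκ
      rw [hrep κ _ measurableSet_Iic]
      exact measure_mono_null (Set.prod_mono le_rfl (Set.subset_univ _)) hκ
    have := ext_of_Ioi_pos (hz μ hμ) (hz ν hν) fun t ht => by
      rw [hrep μ _ measurableSet_Ioi, hrep ν _ measurableSet_Ioi, h t j ht]
    rw [← hrep μ _ hS, ← hrep ν _ hS, this]
  ext S hS
  have hS' : S = ⋃ j, {x | (x, j) ∈ S} ×ˢ {j} := by
    ext ⟨x, j⟩
    simp
  have hdisj : Pairwise (Function.onFun Disjoint fun j : Fin d => {x | (x, j) ∈ S} ×ˢ {j}) := by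
    intro j k hjk
    rw [Function.onFun, Set.disjoint_left]
    rintro ⟨x, l⟩ ⟨-, h1⟩ ⟨-, h2⟩
    exact hjk (h1.symm.trans h2)
  have hm : ∀ j, MeasurableSet {x | (x, j) ∈ S} := fun j => measurable_prodMk_right hS
  rw [hS', measure_iUnion hdisj fun j => (hm j).prod (measurableSet_singleton j),
    measure_iUnion hdisj fun j => (hm j).prod (measurableSet_singleton j)]
  exact tsum_congr fun j => key j _ (hm j)

/-- A finite measure on `(0, ∞)` with differentiable survival function has a density. -/
lemma eq_withDensity_of_differentiable {ν : Measure ℝ} [IsFiniteMeasure ν]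
    (h0 : ν (Set.Iic 0) = 0) {G : ℝ → ℝ} (hG : ∀ t, G t = ν.real (Set.Ioi t))
    (hd : ∀ t, 0 < t → DifferentiableAt ℝ G t) :
    ν = (volume.restrict (Set.Ioi 0)).withDensity fun t => ENNReal.ofReal (-deriv G t) := by
  have hanti : Antitone G := fun a b hab => by
    rw [hG, hG]
    exact measureReal_mono (Set.Ioi_subset_Ioi hab)
  have hneg : ∀ t, deriv G t ≤ 0 := fun t => hanti.deriv_nonpos
  have hIic : ∀ x, G x = ν.real Set.univ - ν.real (Set.Iic x) := by
    intro x
    rw [hG, ← Set.compl_Iic, measureReal_compl measurableSet_Iic]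
  -- Right continuity holds for every survival function; it replaces differentiability at the
  -- endpoint 0, where none is assumed.
  have hright : ∀ a, ContinuousWithinAt G (Set.Ici a) a := by
    intro a
    rw [← continuousWithinAt_Ioi_iff_Ici]
    have h1 : Tendsto (fun x => ν (Set.Iic x)) (𝓝[>] a) (𝓝 (ν (Set.Iic a))) := by
      have := tendsto_measure_biInter_gt (μ := ν) (s := fun x : ℝ => Set.Iic x) (a := a)
        (fun r _ => nullMeasurableSet_Iic) (fun i j _ hij => Set.Iic_subset_Iic.2 hij)
        ⟨a + 1, by simp, measure_ne_top _ _⟩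
      have hi : ⋂ r > a, Set.Iic r = Set.Iic a := by
        ext x
        simpa using ⟨fun h => le_of_forall_gt_imp_ge_of_dense h, fun h r hr => h.trans hr.le⟩
      rwa [hi] at this
    rw [ContinuousWithinAt, funext hIic]
    exact tendsto_const_nhds.sub ((ENNReal.tendsto_toReal (measure_ne_top ν _)).comp h1)
  have htop : Tendsto G atTop (𝓝 0) := by
    rw [funext hIic, ← sub_self (ν.real Set.univ)]
    exact tendsto_const_nhds.sub
      ((ENNReal.tendsto_toReal (measure_ne_top ν _)).comp (tendsto_measure_Iic_atTop ν))
  apply ext_of_Ioi_pos h0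
  · rw [withDensity_apply _ measurableSet_Iic, Measure.restrict_restrict measurableSet_Iic,
      Set.Iic_inter_Ioi, Set.Ioc_self, Measure.restrict_empty, lintegral_zero_measure]
  · intro t ht
    have hsub : Set.Ioi t ∩ Set.Ioi (0 : ℝ) = Set.Ioi t :=
      Set.inter_eq_left.2 (Set.Ioi_subset_Ioi ht)
    have hder : ∀ x ∈ Set.Ioi t, HasDerivAt G (deriv G x) x := fun x hx =>
      (hd x (ht.trans_lt hx)).hasDerivAt
    -- A derivative of constant sign is automatically integrable, and the fundamental theorem of
    -- calculus on (t, ∞) then needs no continuity of `deriv G`.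
    have hint := integrableOn_Ioi_deriv_of_nonpos (hright t) hder (fun x _ => hneg x) htop
    have heq := integral_Ioi_of_hasDerivAt_of_nonpos (hright t) hder (fun x _ => hneg x) htop
    rw [withDensity_apply _ measurableSet_Ioi, Measure.restrict_restrict measurableSet_Ioi, hsub,
      ← ofReal_integral_eq_lintegral_ofReal (f := fun x => -deriv G x) hint.neg
        (Eventually.of_forall fun x => neg_nonneg.2 (hneg x)), integral_neg, heq, zero_sub, neg_neg, hG, ofReal_measureReal]

/-! ### The law of one switching and the semi-Markov property for general events -/

namespace Switching

variable {d : ℕ} {Ω : Type*} [mΩ : MeasurableSpace Ω] (M : Switching d Ω)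

/-- The law of `(τ 1, ε(τ 1))` given `ε(0) = i`. -/
noncomputable def stepLaw (P : Measure Ω) (i : Fin d) : Measure (ℝ × Fin d) :=
  (cond P (M.start i)).map fun ω => (M.τ 1 ω, M.J 1 ω)

variable {M} {P : Measure Ω} [IsProbabilityMeasure P]

lemma measurable_step : Measurable fun ω => (M.τ 1 ω, M.J 1 ω) :=
  (M.measurable_τ 1).prodMk (M.measurable_J 1)

lemma isProbabilityMeasure_stepLaw {i : Fin d} (hi : P (M.start i) ≠ 0) :
    IsProbabilityMeasure (M.stepLaw P i) := by
  have := cond_isProbabilityMeasure hi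
  exact Measure.isProbabilityMeasure_map measurable_step.aemeasurable

instance (i : Fin d) : IsFiniteMeasure (M.stepLaw P i) := by
  unfold stepLaw
  infer_instance

lemma stepLaw_nonpos (i : Fin d) : M.stepLaw P i (Set.Iic 0 ×ˢ Set.univ) = 0 := by
  rw [stepLaw, Measure.map_apply measurable_step (measurableSet_Iic.prod MeasurableSet.univ)]
  have : (fun ω => (M.τ 1 ω, M.J 1 ω)) ⁻¹' (Set.Iic 0 ×ˢ Set.univ) = ∅ := by
    ext ω
    simpa using M.tau_one_pos ω
  rw [this, measure_empty]

lemma stepLaw_ae_pos (i : Fin d) : ∀ᵐ p ∂M.stepLaw P i, 0 < p.1 := by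
  rw [ae_iff]
  convert stepLaw_nonpos (M := M) (P := P) i using 2
  ext p
  simp

lemma stepLaw_Ioi (i j : Fin d) (t : ℝ) :
    M.stepLaw P i (Set.Ioi t ×ˢ {j}) = ENNReal.ofReal (M.survivalTo P i j t) := by
  rw [stepLaw, Measure.map_apply measurable_step (measurableSet_Ioi.prod (measurableSet_singleton j)),
    survivalTo, ofReal_measureReal]
  rfl

/-- The hypothesis covers only the sets (t, ∞) × {j}. Both sides, as functions of `S`, are measures
without mass at nonpositive times, and such finite measures are determined by these sets. -/
lemma semiMarkov_measure (hM : M.IsSemiMarkov P) (n : ℕ) (i : Fin d) {E : Set Ω}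
    (hE : MeasurableSet[M.history n] E) {S : Set (ℝ × Fin d)} (hS : MeasurableSet S) :
    P (E ∩ M.J n ⁻¹' {i} ∩ {ω | (M.gap n ω, M.J (n + 1) ω) ∈ S}) =
      P (E ∩ M.J n ⁻¹' {i}) * M.stepLaw P i S := by
  have hE' : MeasurableSet (E ∩ M.J n ⁻¹' {i}) :=
    (M.history_le n _ hE).inter (M.measurable_J n (measurableSet_singleton i))
  have hmeas : Measurable fun ω => (M.gap n ω, M.J (n + 1) ω) :=
    (M.measurable_gap n).prodMk (M.measurable_J (n + 1))
  have hap : ∀ T : Set (ℝ × Fin d), MeasurableSet T →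
      ((P.restrict (E ∩ M.J n ⁻¹' {i})).map fun ω => (M.gap n ω, M.J (n + 1) ω)) T =
        P (E ∩ M.J n ⁻¹' {i} ∩ {ω | (M.gap n ω, M.J (n + 1) ω) ∈ T}) := by
    intro T hT
    rw [Measure.map_apply hmeas hT, Measure.restrict_apply (hmeas hT), Set.inter_comm]
    rfl
  have : ((P.restrict (E ∩ M.J n ⁻¹' {i})).map fun ω => (M.gap n ω, M.J (n + 1) ω)) =
      P (E ∩ M.J n ⁻¹' {i}) • M.stepLaw P i := by
    apply ext_of_Ioi_pos_prod
    · rw [hap _ (measurableSet_Iic.prod MeasurableSet.univ)]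
      have : E ∩ M.J n ⁻¹' {i} ∩ {ω | (M.gap n ω, M.J (n + 1) ω) ∈ Set.Iic 0 ×ˢ Set.univ} = ∅ := by
        ext ω
        simp [M.gap_pos n ω]
      rw [this, measure_empty]
    · simp [stepLaw_nonpos]
    · intro t j ht
      rw [hap _ (measurableSet_Ioi.prod (measurableSet_singleton j)), Measure.smul_apply, stepLaw_Ioi,
        smul_eq_mul, ← ofReal_measureReal, ← ofReal_measureReal,
        ← ENNReal.ofReal_mul measureReal_nonneg]
      congr 1
      exact hM n i j t ht E hE
  rw [← hap S hS, this, Measure.smul_apply, smul_eq_mul]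

/-- `τ n` belongs to the history, so adding {τ n ∈ A} to `E` in `semiMarkov_measure` gives the
product formula on rectangles. -/
lemma map_step_eq_prod (hM : M.IsSemiMarkov P) (n : ℕ) (i : Fin d) {E : Set Ω}
    (hE : MeasurableSet[M.history n] E) :
    ((P.restrict (E ∩ M.J n ⁻¹' {i})).map fun ω => (M.τ n ω, (M.gap n ω, M.J (n + 1) ω))) =
      ((P.restrict (E ∩ M.J n ⁻¹' {i})).map (M.τ n)).prod (M.stepLaw P i) := by
  symm
  apply Measure.prod_eq
  intro A S hA hS
  have hmeas : Measurable fun ω => (M.gap n ω, M.J (n + 1) ω) :=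
    (M.measurable_gap n).prodMk (M.measurable_J (n + 1))
  have hτ : MeasurableSet[M.history n] (M.τ n ⁻¹' A) := by
    have := M.measurable_history_τ n (Fin.last n)
    exact this hA
  rw [Measure.map_apply ((M.measurable_τ n).prodMk hmeas) (hA.prod hS),
    Measure.map_apply (M.measurable_τ n) hA, Measure.restrict_apply (M.measurable_τ n hA),
    Measure.restrict_apply (((M.measurable_τ n).prodMk hmeas) (hA.prod hS))]
  have h1 := semiMarkov_measure hM n i (hE.inter hτ) hS
  have e1 : E ∩ M.τ n ⁻¹' A ∩ M.J n ⁻¹' {i} = M.τ n ⁻¹' A ∩ (E ∩ M.J n ⁻¹' {i}) := by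
    ext ω; simp only [Set.mem_inter_iff]; tauto
  rw [e1] at h1
  rw [← h1]
  congr 1
  ext ω
  simp only [Set.mem_inter_iff, Set.mem_preimage, Set.mem_prod, Set.mem_ofPred_eq]
  tauto

section Step

variable {n : ℕ} {E : Set Ω}

lemma iUnion_inter_J (n : ℕ) (E : Set Ω) : (⋃ i, E ∩ M.J n ⁻¹' {i}) = E := by
  ext ω; simp

lemma pairwise_disjoint_inter_J (n : ℕ) (E : Set Ω) :
    Pairwise (Function.onFun Disjoint fun i => E ∩ M.J n ⁻¹' {i}) := by
  intro j k hjk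
  rw [Function.onFun, Set.disjoint_left]
  rintro ω ⟨-, h1⟩ ⟨-, h2⟩
  exact hjk (h1.symm.trans h2)

/-- Integrates out the step after `τ n`: on each piece {J n = i} the joint law of `τ n` and the step
is a product, and Tonelli applies. -/
lemma setLIntegral_step (hM : M.IsSemiMarkov P) (hE : MeasurableSet[M.history n] E)
    {F : Fin d → ℝ → ℝ × Fin d → ℝ≥0∞} (hF : ∀ i, Measurable fun q : ℝ × (ℝ × Fin d) => F i q.1 q.2) :
    ∫⁻ ω in E, F (M.J n ω) (M.τ n ω) (M.gap n ω, M.J (n + 1) ω) ∂P =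
      ∫⁻ ω in E, ∫⁻ p, F (M.J n ω) (M.τ n ω) p ∂M.stepLaw P (M.J n ω) ∂P := by
  have hm : ∀ i, MeasurableSet (E ∩ M.J n ⁻¹' {i}) := fun i =>
    (M.history_le n _ hE).inter (M.measurable_J n (measurableSet_singleton i))
  rw [← iUnion_inter_J (M := M) n E, lintegral_iUnion hm (pairwise_disjoint_inter_J n E),
    lintegral_iUnion hm (pairwise_disjoint_inter_J n E)]
  refine tsum_congr fun i => ?_
  rw [setLIntegral_congr_fun (f := fun ω => F (M.J n ω) (M.τ n ω) (M.gap n ω, M.J (n + 1) ω))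
      (g := fun ω => F i (M.τ n ω) (M.gap n ω, M.J (n + 1) ω)) (hm i)
      (fun ω hω => by have : M.J n ω = i := hω.2
                      simp only [this]),
    setLIntegral_congr_fun (f := fun ω => ∫⁻ p, F (M.J n ω) (M.τ n ω) p ∂M.stepLaw P (M.J n ω))
      (g := fun ω => ∫⁻ p, F i (M.τ n ω) p ∂M.stepLaw P i) (hm i)
      (fun ω hω => by have : M.J n ω = i := hω.2
                      simp only [this])]
  have hmeas : Measurable fun ω => (M.τ n ω, (M.gap n ω, M.J (n + 1) ω)) :=
    (M.measurable_τ n).prodMk ((M.measurable_gap n).prodMk (M.measurable_J (n + 1)))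
  rw [← lintegral_map (f := fun q : ℝ × (ℝ × Fin d) => F i q.1 q.2) (hF i) hmeas, map_step_eq_prod hM n i hE, lintegral_prod _ (hF i).aemeasurable,
    lintegral_map ((hF i).lintegral_prod_right') (M.measurable_τ n)]

lemma setIntegral_step (hM : M.IsSemiMarkov P) (hE : MeasurableSet[M.history n] E)
    {F : Fin d → ℝ → ℝ × Fin d → ℝ} (hF : ∀ i, Measurable fun q : ℝ × (ℝ × Fin d) => F i q.1 q.2)
    (hi : IntegrableOn (fun ω => F (M.J n ω) (M.τ n ω) (M.gap n ω, M.J (n + 1) ω)) E P) :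
    ∫ ω in E, F (M.J n ω) (M.τ n ω) (M.gap n ω, M.J (n + 1) ω) ∂P =
      ∫ ω in E, ∫ p, F (M.J n ω) (M.τ n ω) p ∂M.stepLaw P (M.J n ω) ∂P := by
  have hm : ∀ i, MeasurableSet (E ∩ M.J n ⁻¹' {i}) := fun i =>
    (M.history_le n _ hE).inter (M.measurable_J n (measurableSet_singleton i))
  have hmeas : Measurable fun ω => (M.τ n ω, (M.gap n ω, M.J (n + 1) ω)) :=
    (M.measurable_τ n).prodMk ((M.measurable_gap n).prodMk (M.measurable_J (n + 1)))
  have hi' : ∀ i, Integrable (fun q : ℝ × (ℝ × Fin d) => F i q.1 q.2)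
      (((P.restrict (E ∩ M.J n ⁻¹' {i})).map (M.τ n)).prod (M.stepLaw P i)) := by
    intro i
    rw [← map_step_eq_prod hM n i hE,
      integrable_map_measure (hF i).aestronglyMeasurable hmeas.aemeasurable]
    refine IntegrableOn.congr_fun (hi.mono_set Set.inter_subset_left) (fun ω hω => ?_) (hm i)
    have : M.J n ω = i := hω.2
    simp only [this, Function.comp]
  have hc1 : ∀ i, ∫ ω in E ∩ M.J n ⁻¹' {i}, ∫ p, F (M.J n ω) (M.τ n ω) p
      ∂M.stepLaw P (M.J n ω) ∂P =
      ∫ ω in E ∩ M.J n ⁻¹' {i}, ∫ p, F i (M.τ n ω) p ∂M.stepLaw P i ∂P := fun i =>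
    setIntegral_congr_fun (hm i) fun ω hω => by
      have : M.J n ω = i := hω.2
      simp only [this]
  have hsm : ∀ i, StronglyMeasurable fun x => ∫ p, F i x p ∂M.stepLaw P i := fun i =>
    (hF i).stronglyMeasurable.integral_prod_right'
  have hiR : IntegrableOn (fun ω => ∫ p, F (M.J n ω) (M.τ n ω) p ∂M.stepLaw P (M.J n ω))
      (⋃ i, E ∩ M.J n ⁻¹' {i}) P := by
    rw [integrableOn_finite_iUnion]
    intro i
    have h1 := (hi' i).integral_prod_left
    rw [integrable_map_measure (hsm i).aestronglyMeasurable (M.measurable_τ n).aemeasurable] at h1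
    refine IntegrableOn.congr_fun h1 (fun ω hω => ?_) (hm i)
    have : M.J n ω = i := hω.2
    simp only [this, Function.comp]
  rw [← iUnion_inter_J (M := M) n E] at hi
  conv_lhs => rw [← iUnion_inter_J (M := M) n E]
  conv_rhs => rw [← iUnion_inter_J (M := M) n E]
  rw [integral_iUnion hm (pairwise_disjoint_inter_J n E) hi,
    integral_iUnion hm (pairwise_disjoint_inter_J n E) hiR]
  refine tsum_congr fun i => ?_
  rw [hc1, setIntegral_congr_fun (g := fun ω => F i (M.τ n ω) (M.gap n ω, M.J (n + 1) ω)) (hm i)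
      (fun ω hω => by have : M.J n ω = i := hω.2
                      simp only [this]),
    ← integral_map (f := fun q : ℝ × (ℝ × Fin d) => F i q.1 q.2) hmeas.aemeasurable
      (hF i).aestronglyMeasurable, map_step_eq_prod hM n i hE, integral_prod _ (hi' i),
    integral_map (M.measurable_τ n).aemeasurable (hsm i).aestronglyMeasurable]

end Step

/-! ### The density of the law of the first switching -/

variable (M P) in
/-- The law of `τ 1` on `{ε(τ 1) = j}`, given `ε(0) = i`. -/
noncomputable def densityLaw (i j : Fin d) : Measure ℝ :=
  (volume.restrict (Set.Ioi 0)).withDensity fun t => ENNReal.ofReal (M.densityTo P i j t)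

lemma survivalTo_antitone (i j : Fin d) : Antitone (M.survivalTo P i j) := by
  intro a b hab
  exact measureReal_mono (fun ω hω => ⟨hab.trans_lt hω.1, hω.2⟩)

lemma densityTo_nonneg (i j : Fin d) (t : ℝ) : 0 ≤ M.densityTo P i j t :=
  neg_nonneg.2 (survivalTo_antitone i j).deriv_nonpos

lemma measurable_densityTo (i j : Fin d) : Measurable (M.densityTo P i j) :=
  (measurable_deriv _).neg

/-- Every switching changes the regime; this is why the sums in the system run over j ≠ i only. -/
lemma survivalTo_self (i : Fin d) (t : ℝ) : M.survivalTo P i i t = 0 := by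
  rw [survivalTo, measureReal_def, cond_apply (M.measurableSet_start i), start_eq]
  have : {ω | M.J 0 ω = i} ∩ {ω | t < M.τ 1 ω ∧ M.J 1 ω = i} = ∅ := by
    ext ω
    simp only [Set.mem_inter_iff, Set.mem_ofPred_eq, Set.mem_empty_iff_false, iff_false]
    rintro ⟨h1, -, h2⟩
    exact M.J_succ_ne 0 ω (h2.trans h1.symm)
  simp [this]

lemma densityTo_self (i : Fin d) (t : ℝ) : M.densityTo P i i t = 0 := by
  have : M.survivalTo P i i = fun _ => 0 := funext (survivalTo_self i)
  simp [densityTo, this]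

/-- Differentiability of F̄_ij on (0, ∞) rules out a singular part and atoms. -/
lemma densityLaw_eq (hd : ∀ i j t, 0 < t → DifferentiableAt ℝ (M.survivalTo P i j) t)
    (i j : Fin d) :
    ((M.stepLaw P i).restrict (Prod.snd ⁻¹' {j})).map Prod.fst = M.densityLaw P i j := by
  have hap : ∀ T : Set ℝ, MeasurableSet T →
      ((M.stepLaw P i).restrict (Prod.snd ⁻¹' {j})).map Prod.fst T =
        M.stepLaw P i (T ×ˢ {j}) := by
    intro T hT
    rw [Measure.map_apply measurable_fst hT, Measure.restrict_apply (measurable_fst hT)]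
    rfl
  apply eq_withDensity_of_differentiable _ _ (hd i j)
  · rw [hap _ measurableSet_Iic]
    exact measure_mono_null (Set.prod_mono le_rfl (Set.subset_univ _)) (stepLaw_nonpos i)
  · intro t
    rw [measureReal_def, hap _ measurableSet_Ioi, stepLaw_Ioi,
      ENNReal.toReal_ofReal (by exact measureReal_nonneg)]

lemma lintegral_stepLaw (hd : ∀ i j t, 0 < t → DifferentiableAt ℝ (M.survivalTo P i j) t)
    (i : Fin d) {g : ℝ × Fin d → ℝ≥0∞} (hg : Measurable g) :
    ∫⁻ p, g p ∂M.stepLaw P i = ∑ j, ∫⁻ v, g (v, j) ∂M.densityLaw P i j := by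
  have hm : ∀ j : Fin d, MeasurableSet (Prod.snd ⁻¹' {j} : Set (ℝ × Fin d)) := fun j =>
    measurable_snd (measurableSet_singleton j)
  have hU : (⋃ j : Fin d, (Prod.snd ⁻¹' {j} : Set (ℝ × Fin d))) = Set.univ := by
    ext; simp
  have hdisj : Pairwise (Function.onFun Disjoint fun j : Fin d =>
      (Prod.snd ⁻¹' {j} : Set (ℝ × Fin d))) := by
    intro j k hjk
    rw [Function.onFun, Set.disjoint_left]
    intro p h1 h2
    exact hjk (h1.symm.trans h2)
  rw [← setLIntegral_univ, ← hU, lintegral_iUnion hm hdisj, tsum_fintype]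
  refine Finset.sum_congr rfl fun j _ => ?_
  rw [← densityLaw_eq hd, lintegral_map (by fun_prop) measurable_fst]
  refine setLIntegral_congr_fun (hm j) fun p hp => ?_
  have : p.2 = j := hp
  simp only [← this]

lemma integrable_densityLaw (hd : ∀ i j t, 0 < t → DifferentiableAt ℝ (M.survivalTo P i j) t)
    (i j : Fin d) {g : ℝ × Fin d → ℝ} (hg : Measurable g) (hi : Integrable g (M.stepLaw P i)) :
    Integrable (fun v => g (v, j)) (M.densityLaw P i j) := by
  have hm : MeasurableSet (Prod.snd ⁻¹' {j} : Set (ℝ × Fin d)) :=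
    measurable_snd (measurableSet_singleton j)
  rw [← densityLaw_eq hd, integrable_map_measure
    (show Measurable fun v => g (v, j) from hg.comp measurable_prodMk_right).aestronglyMeasurable measurable_fst.aemeasurable]
  refine IntegrableOn.congr_fun hi.integrableOn (fun p hp => ?_) hm
  have : p.2 = j := hp
  simp only [← this, Function.comp]

lemma integral_stepLaw (hd : ∀ i j t, 0 < t → DifferentiableAt ℝ (M.survivalTo P i j) t)
    (i : Fin d) {g : ℝ × Fin d → ℝ} (hg : Measurable g) (hi : Integrable g (M.stepLaw P i)) :
    ∫ p, g p ∂M.stepLaw P i = ∑ j, ∫ v, g (v, j) ∂M.densityLaw P i j := by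
  have hm : ∀ j : Fin d, MeasurableSet (Prod.snd ⁻¹' {j} : Set (ℝ × Fin d)) := fun j =>
    measurable_snd (measurableSet_singleton j)
  have hU : (⋃ j : Fin d, (Prod.snd ⁻¹' {j} : Set (ℝ × Fin d))) = Set.univ := by
    ext; simp
  have hdisj : Pairwise (Function.onFun Disjoint fun j : Fin d =>
      (Prod.snd ⁻¹' {j} : Set (ℝ × Fin d))) := by
    intro j k hjk
    rw [Function.onFun, Set.disjoint_left]
    intro p h1 h2
    exact hjk (h1.symm.trans h2)
  rw [← setIntegral_univ, ← hU, integral_iUnion hm hdisj hi.integrableOn, tsum_fintype]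
  refine Finset.sum_congr rfl fun j _ => ?_
  rw [← densityLaw_eq hd, integral_map measurable_fst.aemeasurable
    (show Measurable fun v => g (v, j) from hg.comp measurable_prodMk_right).aestronglyMeasurable]
  refine setIntegral_congr_fun (hm j) fun p hp => ?_
  have : p.2 = j := hp
  simp only [← this]

lemma integrable_densityLaw_iff (i j : Fin d) {g : ℝ → ℝ} :
    Integrable g (M.densityLaw P i j) ↔
      IntegrableOn (fun v => g v * M.densityTo P i j v) (Set.Ioi 0) := by
  rw [densityLaw, integrable_withDensity_iff
    (measurable_densityTo i j).ennreal_ofReal (by simp)]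
  simp_rw [ENNReal.toReal_ofReal (densityTo_nonneg i j _)]
  rfl

lemma integral_densityLaw (i j : Fin d) (g : ℝ → ℝ) :
    ∫ v, g v ∂M.densityLaw P i j = ∫ v in Set.Ioi 0, g v * M.densityTo P i j v := by
  rw [densityLaw, integral_withDensity_eq_integral_toReal_smul
    (measurable_densityTo i j).ennreal_ofReal (by simp)]
  simp_rw [ENNReal.toReal_ofReal (densityTo_nonneg i j _), smul_eq_mul, mul_comm]

end Switching

end RegimeSwitching

namespace RegimeSwitching

/-! ### The renewal operator -/

/-- A family of functions on the line which vanish on `(-∞, 0)` and grow at most exponentially. -/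
structure Dominated {d : ℕ} (g : Fin d → ℝ → ℝ) (C : ℝ) : Prop where
  measurable : ∀ j, Measurable (g j)
  bound : ∀ j r, |g j r| ≤ C * Real.exp r
  zero : ∀ j r, r < 0 → g j r = 0

namespace Dominated

variable {d : ℕ} {g : Fin d → ℝ → ℝ} {C : ℝ}

lemma measurable_uncurry (hg : Dominated g C) : Measurable fun q : Fin d × ℝ => g q.1 q.2 :=
  measurable_from_prod_countable_right hg.measurable

lemma measurable_eval (hg : Dominated g C) {α : Type*} [MeasurableSpace α] {J : α → Fin d}
    {r : α → ℝ} (hJ : Measurable J) (hr : Measurable r) : Measurable fun a => g (J a) (r a) :=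
  hg.measurable_uncurry.comp (hJ.prodMk hr)

lemma nonneg (hg : Dominated g C) (j : Fin d) : 0 ≤ C := by
  have := (abs_nonneg _).trans (hg.bound j 0)
  simpa using this

lemma bound_of_le (hg : Dominated g C) (j : Fin d) {r t : ℝ} (h : r ≤ t) :
    |g j r| ≤ C * Real.exp t :=
  (hg.bound j r).trans (mul_le_mul_of_nonneg_left (Real.exp_le_exp.2 h) (hg.nonneg j))

lemma integrable_eval (hg : Dominated g C) {α : Type*} [MeasurableSpace α] {μ : Measure α}
    [IsFiniteMeasure μ] {J : α → Fin d} {r : α → ℝ} (hJ : Measurable J) (hr : Measurable r) {t : ℝ}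
    (h : ∀ᵐ a ∂μ, r a ≤ t) : Integrable (fun a => g (J a) (r a)) μ := by
  refine Integrable.of_bound (hg.measurable_eval hJ hr).aestronglyMeasurable (C * Real.exp t) ?_
  filter_upwards [h] with a ha
  exact hg.bound_of_le _ ha

end Dominated

namespace Switching

variable {d : ℕ} {Ω : Type*} [mΩ : MeasurableSpace Ω] {M : Switching d Ω}
  {P : Measure Ω} [IsProbabilityMeasure P]

variable (M P) in
/-- The renewal operator `(K g)_i(t) = E[g_{ε(τ 1)}(t - τ 1) | ε(0) = i]`. -/
noncomputable def renew (g : Fin d → ℝ → ℝ) (i : Fin d) (t : ℝ) : ℝ :=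
  ∫ p, g p.2 (t - p.1) ∂M.stepLaw P i

lemma stepLaw_ae_sub_le (i : Fin d) (t : ℝ) : ∀ᵐ p ∂M.stepLaw P i, t - p.1 ≤ t := by
  filter_upwards [stepLaw_ae_pos (M := M) (P := P) i] with p hp
  linarith

lemma integrable_exp_neg (i : Fin d) :
    Integrable (fun p : ℝ × Fin d => Real.exp (-p.1)) (M.stepLaw P i) := by
  refine Integrable.of_bound (by fun_prop) 1 ?_
  filter_upwards [stepLaw_ae_pos (M := M) (P := P) i] with p hp
  simp [hp.le]

/-- Since τ 1 > 0, each Laplace transform at 1 is strictly below 1, and so is the largest of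
finitely many. This q is the contraction constant of every later estimate. -/
lemma exists_laplace_lt_one (h0 : ∀ i, P (M.start i) ≠ 0) :
    ∃ q : ℝ, 0 ≤ q ∧ q < 1 ∧ ∀ i, ∫ p, Real.exp (-p.1) ∂M.stepLaw P i ≤ q := by
  have hlt : ∀ i, ∫ p, Real.exp (-p.1) ∂M.stepLaw P i < 1 := by
    intro i
    have := isProbabilityMeasure_stepLaw (h0 i)
    have h1 : 0 < ∫ p, (1 - Real.exp (-p.1)) ∂M.stepLaw P i := by
      rw [integral_pos_iff_support_of_nonneg_ae]
      · have : (fun p : ℝ × Fin d => 1 - Real.exp (-p.1)).support ∈ ae (M.stepLaw P i) := by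
          filter_upwards [stepLaw_ae_pos (M := M) (P := P) i] with p hp
          have : Real.exp (-p.1) < 1 := by simpa using hp
          exact (sub_pos.2 this).ne'
        refine pos_iff_ne_zero.2 fun h => ?_
        have hbot := Filter.inter_mem this (compl_mem_ae_iff.2 h)
        rw [Set.inter_compl_self] at hbot
        exact Filter.empty_notMem _ hbot
      · filter_upwards [stepLaw_ae_pos (M := M) (P := P) i] with p hp
        simp [hp.le]
      · exact (integrable_const _).sub (integrable_exp_neg i)
    rw [integral_sub (integrable_const _) (integrable_exp_neg i)] at h1
    simpa using h1
  have hnn : ∀ i, 0 ≤ ∫ p, Real.exp (-p.1) ∂M.stepLaw P i := fun i =>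
    integral_nonneg fun p => (Real.exp_pos _).le
  rcases isEmpty_or_nonempty (Fin d) with he | hne
  · exact ⟨0, le_rfl, one_pos, fun i => he.elim i⟩
  · obtain ⟨i, -, hi⟩ := Finset.exists_max_image Finset.univ
      (fun i => ∫ p, Real.exp (-p.1) ∂M.stepLaw P i) Finset.univ_nonempty
    exact ⟨_, hnn i, hlt i, fun j => hi j (Finset.mem_univ j)⟩

/-- As exp(t - v) = exp(t) exp(-v), the weighted bound is multiplied by the Laplace transform at 1.
-/
lemma renew_dominated {g : Fin d → ℝ → ℝ} {C q : ℝ} (hg : Dominated g C)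
    (hq : ∀ i, ∫ p, Real.exp (-p.1) ∂M.stepLaw P i ≤ q) : Dominated (M.renew P g) (C * q) where
  measurable i := by
    have : Measurable fun x : ℝ × (ℝ × Fin d) => g x.2.2 (x.1 - x.2.1) :=
      hg.measurable_eval (by fun_prop) (by fun_prop)
    exact this.stronglyMeasurable.integral_prod_right'.measurable
  bound i t := by
    calc |M.renew P g i t| ≤ ∫ p, |g p.2 (t - p.1)| ∂M.stepLaw P i := abs_integral_le_integral_abs
      _ ≤ ∫ p, C * Real.exp t * Real.exp (-p.1) ∂M.stepLaw P i := by
        refine integral_mono_of_nonneg (Eventually.of_forall fun p => abs_nonneg _)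
          ((integrable_exp_neg i).const_mul _) (Eventually.of_forall fun p => ?_)
        have := hg.bound p.2 (t - p.1)
        rwa [sub_eq_add_neg, Real.exp_add, ← mul_assoc, ← sub_eq_add_neg] at this
      _ = C * Real.exp t * ∫ p, Real.exp (-p.1) ∂M.stepLaw P i := integral_const_mul _ _
      _ ≤ C * Real.exp t * q :=
        mul_le_mul_of_nonneg_left (hq i) (mul_nonneg (hg.nonneg i) (Real.exp_pos _).le)
      _ = C * q * Real.exp t := by ring
  zero i t ht := by
    have : (fun p : ℝ × Fin d => g p.2 (t - p.1)) =ᵐ[M.stepLaw P i] fun _ => 0 := by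
      filter_upwards [stepLaw_ae_pos (M := M) (P := P) i] with p hp
      exact hg.zero _ _ (by linarith)
    rw [renew, integral_congr_ae this, integral_zero]

lemma iterate_renew_dominated {g : Fin d → ℝ → ℝ} {C q : ℝ} (hg : Dominated g C)
    (hq : ∀ i, ∫ p, Real.exp (-p.1) ∂M.stepLaw P i ≤ q) (n : ℕ) :
    Dominated ((M.renew P)^[n] g) (C * q ^ n) := by
  induction n with
  | zero => simpa using hg
  | succ n ih =>
    rw [Function.iterate_succ_apply', pow_succ, ← mul_assoc]
    exact renew_dominated ih hq

lemma setIntegral_renew (hM : M.IsSemiMarkov P) {n : ℕ} {E : Set Ω}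
    (hE : MeasurableSet[M.history n] E) {g : Fin d → ℝ → ℝ} {C : ℝ} (hg : Dominated g C) (t : ℝ) :
    ∫ ω in E, g (M.J (n + 1) ω) (t - M.τ (n + 1) ω) ∂P =
      ∫ ω in E, M.renew P g (M.J n ω) (t - M.τ n ω) ∂P := by
  have hint : IntegrableOn (fun ω => g (M.J (n + 1) ω) (t - M.τ (n + 1) ω)) E P := by
    refine hg.integrable_eval (t := t) (M.measurable_J _)
      (measurable_const.sub (M.measurable_τ _)) (Eventually.of_forall fun ω => ?_)
    linarith [M.tau_nonneg (n + 1) ω]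
  have heq : ∀ ω, t - M.τ (n + 1) ω = t - M.τ n ω - M.gap n ω := fun ω => by rw [gap]; ring
  simp only [heq] at hint ⊢
  exact setIntegral_step hM hE (F := fun _ x p => g p.2 (t - x - p.1))
    (fun i => hg.measurable_eval (by fun_prop) (by fun_prop)) hint

/-- The last switching is integrated out first, which replaces `g` by its image under `renew`; hence
the induction on `n` keeps `g` general. -/
lemma setIntegral_iterate_renew (hM : M.IsSemiMarkov P) {m : ℕ} {E : Set Ω}
    (hE : MeasurableSet[M.history m] E) (n : ℕ) {q : ℝ}
    (hq : ∀ i, ∫ p, Real.exp (-p.1) ∂M.stepLaw P i ≤ q) (t : ℝ) :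
    ∀ {g : Fin d → ℝ → ℝ} {C : ℝ}, Dominated g C →
    ∫ ω in E, g (M.J (m + n) ω) (t - M.τ (m + n) ω) ∂P =
      ∫ ω in E, (M.renew P)^[n] g (M.J m ω) (t - M.τ m ω) ∂P := by
  induction n with
  | zero => intro g C hg; rfl
  | succ n ih =>
    intro g C hg
    rw [← add_assoc, setIntegral_renew hM (M.history_mono (Nat.le_add_right m n) _ hE) hg,
      ih (renew_dominated hg hq), Function.iterate_succ_apply]

/-- The indicator of {τ n ≤ t} is the Heaviside function at t - τ n. That function is dominated by
exp with constant 1, and n renewals bring the factor q^n. -/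
lemma measureReal_tau_le (hM : M.IsSemiMarkov P) {q : ℝ}
    (hq : ∀ i, ∫ p, Real.exp (-p.1) ∂M.stepLaw P i ≤ q) (n : ℕ) (t : ℝ) :
    P.real {ω | M.τ n ω ≤ t} ≤ q ^ n * Real.exp t := by
  have hg : Dominated (fun (_ : Fin d) => Set.indicator (Set.Ici (0 : ℝ)) fun _ => (1 : ℝ)) 1 := by
    refine ⟨fun _ => measurable_const.indicator measurableSet_Ici, fun j r => ?_, fun j r hr => ?_⟩
    · by_cases hr : 0 ≤ r
      · simp [Set.indicator, hr]
      · simp [Set.indicator, hr, Real.exp_nonneg]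
    · simp [Set.indicator, hr]
  have h1 := setIntegral_iterate_renew hM (m := 0) (E := Set.univ) MeasurableSet.univ n hq t hg
  have h2 := iterate_renew_dominated hg hq n
  have hset : MeasurableSet {ω | M.τ n ω ≤ t} := M.measurable_τ n measurableSet_Iic
  have e1 : (fun ω => Set.indicator (Set.Ici (0 : ℝ)) (fun _ => (1 : ℝ)) (t - M.τ n ω)) =
      Set.indicator {ω | M.τ n ω ≤ t} 1 := by
    ext ω
    simp [Set.indicator]
  simp only [zero_add, setIntegral_univ, M.τ_zero, sub_zero] at h1
  rw [e1, integral_indicator_one hset] at h1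
  rw [h1]
  calc _ ≤ ∫ ω, q ^ n * Real.exp t ∂P := by
        refine integral_mono (h2.integrable_eval (t := t) (M.measurable_J 0) measurable_const
          (by simp)) (integrable_const _) fun ω => ?_
        simpa using (le_abs_self _).trans (h2.bound (M.J 0 ω) t)
    _ = _ := by simp

/-! ### The expected contributions of the sojourns -/

variable {c h : Fin d → ℝ → ℝ}

variable (M P) in
/-- The mean contribution of a sojourn in the regime `j`, observed for a time `r`. -/
noncomputable def sojournMean (c h : Fin d → ℝ → ℝ) (j : Fin d) (r : ℝ) : ℝ :=
  ∫ p, sojourn c h j r p.1 ∂M.stepLaw P j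

/-- A bound for the contributions of a sojourn in the regime `j` of length `v`, up to time `T`. -/
noncomputable def sojournBound (c h : Fin d → ℝ → ℝ) (T : ℝ) (j : Fin d) (v : ℝ) : ℝ :=
  (∫ u in (0 : ℝ)..T, |c j u|) + |if v ≤ T then h j v else 0|

variable (M P) in
/-- A common bound for the mean absolute contributions of sojourns up to time `T`. -/
noncomputable def sojournConst (c h : Fin d → ℝ → ℝ) (T : ℝ) : ℝ :=
  ∑ j, ∫ p, sojournBound c h T j p.1 ∂M.stepLaw P j

lemma sojournBound_nonneg {T : ℝ} (hT : 0 ≤ T) (j : Fin d) (v : ℝ) :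
    0 ≤ sojournBound c h T j v :=
  add_nonneg (intervalIntegral.integral_nonneg hT fun _ _ => abs_nonneg _) (abs_nonneg _)

section

variable (hc : ∀ i t, 0 ≤ t → IntervalIntegrable (c i) volume 0 t) (hh : ∀ i, Measurable (h i))

include hc in
lemma abs_sojourn_le {r T : ℝ} (hT : 0 ≤ T) (hr : r ≤ T) (j : Fin d) (v : ℝ) :
    |sojourn c h j r v| ≤ sojournBound c h T j v := by
  have hle : 0 ≤ r ∧ 0 < v → |∫ u in (0 : ℝ)..min r v, c j u| ≤ ∫ u in (0 : ℝ)..T, |c j u| := by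
    rintro ⟨h1, h2⟩
    have h0 : 0 ≤ min r v := le_min h1 h2.le
    exact (intervalIntegral.abs_integral_le_integral_abs h0).trans
      (intervalIntegral.integral_mono_interval le_rfl h0 ((min_le_left r v).trans hr)
        (Eventually.of_forall fun _ => abs_nonneg _) (hc j T hT).abs)
  rw [sojourn]
  split_ifs with h1 h2
  · exact (abs_add_le _ _).trans (add_le_add (hle h1) (by simp [h2.trans hr]))
  · rw [add_zero]
    exact (hle h1).trans (le_add_of_nonneg_right (abs_nonneg _))
  · simpa using sojournBound_nonneg hT j v

end

variable (hc : ∀ i t, 0 ≤ t → IntervalIntegrable (c i) volume 0 t) (hh : ∀ i, Measurable (h i))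
  (hhi : ∀ j T, 0 ≤ T → Integrable (fun p : ℝ × Fin d => if p.1 ≤ T then h j p.1 else 0)
    (M.stepLaw P j))

include hhi in
lemma integrable_sojournBound {T : ℝ} (hT : 0 ≤ T) (j : Fin d) :
    Integrable (fun p : ℝ × Fin d => sojournBound c h T j p.1) (M.stepLaw P j) :=
  (integrable_const _).add (hhi j T hT).abs

include hc hh hhi in
lemma integrable_sojourn (j : Fin d) (r : ℝ) :
    Integrable (fun p : ℝ × Fin d => sojourn c h j r p.1) (M.stepLaw P j) := by
  refine (integrable_sojournBound (c := c) hhi (le_max_right r 0) j).mono'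
    ((measurable_sojourn hc hh j).comp (measurable_const.prodMk measurable_fst)).aestronglyMeasurable
    (Eventually.of_forall fun p => ?_)
  exact abs_sojourn_le hc (le_max_right r 0) (le_max_left r 0) j p.1

lemma integral_sojournBound_le {T : ℝ} (hT : 0 ≤ T) (j : Fin d) :
    ∫ p, sojournBound c h T j p.1 ∂M.stepLaw P j ≤ M.sojournConst P c h T :=
  Finset.single_le_sum (f := fun j => ∫ p, sojournBound c h T j p.1 ∂M.stepLaw P j)
    (fun k _ => integral_nonneg fun p => sojournBound_nonneg hT k p.1) (Finset.mem_univ j)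

lemma sojournConst_nonneg {T : ℝ} (hT : 0 ≤ T) : 0 ≤ M.sojournConst P c h T :=
  Finset.sum_nonneg fun k _ => integral_nonneg fun p => sojournBound_nonneg hT k p.1

include hc hh hhi in
lemma lintegral_sojourn_le {r T : ℝ} (hT : 0 ≤ T) (hr : r ≤ T) (j : Fin d) :
    ∫⁻ p, ‖sojourn c h j r p.1‖ₑ ∂M.stepLaw P j ≤ ENNReal.ofReal (M.sojournConst P c h T) := by
  calc _ ≤ ∫⁻ p, ENNReal.ofReal (sojournBound c h T j p.1) ∂M.stepLaw P j := by
        refine lintegral_mono fun p => ?_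
        rw [← ofReal_norm]
        exact ENNReal.ofReal_le_ofReal (abs_sojourn_le hc hT hr j p.1)
    _ = ENNReal.ofReal (∫ p, sojournBound c h T j p.1 ∂M.stepLaw P j) :=
        (ofReal_integral_eq_lintegral_ofReal (integrable_sojournBound hhi hT j)
          (Eventually.of_forall fun p => sojournBound_nonneg hT j p.1)).symm
    _ ≤ _ := ENNReal.ofReal_le_ofReal (integral_sojournBound_le hT j)

include hc hh hhi in
-- The mean contribution may grow arbitrarily fast with r. Cutting it off at `T` makes it bounded,
-- and costs nothing because the renewal operator at times up to `T` never looks beyond `T`.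
lemma sojournMean_dominated {T : ℝ} (hT : 0 ≤ T) :
    Dominated (fun j r => if r ≤ T then M.sojournMean P c h j r else 0)
      (M.sojournConst P c h T) where
  measurable j := by
    refine Measurable.ite measurableSet_Iic ?_ measurable_const
    have : Measurable fun x : ℝ × (ℝ × Fin d) => sojourn c h j x.1 x.2.1 :=
      (measurable_sojourn hc hh j).comp
        (measurable_fst.prodMk (measurable_fst.comp measurable_snd))
    exact this.stronglyMeasurable.integral_prod_right'.measurable
  bound j r := by
    have hC := sojournConst_nonneg (M := M) (P := P) (c := c) (h := h) hT
    split_ifs with hr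
    · rcases lt_or_ge r 0 with h0 | h0
      · simp only [sojournMean, sojourn_eq_zero h0, integral_zero, abs_zero]
        positivity
      · calc |M.sojournMean P c h j r| ≤ ∫ p, |sojourn c h j r p.1| ∂M.stepLaw P j :=
              abs_integral_le_integral_abs
          _ ≤ ∫ p, sojournBound c h T j p.1 ∂M.stepLaw P j :=
              integral_mono (integrable_sojourn hc hh hhi j r).abs
                (integrable_sojournBound hhi hT j) fun p => abs_sojourn_le hc hT hr j p.1
          _ ≤ M.sojournConst P c h T := integral_sojournBound_le hT j
          _ ≤ M.sojournConst P c h T * Real.exp r :=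
              le_mul_of_one_le_right hC (Real.one_le_exp h0)
    · simp only [abs_zero]
      positivity
  zero j r hr := by
    simp [sojournMean, sojourn_eq_zero hr]

include hc hh in
lemma measurable_sojourn_path (n : ℕ) (t : ℝ) :
    Measurable fun ω => sojourn c h (M.J n ω) (t - M.τ n ω) (M.gap n ω) := by
  have : Measurable fun q : Fin d × (ℝ × ℝ) => sojourn c h q.1 q.2.1 q.2.2 :=
    measurable_from_prod_countable_right (measurable_sojourn hc hh)
  exact this.comp ((M.measurable_J n).prodMk
    ((measurable_const.sub (M.measurable_τ n)).prodMk (M.measurable_gap n)))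

include hc hh hhi in
-- Given the history at τ n, the absolute mean is at most `sojournConst` when τ n ≤ t and is zero
-- otherwise; the probability of τ n ≤ t decays geometrically.
lemma lintegral_sojourn_path_le (hM : M.IsSemiMarkov P) {q : ℝ}
    (hq : ∀ i, ∫ p, Real.exp (-p.1) ∂M.stepLaw P i ≤ q) (n : ℕ) {t : ℝ} (ht : 0 ≤ t) :
    ∫⁻ ω, ‖sojourn c h (M.J n ω) (t - M.τ n ω) (M.gap n ω)‖ₑ ∂P ≤
      ENNReal.ofReal (M.sojournConst P c h t * (q ^ n * Real.exp t)) := by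
  have h1 := setLIntegral_step hM (n := n) (E := Set.univ) MeasurableSet.univ
    (F := fun i x p => ‖sojourn c h i (t - x) p.1‖ₑ)
    (fun i => ((measurable_sojourn hc hh i).comp
      (f := fun q : ℝ × (ℝ × Fin d) => (t - q.1, q.2.1)) (by fun_prop)).enorm)
  simp only [setLIntegral_univ] at h1
  rw [h1]
  have hset : MeasurableSet {ω | M.τ n ω ≤ t} := M.measurable_τ n measurableSet_Iic
  calc _ ≤ ∫⁻ ω, {ω | M.τ n ω ≤ t}.indicator
          (fun _ => ENNReal.ofReal (M.sojournConst P c h t)) ω ∂P := by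
        refine lintegral_mono fun ω => ?_
        by_cases hω : M.τ n ω ≤ t
        · rw [Set.indicator_of_mem (show ω ∈ {ω | M.τ n ω ≤ t} from hω)]
          exact lintegral_sojourn_le hc hh hhi ht (by linarith [M.tau_nonneg n ω]) _
        · have : t - M.τ n ω < 0 := by linarith
          simp [sojourn_eq_zero this]
    _ = ENNReal.ofReal (M.sojournConst P c h t) * P {ω | M.τ n ω ≤ t} :=
        lintegral_indicator_const hset _
    _ ≤ _ := by
        rw [ENNReal.ofReal_mul (sojournConst_nonneg ht), ← ofReal_measureReal]
        gcongr
        exact measureReal_tau_le hM hq n t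

include hc hh hhi in
lemma integrable_sojourn_path (hM : M.IsSemiMarkov P) (h0 : ∀ i, P (M.start i) ≠ 0) (n : ℕ) {t : ℝ}
    (ht : 0 ≤ t) :
    Integrable (fun ω => sojourn c h (M.J n ω) (t - M.τ n ω) (M.gap n ω)) P := by
  obtain ⟨q, -, -, hq⟩ := exists_laplace_lt_one h0
  exact ⟨(measurable_sojourn_path hc hh n t).aestronglyMeasurable,
    (lintegral_sojourn_path_le hc hh hhi hM hq n ht).trans_lt ENNReal.ofReal_lt_top⟩

include hc hh hhi in
lemma tsum_lintegral_sojourn_path_ne_top (hM : M.IsSemiMarkov P) (h0 : ∀ i, P (M.start i) ≠ 0)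
    {t : ℝ} (ht : 0 ≤ t) :
    ∑' n, ∫⁻ ω, ‖sojourn c h (M.J n ω) (t - M.τ n ω) (M.gap n ω)‖ₑ ∂P ≠ ∞ := by
  obtain ⟨q, hq0, hq1, hq⟩ := exists_laplace_lt_one h0
  have hC := sojournConst_nonneg (M := M) (P := P) (c := c) (h := h) ht
  have hs : Summable fun n : ℕ => M.sojournConst P c h t * (q ^ n * Real.exp t) :=
    ((summable_geometric_of_lt_one hq0 hq1).mul_right _).mul_left _
  refine ne_top_of_le_ne_top ?_
    (ENNReal.tsum_le_tsum fun n => lintegral_sojourn_path_le hc hh hhi hM hq n ht)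
  rw [← ENNReal.ofReal_tsum_of_nonneg (fun n => by positivity) hs]
  exact ENNReal.ofReal_ne_top

include hc hh in
lemma measurable_telegraph_add_jump {t : ℝ} (ht : 0 ≤ t) :
    Measurable fun ω => M.telegraph c t ω + M.jump h t ω := by
  refine measurable_of_tendsto_metrizable
    (f := fun N ω => ∑ n ∈ Finset.range N, sojourn c h (M.J n ω) (t - M.τ n ω) (M.gap n ω))
    (fun N => Finset.measurable_sum _ fun n _ => measurable_sojourn_path hc hh n t) ?_
  rw [tendsto_pi_nhds]
  exact fun ω => (M.hasSum_sojourn hc ht ω).tendsto_sum_nat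

include hc hh hhi in
lemma integrable_telegraph_add_jump (hM : M.IsSemiMarkov P) (h0 : ∀ i, P (M.start i) ≠ 0) {t : ℝ}
    (ht : 0 ≤ t) : Integrable (fun ω => M.telegraph c t ω + M.jump h t ω) P := by
  refine ⟨(measurable_telegraph_add_jump hc hh ht).aestronglyMeasurable, ?_⟩
  calc ∫⁻ ω, ‖M.telegraph c t ω + M.jump h t ω‖ₑ ∂P
      ≤ ∫⁻ ω, ∑' n, ‖sojourn c h (M.J n ω) (t - M.τ n ω) (M.gap n ω)‖ₑ ∂P := by
        refine lintegral_mono fun ω => ?_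
        rw [← (M.hasSum_sojourn hc ht ω).tsum_eq]
        exact enorm_tsum_le_tsum_enorm
    _ = ∑' n, ∫⁻ ω, ‖sojourn c h (M.J n ω) (t - M.τ n ω) (M.gap n ω)‖ₑ ∂P :=
        lintegral_tsum fun n => (measurable_sojourn_path hc hh n t).enorm.aemeasurable
    _ < ∞ := (tsum_lintegral_sojourn_path_ne_top hc hh hhi hM h0 ht).lt_top

include hc hh hhi in
lemma hasSum_setIntegral_sojourn (hM : M.IsSemiMarkov P) (h0 : ∀ i, P (M.start i) ≠ 0) {t : ℝ}
    (ht : 0 ≤ t) (E : Set Ω) :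
    HasSum (fun n => ∫ ω in E, sojourn c h (M.J n ω) (t - M.τ n ω) (M.gap n ω) ∂P)
      (∫ ω in E, (M.telegraph c t ω + M.jump h t ω) ∂P) := by
  have hi : ∀ n, Integrable (fun ω => sojourn c h (M.J n ω) (t - M.τ n ω) (M.gap n ω))
      (P.restrict E) := fun n => (integrable_sojourn_path hc hh hhi hM h0 n ht).integrableOn
  have hs := tsum_lintegral_sojourn_path_ne_top hc hh hhi hM h0 ht
  have hs' : ∑' n, ∫⁻ ω in E, ‖sojourn c h (M.J n ω) (t - M.τ n ω) (M.gap n ω)‖ₑ ∂P ≠ ∞ :=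
    ne_top_of_le_ne_top hs (ENNReal.tsum_le_tsum fun n => setLIntegral_le_lintegral _ _)
  have := hasSum_integral_of_summable_integral_norm hi (by
    have := ENNReal.summable_toReal hs'
    refine this.congr fun n => ?_
    rw [integral_norm_eq_lintegral_enorm (hi n).aestronglyMeasurable])
  simpa only [(M.hasSum_sojourn hc ht _).tsum_eq] using this

include hc hh hhi in
-- Averaging over the length of the sojourn gives `sojournMean` at the switching `m + n`; going back
-- to the switching `m` takes n renewals.
lemma setIntegral_sojourn_path (hM : M.IsSemiMarkov P) (h0 : ∀ i, P (M.start i) ≠ 0)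
    {q : ℝ} (hq : ∀ i, ∫ p, Real.exp (-p.1) ∂M.stepLaw P i ≤ q) {t T : ℝ} (ht : 0 ≤ t) (hT : t ≤ T)
    {m : ℕ} {E : Set Ω} (hE : MeasurableSet[M.history m] E) (n : ℕ) :
    ∫ ω in E, sojourn c h (M.J (m + n) ω) (t - M.τ (m + n) ω) (M.gap (m + n) ω) ∂P =
      ∫ ω in E, (M.renew P)^[n] (fun j r => if r ≤ T then M.sojournMean P c h j r else 0)
        (M.J m ω) (t - M.τ m ω) ∂P := by
  rw [← setIntegral_iterate_renew hM hE n hq t (sojournMean_dominated hc hh hhi (ht.trans hT))]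
  have h1 := setIntegral_step hM (n := m + n)
    (M.history_mono (Nat.le_add_right m n) _ hE)
    (F := fun i x p => sojourn c h i (t - x) p.1)
    (fun i => (measurable_sojourn hc hh i).comp
      (f := fun q : ℝ × (ℝ × Fin d) => (t - q.1, q.2.1)) (by fun_prop))
    (integrable_sojourn_path hc hh hhi hM h0 (m + n) ht).integrableOn
  rw [h1]
  congr 1
  ext ω
  -- The remaining time is at most t ≤ T, so the cut-off is inactive.
  rw [if_pos (by linarith [M.tau_nonneg (m + n) ω]), sojournMean]

end Switching

end RegimeSwitching

/-! ### Conditional survival functions and integrals over the first sojourn -/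

namespace RegimeSwitching

namespace Switching

variable {d : ℕ} {Ω : Type*} [mΩ : MeasurableSpace Ω] {M : Switching d Ω}
  {P : Measure Ω} [IsProbabilityMeasure P]

lemma integral_cond (A : Set Ω) (f : Ω → ℝ) :
    ∫ ω, f ω ∂(cond P A) = (P.real A)⁻¹ * ∫ ω in A, f ω ∂P := by
  rw [ProbabilityTheory.cond, integral_smul_measure, ENNReal.toReal_inv, smul_eq_mul,
    measureReal_def]

lemma integrable_cond {A : Set Ω} (hA : P A ≠ 0) {f : Ω → ℝ} (hf : Integrable f P) :
    Integrable f (cond P A) := by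
  rw [ProbabilityTheory.cond]
  exact hf.integrableOn.smul_measure (ENNReal.inv_ne_top.2 hA)

lemma measureReal_start_pos {i : Fin d} (hi : P (M.start i) ≠ 0) : 0 < P.real (M.start i) :=
  ENNReal.toReal_pos hi (measure_ne_top _ _)

lemma setIntegral_start_stepLaw {i : Fin d} (hi : P (M.start i) ≠ 0) (s : ℝ)
    {F : ℝ × Fin d → ℝ} (hF : Measurable F) :
    ∫ ω in M.start i ∩ {ω | s < M.τ 1 ω}, F (M.τ 1 ω, M.J 1 ω) ∂P =
      P.real (M.start i) * ∫ p in {p | s < p.1}, F p ∂M.stepLaw P i := by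
  have hm : MeasurableSet {p : ℝ × Fin d | s < p.1} := measurableSet_lt measurable_const measurable_fst
  have h1 : ∫ p in {p | s < p.1}, F p ∂M.stepLaw P i =
      ∫ ω, {p : ℝ × Fin d | s < p.1}.indicator F (M.τ 1 ω, M.J 1 ω) ∂(cond P (M.start i)) := by
    rw [← integral_indicator hm, stepLaw, integral_map measurable_step.aemeasurable
      (hF.indicator hm).aestronglyMeasurable]
  rw [h1, integral_cond, mul_inv_cancel_left₀ (measureReal_start_pos hi).ne', Set.inter_comm,
    ← Measure.restrict_restrict (M.measurableSet_tau_gt s), ← integral_indicator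
    (M.measurableSet_tau_gt s)]
  rfl

lemma survival_eq_div (i : Fin d) (u : ℝ) :
    M.survival P i u = P.real (M.start i ∩ {ω | u < M.τ 1 ω}) / P.real (M.start i) := by
  rw [survival, measureReal_def, cond_apply (M.measurableSet_start i), ENNReal.toReal_mul,
    ENNReal.toReal_inv, measureReal_def, measureReal_def, div_eq_inv_mul]

lemma condSurvival_eq_div (i : Fin d) {s u : ℝ} (hi : P (M.start i) ≠ 0) (hsu : s ≤ u) :
    M.condSurvival P i s u = M.survival P i u / M.survival P i s := by
  have hpos := (measureReal_start_pos hi).ne'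
  have hset : M.start i ∩ {ω | s < M.τ 1 ω} ∩ {ω | u < M.τ 1 ω} = M.start i ∩ {ω | u < M.τ 1 ω} := by
    ext ω
    simp only [Set.mem_inter_iff, Set.mem_ofPred_eq]
    exact ⟨fun h => ⟨h.1.1, h.2⟩, fun h => ⟨⟨h.1, hsu.trans_lt h.2⟩, h.2⟩⟩
  rw [condSurvival, measureReal_def, cond_apply ((M.measurableSet_start i).inter
    (M.measurableSet_tau_gt s)), hset, ENNReal.toReal_mul, ENNReal.toReal_inv, survival_eq_div,
    survival_eq_div, div_div_div_cancel_right₀ hpos, div_eq_inv_mul]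
  rfl

lemma condSurvivalTo_eq_div (i j : Fin d) {s u : ℝ} (hi : P (M.start i) ≠ 0) (hsu : s ≤ u) :
    M.condSurvivalTo P i j s u = M.survivalTo P i j u / M.survival P i s := by
  have hpos := (measureReal_start_pos hi).ne'
  have hset : M.start i ∩ {ω | s < M.τ 1 ω} ∩ {ω | u < M.τ 1 ω ∧ M.J 1 ω = j} =
      M.start i ∩ {ω | u < M.τ 1 ω ∧ M.J 1 ω = j} := by
    ext ω
    simp only [Set.mem_inter_iff, Set.mem_ofPred_eq]
    exact ⟨fun h => ⟨h.1.1, h.2⟩, fun h => ⟨⟨h.1, hsu.trans_lt h.2.1⟩, h.2⟩⟩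
  rw [condSurvivalTo, survivalTo, measureReal_def, measureReal_def,
    cond_apply ((M.measurableSet_start i).inter (M.measurableSet_tau_gt s)),
    cond_apply (M.measurableSet_start i), hset, ENNReal.toReal_mul, ENNReal.toReal_inv,
    ENNReal.toReal_mul, ENNReal.toReal_inv, survival_eq_div]
  simp only [← measureReal_def]
  field_simp

/-- The quotient formula for the conditional survival function may fail to the left of s, so the
two-sided derivative is controlled only for u > s. The point u = s is negligible in the integrals.
-/
lemma condDensity_eq_div (i : Fin d) {s u : ℝ} (hi : P (M.start i) ≠ 0) (hsu : s < u) :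
    M.condDensity P i s u = M.density P i u / M.survival P i s := by
  have : M.condSurvival P i s =ᶠ[𝓝 u] fun v => M.survival P i v / M.survival P i s := by
    filter_upwards [eventually_gt_nhds hsu] with v hv
    exact condSurvival_eq_div i hi hv.le
  rw [condDensity, this.deriv_eq, deriv_div_const, density, neg_div]

lemma condDensityTo_eq_div (i j : Fin d) {s u : ℝ} (hi : P (M.start i) ≠ 0) (hsu : s < u) :
    M.condDensityTo P i j s u = M.densityTo P i j u / M.survival P i s := by
  have : M.condSurvivalTo P i j s =ᶠ[𝓝 u] fun v => M.survivalTo P i j v / M.survival P i s := by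
    filter_upwards [eventually_gt_nhds hsu] with v hv
    exact condSurvivalTo_eq_div i j hi hv.le
  rw [condDensityTo, this.deriv_eq, deriv_div_const, densityTo, neg_div]

lemma survival_antitone (i : Fin d) : Antitone (M.survival P i) := fun _ _ hab =>
  measureReal_mono (fun _ hω => hab.trans_lt hω)

lemma norm_survival_le (i : Fin d) (t : ℝ) : ‖M.survival P i t‖ ≤ 1 := by
  rw [survival, Real.norm_of_nonneg measureReal_nonneg]
  exact measureReal_le_one

lemma density_nonneg (i : Fin d) (t : ℝ) : 0 ≤ M.density P i t :=
  neg_nonneg.2 (survival_antitone i).deriv_nonpos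

lemma measurable_density (i : Fin d) : Measurable (M.density P i) :=
  (measurable_deriv _).neg

lemma survival_eq_sum (i : Fin d) (t : ℝ) :
    M.survival P i t = ∑ j, M.survivalTo P i j t := by
  have hset : {ω | t < M.τ 1 ω} = ⋃ j, {ω | t < M.τ 1 ω ∧ M.J 1 ω = j} := by
    ext ω; simp
  have hdisj : Pairwise (Function.onFun Disjoint fun j => {ω | t < M.τ 1 ω ∧ M.J 1 ω = j}) := by
    intro j k hjk
    rw [Function.onFun, Set.disjoint_left]
    rintro ω ⟨-, h1⟩ ⟨-, h2⟩
    exact hjk (h1.symm.trans h2)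
  rw [survival, hset, measureReal_iUnion_fintype hdisj fun j =>
    (M.measurableSet_tau_gt t).inter (M.measurable_J 1 (measurableSet_singleton j))]
  rfl

lemma stepLaw_real_gt (i : Fin d) (t : ℝ) :
    (M.stepLaw P i).real {p | t < p.1} = M.survival P i t := by
  rw [measureReal_def, stepLaw, Measure.map_apply measurable_step
    (measurableSet_lt measurable_const measurable_fst)]
  rfl

lemma gapLaw_eq (hd : ∀ i j t, 0 < t → DifferentiableAt ℝ (M.survivalTo P i j) t) (i : Fin d) :
    (M.stepLaw P i).map Prod.fst = (volume.restrict (Set.Ioi 0)).withDensity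
      fun t => ENNReal.ofReal (M.density P i t) := by
  refine eq_withDensity_of_differentiable ?_ (fun t => ?_) fun t ht => ?_
  · rw [Measure.map_apply measurable_fst measurableSet_Iic]
    refine measure_mono_null ?_ (stepLaw_nonpos (M := M) (P := P) i)
    rintro ⟨x, j⟩ hx
    exact ⟨hx, Set.mem_univ j⟩
  · rw [← stepLaw_real_gt, measureReal_def, measureReal_def,
      Measure.map_apply measurable_fst measurableSet_Ioi]
    rfl
  · rw [funext (survival_eq_sum (M := M) (P := P) i)]
    exact DifferentiableAt.fun_sum fun j _ => hd i j t ht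

lemma integrable_stepLaw_fst_iff
    (hd : ∀ i j t, 0 < t → DifferentiableAt ℝ (M.survivalTo P i j) t) (i : Fin d)
    {g : ℝ → ℝ} (hg : Measurable g) :
    Integrable (fun p : ℝ × Fin d => g p.1) (M.stepLaw P i) ↔
      IntegrableOn (fun v => g v * M.density P i v) (Set.Ioi 0) := by
  have h1 := integrable_map_measure (μ := M.stepLaw P i) (f := Prod.fst) (g := g)
    hg.aestronglyMeasurable measurable_fst.aemeasurable
  rw [show (fun p : ℝ × Fin d => g p.1) = g ∘ Prod.fst from rfl, ← h1, gapLaw_eq hd,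
    integrable_withDensity_iff (measurable_density i).ennreal_ofReal (by simp)]
  simp_rw [ENNReal.toReal_ofReal (density_nonneg i _)]
  rfl

lemma integral_stepLaw_fst
    (hd : ∀ i j t, 0 < t → DifferentiableAt ℝ (M.survivalTo P i j) t) (i : Fin d)
    {g : ℝ → ℝ} (hg : Measurable g) :
    ∫ p, g p.1 ∂M.stepLaw P i = ∫ v in Set.Ioi 0, g v * M.density P i v := by
  rw [← integral_map (f := g) measurable_fst.aemeasurable hg.aestronglyMeasurable, gapLaw_eq hd,
    integral_withDensity_eq_integral_toReal_smul (measurable_density i).ennreal_ofReal (by simp)]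
  simp_rw [ENNReal.toReal_ofReal (density_nonneg i _), smul_eq_mul, mul_comm]

variable {c h : Fin d → ℝ → ℝ}

/-- Translates the integrability of h_j f_j on [0, T] into integrability of the amplitude under the
law of τ 1, which is needed only up to the horizon T. -/
lemma integrable_jump (hd : ∀ i j t, 0 < t → DifferentiableAt ℝ (M.survivalTo P i j) t)
    (hh : ∀ i, Measurable (h i))
    (hhf : ∀ i t, 0 ≤ t → IntervalIntegrable (fun u => h i u * M.density P i u) volume 0 t)
    (j : Fin d) (T : ℝ) (hT : 0 ≤ T) :
    Integrable (fun p : ℝ × Fin d => if p.1 ≤ T then h j p.1 else 0) (M.stepLaw P j) := by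
  have hm : Measurable fun v => if v ≤ T then h j v else 0 :=
    Measurable.ite measurableSet_Iic (hh j) measurable_const
  rw [integrable_stepLaw_fst_iff hd j hm]
  have h1 := (intervalIntegrable_iff_integrableOn_Ioc_of_le hT).1 (hhf j T hT)
  have h2 : (fun v => (if v ≤ T then h j v else 0) * M.density P j v) =
      (Set.Iic T).indicator fun v => h j v * M.density P j v := by
    ext v; by_cases hv : v ≤ T <;> simp [Set.indicator, hv]
  rw [h2, IntegrableOn, integrable_indicator_iff measurableSet_Iic, IntegrableOn,
    Measure.restrict_restrict measurableSet_Iic, Set.inter_comm, Set.Ioi_inter_Iic]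
  exact h1

section

variable (hd : ∀ i j t, 0 < t → DifferentiableAt ℝ (M.survivalTo P i j) t)
  (hc : ∀ i t, 0 ≤ t → IntervalIntegrable (c i) volume 0 t) (hh : ∀ i, Measurable (h i))
  (hcm : ∀ i, Measurable (c i))
  (hhf : ∀ i t, 0 ≤ t → IntervalIntegrable (fun u => h i u * M.density P i u) volume 0 t)

include hd hh in
lemma setIntegral_stepLaw_jump {s t : ℝ} (hs : 0 ≤ s) (hst : s ≤ t) (i : Fin d) :
    ∫ p in {p | s < p.1}, (if p.1 ≤ t then h i p.1 else 0) ∂M.stepLaw P i =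
      ∫ u in s..t, h i u * M.density P i u := by
  have hm : MeasurableSet {p : ℝ × Fin d | s < p.1} := measurableSet_lt measurable_const measurable_fst
  have hg : Measurable ((Set.Ioi s).indicator fun v => if v ≤ t then h i v else 0) :=
    (Measurable.ite measurableSet_Iic (hh i) measurable_const).indicator measurableSet_Ioi
  rw [← integral_indicator hm, intervalIntegral.integral_of_le hst]
  have h1 := integral_stepLaw_fst hd i hg
  have h2 : (fun v => (Set.Ioi s).indicator (fun v => if v ≤ t then h i v else 0) v *
      M.density P i v) = (Set.Ioc s t).indicator fun v => h i v * M.density P i v := by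
    ext v
    by_cases h3 : s < v <;> by_cases h4 : v ≤ t <;> simp [Set.indicator, h3, h4]
  rw [h2, setIntegral_indicator measurableSet_Ioc,
    show Set.Ioi 0 ∩ Set.Ioc s t = Set.Ioc s t from
      Set.inter_eq_right.2 fun x hx => hs.trans_lt hx.1] at h1
  exact h1

include hc hcm in
-- By Fubini, the drift at time u is weighted by the probability of τ 1 > max(s, u), which is
-- F̄_i(s) for u ≤ s and F̄_i(u) afterwards.
lemma setIntegral_stepLaw_drift {s t : ℝ} (hs : 0 ≤ s) (hst : s ≤ t) (i : Fin d) :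
    ∫ p in {p | s < p.1}, (∫ u in (0 : ℝ)..min t p.1, c i u) ∂M.stepLaw P i =
      M.survival P i s * (∫ u in (0 : ℝ)..s, c i u) +
        ∫ u in s..t, c i u * M.survival P i u := by
  have ht := hs.trans hst
  have hm : MeasurableSet {p : ℝ × Fin d | s < p.1} := measurableSet_lt measurable_const measurable_fst
  set B : Set ((ℝ × Fin d) × ℝ) := {x | s < x.1.1 ∧ x.2 < x.1.1} with hB
  have hBm : MeasurableSet B :=
    (measurableSet_lt measurable_const (measurable_fst.comp measurable_fst)).inter
      (measurableSet_lt measurable_snd (measurable_fst.comp measurable_fst))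
  have hcI : Integrable (c i) (volume.restrict (Set.Ioc 0 t)) :=
    (intervalIntegrable_iff_integrableOn_Ioc_of_le ht).1 (hc i t ht)
  have hint : Integrable (B.indicator fun x => c i x.2)
      ((M.stepLaw P i).prod (volume.restrict (Set.Ioc 0 t))) :=
    (hcI.comp_snd (M.stepLaw P i)).indicator hBm
  have e1 : ∀ p : ℝ × Fin d, 0 < p.1 →
      {p : ℝ × Fin d | s < p.1}.indicator (fun p => ∫ u in (0 : ℝ)..min t p.1, c i u) p =
      ∫ u in Set.Ioc 0 t, B.indicator (fun x => c i x.2) (p, u) := by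
    intro p hp
    by_cases hsp : s < p.1
    · rw [Set.indicator_of_mem (show p ∈ {p : ℝ × Fin d | s < p.1} from hsp),
        intervalIntegral.integral_of_le (le_min ht hp.le)]
      have : ∀ u, B.indicator (fun x => c i x.2) (p, u) = (Set.Iio p.1).indicator (c i) u := by
        intro u
        by_cases hu : u < p.1 <;> simp [Set.indicator, hB, hsp, hu]
      simp_rw [this]
      rw [setIntegral_indicator measurableSet_Iio]
      apply setIntegral_congr_set
      have hne : ∀ᵐ u : ℝ ∂volume, u ≠ p.1 := by simp [ae_iff]
      filter_upwards [hne] with u hu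
      apply propext
      change (u ∈ Set.Ioc 0 (min t p.1)) ↔ (u ∈ Set.Ioc 0 t ∩ Set.Iio p.1)
      simp only [Set.mem_Ioc, Set.mem_inter_iff, Set.mem_Iio, le_min_iff]
      exact ⟨fun h => ⟨⟨h.1, h.2.1⟩, lt_of_le_of_ne h.2.2 hu⟩, fun h => ⟨h.1.1, h.1.2, h.2.le⟩⟩
    · rw [Set.indicator_of_notMem (show p ∉ {p : ℝ × Fin d | s < p.1} from hsp)]
      simp [Set.indicator, hB, hsp]
  rw [← integral_indicator hm, integral_congr_ae
    ((stepLaw_ae_pos (M := M) (P := P) i).mono fun p hp => e1 p hp),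
    integral_integral_swap (f := fun p u => B.indicator (fun x => c i x.2) (p, u)) hint]
  have e2 : ∀ u, ∫ p, B.indicator (fun x => c i x.2) (p, u) ∂M.stepLaw P i =
      c i u * M.survival P i (max s u) := by
    intro u
    have hmm : MeasurableSet {p : ℝ × Fin d | max s u < p.1} :=
      measurableSet_lt measurable_const measurable_fst
    have : (fun p : ℝ × Fin d => B.indicator (fun x => c i x.2) (p, u)) =
        {p : ℝ × Fin d | max s u < p.1}.indicator fun _ => c i u := by
      ext p
      simp [Set.indicator, hB]
    rw [this, integral_indicator_const _ hmm, stepLaw_real_gt, smul_eq_mul, mul_comm]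
  simp_rw [e2]
  have hI : IntervalIntegrable (fun u => c i u * M.survival P i (max s u)) volume 0 t := by
    rw [intervalIntegrable_iff_integrableOn_Ioc_of_le ht]
    have hsm : Measurable fun u => M.survival P i (max s u) :=
      (survival_antitone i).measurable.comp (measurable_const.max measurable_id)
    exact Integrable.mul_bdd (c := 1) hcI hsm.aestronglyMeasurable (Eventually.of_forall fun u => norm_survival_le i _)
  have hI1 : IntervalIntegrable (fun u => c i u * M.survival P i (max s u)) volume 0 s :=
    hI.mono_set (by rw [Set.uIcc_of_le hs, Set.uIcc_of_le ht]; exact Set.Icc_subset_Icc le_rfl hst)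
  have hI2 : IntervalIntegrable (fun u => c i u * M.survival P i (max s u)) volume s t :=
    hI.mono_set (by rw [Set.uIcc_of_le hst, Set.uIcc_of_le ht]; exact Set.Icc_subset_Icc hs le_rfl)
  rw [← intervalIntegral.integral_of_le ht, ← intervalIntegral.integral_add_adjacent_intervals hI1 hI2]
  congr 1
  · rw [← intervalIntegral.integral_const_mul]
    refine intervalIntegral.integral_congr fun u hu => ?_
    rw [Set.uIcc_of_le hs] at hu
    simp only [max_eq_left hu.2, mul_comm]
  · refine intervalIntegral.integral_congr fun u hu => ?_
    rw [Set.uIcc_of_le hst] at hu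
    simp only [max_eq_right hu.1]

include hd hc hh hcm hhf in
lemma setIntegral_stepLaw_sojourn {s t : ℝ} (hs : 0 ≤ s) (hst : s ≤ t) (i : Fin d) :
    ∫ p in {p | s < p.1}, sojourn c h i t p.1 ∂M.stepLaw P i =
      M.survival P i s * (∫ u in (0 : ℝ)..s, c i u) +
        ∫ u in s..t, (c i u * M.survival P i u + h i u * M.density P i u) := by
  have ht := hs.trans hst
  have hm : MeasurableSet {p : ℝ × Fin d | s < p.1} := measurableSet_lt measurable_const measurable_fst
  have hj := integrable_jump hd hh hhf i t ht
  have hsoj := integrable_sojourn hc hh (integrable_jump hd hh hhf) i t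
  have e1 : (fun p : ℝ × Fin d => ∫ u in (0 : ℝ)..min t p.1, c i u) =ᵐ[M.stepLaw P i]
      fun p => sojourn c h i t p.1 - if p.1 ≤ t then h i p.1 else 0 := by
    filter_upwards [stepLaw_ae_pos (M := M) (P := P) i] with p hp
    rw [sojourn, if_pos ⟨ht, hp⟩, add_sub_cancel_right]
  have hdr : Integrable (fun p : ℝ × Fin d => ∫ u in (0 : ℝ)..min t p.1, c i u) (M.stepLaw P i) :=
    (hsoj.sub hj).congr e1.symm
  have e2 : ∫ p in {p | s < p.1}, sojourn c h i t p.1 ∂M.stepLaw P i =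
      ∫ p in {p | s < p.1}, ((∫ u in (0 : ℝ)..min t p.1, c i u) +
        if p.1 ≤ t then h i p.1 else 0) ∂M.stepLaw P i := by
    refine integral_congr_ae (ae_restrict_of_ae ?_)
    filter_upwards [e1] with p hp
    rw [hp, sub_add_cancel]
  have hcI : IntervalIntegrable (fun u => c i u * M.survival P i u) volume s t := by
    rw [intervalIntegrable_iff_integrableOn_Ioc_of_le hst]
    exact Integrable.mul_bdd (c := 1) ((intervalIntegrable_iff_integrableOn_Ioc_of_le hst).1
      (intervalIntegrable_of_zero (hc i) hs ht)) (survival_antitone i).measurable.aestronglyMeasurable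
      (Eventually.of_forall fun u => norm_survival_le i _)
  rw [e2, integral_add hdr.integrableOn hj.integrableOn, setIntegral_stepLaw_jump hd hh hs hst,
    setIntegral_stepLaw_drift hc hcm hs hst, intervalIntegral.integral_add hcI
    (intervalIntegrable_of_zero (hhf i) hs ht), add_assoc]

end

end Switching

end RegimeSwitching

namespace RegimeSwitching

namespace Switching

variable {d : ℕ} {Ω : Type*} [mΩ : MeasurableSpace Ω] {M : Switching d Ω}
  {P : Measure Ω} [IsProbabilityMeasure P]

/-! ### Mean values of the switching part -/

variable (M P) in
/-- The conditional mean of `T^c(t) + N^h(t)` given `ε(0) = i`. -/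
noncomputable def switchMean (c h : Fin d → ℝ → ℝ) (i : Fin d) (t : ℝ) : ℝ :=
  ∫ ω, (M.telegraph c t ω + M.jump h t ω) ∂(cond P (M.start i))

variable (M P) in
/-- The renewal series generated by the mean sojourn contributions up to time `T`. -/
noncomputable def renewalSeries (c h : Fin d → ℝ → ℝ) (T : ℝ) (j : Fin d) (r : ℝ) : ℝ :=
  ∑' n, (M.renew P)^[n] (fun j r => if r ≤ T then M.sojournMean P c h j r else 0) j r

lemma tsum_dominated {g : ℕ → Fin d → ℝ → ℝ} {C q : ℝ} (hq0 : 0 ≤ q) (hq1 : q < 1)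
    (hg : ∀ n, Dominated (g n) (C * q ^ n)) :
    (∀ j r, Summable fun n => g n j r) ∧
      Dominated (fun j r => ∑' n, g n j r) (C * (1 - q)⁻¹) := by
  have hs : ∀ r : ℝ, HasSum (fun n : ℕ => C * q ^ n * Real.exp r) (C * (1 - q)⁻¹ * Real.exp r) :=
    fun r => ((hasSum_geometric_of_lt_one hq0 hq1).mul_left C).mul_right _
  have hsum : ∀ j r, Summable fun n => g n j r := fun j r =>
    Summable.of_norm_bounded (f := fun n => g n j r) (hs r).summable fun n => (hg n).bound j r
  refine ⟨hsum, ⟨fun j => ?_, fun j r => ?_, fun j r hr => ?_⟩⟩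
  · refine measurable_of_tendsto_metrizable
      (f := fun N r => ∑ n ∈ Finset.range N, g n j r)
      (fun N => Finset.measurable_sum _ fun n _ => (hg n).measurable j) ?_
    rw [tendsto_pi_nhds]
    exact fun r => (hsum j r).hasSum.tendsto_sum_nat
  · exact tsum_of_norm_bounded (f := fun n => g n j r) (hs r) fun n => (hg n).bound j r
  · simp [(hg _).zero j r hr]

variable {c h : Fin d → ℝ → ℝ}

/-- Since `g` vanishes at negative arguments, the integration stops at u = t; the term j = i
disappears because f_ii = 0. -/
lemma setIntegral_stepLaw_eval
    (hd : ∀ i j t, 0 < t → DifferentiableAt ℝ (M.survivalTo P i j) t)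
    {g : Fin d → ℝ → ℝ} {C : ℝ} (hg : Dominated g C) {s t : ℝ} (hs : 0 ≤ s) (hst : s ≤ t)
    (i : Fin d) :
    (∀ j, IntervalIntegrable (fun u => g j (t - u) * M.densityTo P i j u) volume s t) ∧
    ∫ p in {p | s < p.1}, g p.2 (t - p.1) ∂M.stepLaw P i =
      ∑ j ∈ Finset.univ.erase i, ∫ u in s..t, g j (t - u) * M.densityTo P i j u := by
  have hm : MeasurableSet {p : ℝ × Fin d | s < p.1} := measurableSet_lt measurable_const measurable_fst
  set F : ℝ × Fin d → ℝ := {p : ℝ × Fin d | s < p.1}.indicator fun p => g p.2 (t - p.1) with hF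
  have hFm : Measurable F :=
    (hg.measurable_eval measurable_snd (measurable_const.sub measurable_fst)).indicator hm
  have hFi : Integrable F (M.stepLaw P i) :=
    (hg.integrable_eval measurable_snd (measurable_const.sub measurable_fst)
      (stepLaw_ae_sub_le i t)).indicator hm
  have e1 : ∀ j, (fun v => F (v, j) * M.densityTo P i j v) =
      (Set.Ioc s t).indicator fun v => g j (t - v) * M.densityTo P i j v := by
    intro j
    ext v
    by_cases h1 : s < v
    · by_cases h2 : v ≤ t
      · simp [hF, Set.indicator, h1, h2]
      · simp [hF, Set.indicator, h1, h2, hg.zero j (t - v) (by linarith)]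
    · simp [hF, Set.indicator, h1]
  have hsub : Set.Ioi 0 ∩ Set.Ioc s t = Set.Ioc s t :=
    Set.inter_eq_right.2 fun x hx => hs.trans_lt hx.1
  constructor
  · intro j
    have h1 := (integrable_densityLaw_iff i j).1 (integrable_densityLaw hd i j hFm hFi)
    rw [e1, IntegrableOn, integrable_indicator_iff measurableSet_Ioc, IntegrableOn,
      Measure.restrict_restrict measurableSet_Ioc, Set.inter_comm, hsub] at h1
    rwa [intervalIntegrable_iff_integrableOn_Ioc_of_le hst]
  · rw [← integral_indicator hm, ← hF, integral_stepLaw hd i hFm hFi,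
      ← Finset.add_sum_erase _ _ (Finset.mem_univ i)]
    have hzero : ∫ v, F (v, i) ∂M.densityLaw P i i = 0 := by
      rw [integral_densityLaw]
      simp [densityTo_self]
    rw [hzero, zero_add]
    refine Finset.sum_congr rfl fun j _ => ?_
    rw [integral_densityLaw, e1, setIntegral_indicator measurableSet_Ioc, hsub,
      intervalIntegral.integral_of_le hst]

section

variable (hd : ∀ i j t, 0 < t → DifferentiableAt ℝ (M.survivalTo P i j) t)
  (hc : ∀ i t, 0 ≤ t → IntervalIntegrable (c i) volume 0 t) (hh : ∀ i, Measurable (h i))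
  (hcm : ∀ i, Measurable (c i))
  (hhf : ∀ i t, 0 ≤ t → IntervalIntegrable (fun u => h i u * M.density P i u) volume 0 t)
  (hM : M.IsSemiMarkov P) (h0 : ∀ i, P (M.start i) ≠ 0)

include hd hc hh hhf hM h0 in
-- On {ε(0) = i} the pair (J 0, t - τ 0) is constantly (i, t), so the termwise integrals over this
-- event are the iterates at (i, t) times its probability.
lemma hasSum_switchMean {t T : ℝ} (ht : 0 ≤ t) (hT : t ≤ T) (i : Fin d) :
    HasSum (fun n => (M.renew P)^[n]
      (fun j r => if r ≤ T then M.sojournMean P c h j r else 0) i t) (M.switchMean P c h i t) := by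
  obtain ⟨q, -, -, hq⟩ := exists_laplace_lt_one h0
  have hhi := integrable_jump hd hh hhf
  have hE : MeasurableSet[M.history 0] (M.start i) := by
    rw [start_eq]
    exact M.measurable_history_J 0 0 (measurableSet_singleton i)
  have h1 := (hasSum_setIntegral_sojourn hc hh hhi hM h0 ht (M.start i)).mul_left
    (P.real (M.start i))⁻¹
  rw [← integral_cond] at h1
  rw [switchMean]
  suffices hfun : (fun n => (M.renew P)^[n]
      (fun j r => if r ≤ T then M.sojournMean P c h j r else 0) i t) = _ by rwa [hfun]
  funext n
  have h2 := setIntegral_sojourn_path hc hh hhi hM h0 hq ht hT hE n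
  simp only [zero_add] at h2
  rw [h2, setIntegral_congr_fun (g := fun _ => (M.renew P)^[n]
      (fun j r => if r ≤ T then M.sojournMean P c h j r else 0) i t) (M.measurableSet_start i)
    (fun ω hω => by
      have : M.J 0 ω = i := by rwa [start_eq] at hω
      simp only [this, M.τ_zero, sub_zero]), setIntegral_const, smul_eq_mul,
    inv_mul_cancel_left₀ (measureReal_start_pos (h0 i)).ne']

include hd hc hh hhf hM h0 in
-- On [0, T] the cut-off leaves no trace; this passes the measurability and the bounds of the series
-- on to the mean.
lemma renewalSeries_eq {t T : ℝ} (ht : 0 ≤ t) (hT : t ≤ T) (i : Fin d) :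
    M.renewalSeries P c h T i t = M.switchMean P c h i t :=
  (hasSum_switchMean hd hc hh hhf hM h0 ht hT i).tsum_eq

include hd hc hh hhf h0 in
lemma renewalSeries_dominated {T : ℝ} (hT : 0 ≤ T) :
    ∃ C, Dominated (M.renewalSeries P c h T) C := by
  obtain ⟨q, hq0, hq1, hq⟩ := exists_laplace_lt_one h0
  exact ⟨_, (tsum_dominated hq0 hq1 fun n => iterate_renew_dominated
    (sojournMean_dominated hc hh (integrable_jump hd hh hhf) hT) hq n).2⟩

include hd hc hh hhf hM h0 in
lemma intervalIntegrable_switchMean {T : ℝ} (hT : 0 ≤ T) (i : Fin d) :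
    IntervalIntegrable (M.switchMean P c h i) volume 0 T := by
  obtain ⟨C, hC⟩ := renewalSeries_dominated hd hc hh hhf h0 hT
  have h1 : IntegrableOn (M.renewalSeries P c h T i) (Set.Ioc 0 T) := by
    refine Integrable.of_bound (hC.measurable i).aestronglyMeasurable (C * Real.exp T) ?_
    filter_upwards [ae_restrict_mem measurableSet_Ioc] with x hx
    exact hC.bound_of_le i hx.2
  rw [intervalIntegrable_iff_integrableOn_Ioc_of_le hT]
  exact h1.congr_fun (fun x hx => renewalSeries_eq hd hc hh hhf hM h0 hx.1.le hx.2 i)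
    measurableSet_Ioc

include hd hc hh hcm hhf hM h0 in
-- The event {τ 1 > s} is not part of the history before the first switching, so the first sojourn
-- is integrated directly against the law of (τ 1, ε(τ 1)). The event does belong to the history of
-- the first switching; the later sojourns therefore renew from τ 1 and sum to `renewalSeries` at
-- (ε(τ 1), t - τ 1), which is 0 when τ 1 > t.
lemma setIntegral_switch {s t : ℝ} (hs : 0 ≤ s) (hst : s ≤ t) (i : Fin d) :
    (∀ j, IntervalIntegrable (fun u => M.switchMean P c h j (t - u) * M.densityTo P i j u)
      volume s t) ∧
    ∫ ω in M.start i ∩ {ω | s < M.τ 1 ω}, (M.telegraph c t ω + M.jump h t ω) ∂P =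
      P.real (M.start i) * (M.survival P i s * (∫ u in (0 : ℝ)..s, c i u) +
        (∫ u in s..t, (c i u * M.survival P i u + h i u * M.density P i u)) +
        ∑ j ∈ Finset.univ.erase i,
          ∫ u in s..t, M.switchMean P c h j (t - u) * M.densityTo P i j u) := by
  have ht := hs.trans hst
  obtain ⟨q, hq0, hq1, hq⟩ := exists_laplace_lt_one h0
  have hhi := integrable_jump hd hh hhf
  obtain ⟨C, hC⟩ := renewalSeries_dominated hd hc hh hhf h0 ht
  obtain ⟨h1, h2⟩ := setIntegral_stepLaw_eval hd hC hs hst i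
  have hcongr : ∀ j, Set.EqOn (fun u => M.renewalSeries P c h t j (t - u) * M.densityTo P i j u)
      (fun u => M.switchMean P c h j (t - u) * M.densityTo P i j u) (Set.uIcc s t) := by
    intro j u hu
    rw [Set.uIcc_of_le hst] at hu
    simp only [renewalSeries_eq hd hc hh hhf hM h0 (sub_nonneg.2 hu.2)
      (sub_le_self t (hs.trans hu.1)) j]
  refine ⟨fun j => (h1 j).congr (fun u hu => hcongr j (Set.uIoc_subset_uIcc hu)), ?_⟩
  set A := M.start i ∩ {ω | s < M.τ 1 ω} with hA
  have hAm : MeasurableSet A := (M.measurableSet_start i).inter (M.measurableSet_tau_gt s)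
  have hA1 : MeasurableSet[M.history 1] A := by
    rw [hA, start_eq]
    exact MeasurableSet.inter (M.measurable_history_J 1 0 (measurableSet_singleton i))
      (M.measurable_history_τ 1 1 measurableSet_Ioi)
  have hsum := hasSum_setIntegral_sojourn hc hh hhi hM h0 ht A
  have hsum1 := (hasSum_nat_add_iff' 1).2 hsum
  have hterm : ∀ n, ∫ ω in A, sojourn c h (M.J (n + 1) ω) (t - M.τ (n + 1) ω) (M.gap (n + 1) ω) ∂P
      = ∫ ω in A, (M.renew P)^[n] (fun j r => if r ≤ t then M.sojournMean P c h j r else 0)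
        (M.J 1 ω) (t - M.τ 1 ω) ∂P := by
    intro n
    rw [← setIntegral_sojourn_path hc hh hhi hM h0 hq ht le_rfl hA1 n, add_comm n 1]
  have hdom := fun n => iterate_renew_dominated (sojournMean_dominated hc hh hhi ht) hq n
  have hle : ∀ᵐ ω ∂P.restrict A, t - M.τ 1 ω ≤ t :=
    Eventually.of_forall fun ω => sub_le_self t (M.tau_nonneg 1 ω)
  have hsum2 : HasSum (fun n => ∫ ω in A, (M.renew P)^[n]
      (fun j r => if r ≤ t then M.sojournMean P c h j r else 0) (M.J 1 ω) (t - M.τ 1 ω) ∂P)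
      (∫ ω in A, M.renewalSeries P c h t (M.J 1 ω) (t - M.τ 1 ω) ∂P) := by
    refine hasSum_integral_of_dominated_convergence
      (fun n _ => M.sojournConst P c h t * q ^ n * Real.exp t)
      (fun n => ((hdom n).measurable_eval (M.measurable_J 1)
        (measurable_const.sub (M.measurable_τ 1))).aestronglyMeasurable)
      (fun n => hle.mono fun ω hω => (hdom n).bound_of_le _ hω)
      (Eventually.of_forall fun ω => ?_) (integrable_const _) (Eventually.of_forall fun ω => ?_)
    · exact ((summable_geometric_of_lt_one hq0 hq1).mul_left _).mul_right _
    · exact ((tsum_dominated hq0 hq1 hdom).1 _ _).hasSum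
  simp only [hterm] at hsum1
  have heq := hsum1.unique hsum2
  rw [Finset.sum_range_one, sub_eq_iff_eq_add] at heq
  rw [heq]
  have hfst : ∫ ω in A, sojourn c h (M.J 0 ω) (t - M.τ 0 ω) (M.gap 0 ω) ∂P =
      ∫ ω in A, sojourn c h i t (M.τ 1 ω) ∂P := by
    refine setIntegral_congr_fun hAm fun ω hω => ?_
    have : M.J 0 ω = i := by
      have h3 := hω.1
      rwa [start_eq] at h3
    simp only [this, M.τ_zero, sub_zero, gap_zero]
  rw [hfst, hA, setIntegral_start_stepLaw (h0 i) s (F := fun p => sojourn c h i t p.1)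
    ((measurable_sojourn hc hh i).comp (measurable_const.prodMk measurable_fst)),
    setIntegral_start_stepLaw (h0 i) s (F := fun p => M.renewalSeries P c h t p.2 (t - p.1))
    (hC.measurable_eval measurable_snd (measurable_const.sub measurable_fst)), h2,
    setIntegral_stepLaw_sojourn hd hc hh hcm hhf hs hst, ← mul_add, add_comm]
  congr 2
  exact Finset.sum_congr rfl fun j _ => intervalIntegral.integral_congr (hcongr j)

end

/-! ### Uniqueness for the renewal system -/

section Uniqueness

variable (hd : ∀ i j t, 0 < t → DifferentiableAt ℝ (M.survivalTo P i j) t)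
  (h0 : ∀ i, P (M.start i) ≠ 0)

include hd h0 in
-- Solutions are merely locally integrable, so the contraction is used in L¹ with weight exp(-t): a
-- shift by v costs exp(-v), and averaging over τ 1 costs at most q. The finite maximum of the
-- weighted norms is then at most q times itself.
lemma ae_eq_zero_of_renewal {z : Fin d → ℝ → ℝ} {T : ℝ} (hT : 0 ≤ T)
    (hz : ∀ i, IntervalIntegrable (z i) volume 0 T)
    (heq : ∀ i t, 0 ≤ t → t ≤ T → z i t =
      ∑ j ∈ Finset.univ.erase i, ∫ u in (0 : ℝ)..t, z j (t - u) * M.densityTo P i j u)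
    (i : Fin d) : ∀ᵐ t, t ∈ Set.Icc 0 T → z i t = 0 := by
  obtain ⟨q, hq0, hq1, hq⟩ := exists_laplace_lt_one h0
  have hzI : ∀ j, IntegrableOn (z j) (Set.Icc 0 T) := fun j =>
    (intervalIntegrable_iff_integrableOn_Icc_of_le hT).1 (hz j)
  -- A measurable representative extended by 0 outside [0, T], so that the integrals can run over
  -- the whole line and the weighted norms are finite.
  set y : Fin d → ℝ → ℝ := fun j => (Set.Icc 0 T).indicator ((hzI j).1.mk (z j)) with hy
  have hym : ∀ j, Measurable (y j) := fun j =>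
    (hzI j).1.stronglyMeasurable_mk.measurable.indicator measurableSet_Icc
  have hyz : ∀ j, ∀ᵐ t, t ∈ Set.Icc 0 T → z j t = y j t := by
    intro j
    have := (ae_restrict_iff' measurableSet_Icc).1 (hzI j).1.ae_eq_mk
    filter_upwards [this] with t ht hmem
    rw [hy, ht hmem]
    simp [Set.indicator_of_mem hmem]
  set w : Fin d → ℝ≥0∞ := fun j => ∫⁻ t, ‖y j t‖ₑ * ENNReal.ofReal (Real.exp (-t)) with hw
  have hwfin : ∀ j, w j ≠ ∞ := by
    intro j
    have h1 : w j ≤ ∫⁻ t in Set.Icc 0 T, ‖z j t‖ₑ := by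
      rw [← lintegral_indicator measurableSet_Icc]
      refine lintegral_mono_ae ?_
      filter_upwards [hyz j] with t ht
      by_cases hmem : t ∈ Set.Icc 0 T
      · rw [Set.indicator_of_mem hmem, ht hmem]
        refine mul_le_of_le_one_right' (ENNReal.ofReal_le_one.2 ?_)
        simpa using hmem.1
      · simp [hy, hmem]
    exact ne_top_of_le_ne_top (hzI j).2.ne h1
  -- Absolute values turn the equation into an inequality, in which the term j = i may be put back
  -- to recover the full step law.
  have hbound : ∀ i, ∀ t ∈ Set.Icc 0 T,
      ‖z i t‖ₑ ≤ ∫⁻ p, ‖y p.2 (t - p.1)‖ₑ ∂M.stepLaw P i := by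
    intro i t ht
    have hae : ∀ j, ∀ᵐ u, u ∈ Set.Ioc 0 t → z j (t - u) = y j (t - u) := by
      intro j
      have := (Measure.measurePreserving_sub_left (volume : Measure ℝ) t).quasiMeasurePreserving.ae (hyz j)
      filter_upwards [this] with u hu hmem
      exact hu ⟨sub_nonneg.2 hmem.2, (sub_le_self t hmem.1.le).trans ht.2⟩
    have hmy : Measurable fun q : Fin d × ℝ => y q.1 q.2 := measurable_from_prod_countable_right hym
    rw [lintegral_stepLaw hd i (g := fun p => ‖y p.2 (t - p.1)‖ₑ)
      (hmy.comp (f := fun p : ℝ × Fin d => (p.2, t - p.1))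
      (measurable_snd.prodMk (measurable_const.sub measurable_fst))).enorm, heq i t ht.1 ht.2]
    calc ‖∑ j ∈ Finset.univ.erase i, ∫ u in (0 : ℝ)..t, z j (t - u) * M.densityTo P i j u‖ₑ
        ≤ ∑ j ∈ Finset.univ.erase i, ‖∫ u in (0 : ℝ)..t, z j (t - u) * M.densityTo P i j u‖ₑ :=
          enorm_sum_le _ _
      _ ≤ ∑ j ∈ Finset.univ.erase i, ∫⁻ v, ‖y j (t - v)‖ₑ ∂M.densityLaw P i j := by
          refine Finset.sum_le_sum fun j _ => ?_
          rw [intervalIntegral.integral_of_le ht.1]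
          refine (enorm_integral_le_lintegral_enorm _).trans ?_
          rw [densityLaw, lintegral_withDensity_eq_lintegral_mul _
            (measurable_densityTo i j).ennreal_ofReal
            (show Measurable fun v => ‖y j (t - v)‖ₑ from
              ((hym j).comp (measurable_const.sub measurable_id)).enorm)]
          calc _ = ∫⁻ u in Set.Ioc 0 t, ENNReal.ofReal (M.densityTo P i j u) * ‖y j (t - u)‖ₑ := by
                refine setLIntegral_congr_fun_ae measurableSet_Ioc ?_
                filter_upwards [hae j] with u hu hmem
                rw [enorm_mul, hu hmem, mul_comm, Real.enorm_of_nonneg (densityTo_nonneg i j u)]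
            _ ≤ _ := lintegral_mono_set Set.Ioc_subset_Ioi_self
      _ ≤ _ := Finset.sum_le_sum_of_subset (Finset.erase_subset _ _)
  have hwle : ∀ i, w i ≤ ENNReal.ofReal q * Finset.univ.sup w := by
    intro i
    have hmy : Measurable fun q : Fin d × ℝ => y q.1 q.2 := measurable_from_prod_countable_right hym
    have hjm : Measurable fun x : ℝ × (ℝ × Fin d) => ‖y x.2.2 (x.1 - x.2.1)‖ₑ *
        ENNReal.ofReal (Real.exp (-x.1)) :=
      (hmy.comp (f := fun x : ℝ × (ℝ × Fin d) => (x.2.2, x.1 - x.2.1)) (by fun_prop)).enorm.mul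
        (by fun_prop)
    calc w i ≤ ∫⁻ t : ℝ, ∫⁻ p : ℝ × Fin d,
            ‖y p.2 (t - p.1)‖ₑ * ENNReal.ofReal (Real.exp (-t)) ∂M.stepLaw P i := by
          refine lintegral_mono_ae ?_
          filter_upwards [hyz i] with t ht
          by_cases hmem : t ∈ Set.Icc 0 T
          · rw [lintegral_mul_const' _ _ ENNReal.ofReal_ne_top, ← ht hmem]
            gcongr
            exact hbound i t hmem
          · simp [hy, hmem]
      _ = ∫⁻ p : ℝ × Fin d, (∫⁻ t : ℝ, ‖y p.2 (t - p.1)‖ₑ * ENNReal.ofReal (Real.exp (-t))) ∂M.stepLaw P i :=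
          lintegral_lintegral_swap hjm.aemeasurable
      _ = ∫⁻ p, ENNReal.ofReal (Real.exp (-p.1)) * w p.2 ∂M.stepLaw P i := by
          refine lintegral_congr fun p => ?_
          rw [hw, ← lintegral_const_mul' _ _ ENNReal.ofReal_ne_top,
            ← lintegral_sub_right_eq_self (fun t => ENNReal.ofReal (Real.exp (-p.1)) *
              (‖y p.2 t‖ₑ * ENNReal.ofReal (Real.exp (-t)))) p.1]
          refine lintegral_congr fun t => ?_
          have : Real.exp (-t) = Real.exp (-p.1) * Real.exp (-(t - p.1)) := by
            rw [← Real.exp_add]; ring_nf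
          rw [this, ENNReal.ofReal_mul (Real.exp_nonneg _)]
          ring
      _ ≤ ∫⁻ p, ENNReal.ofReal (Real.exp (-p.1)) * Finset.univ.sup w ∂M.stepLaw P i := by
          gcongr with p
          exact Finset.le_sup (f := w) (Finset.mem_univ p.2)
      _ = ENNReal.ofReal (∫ p, Real.exp (-p.1) ∂M.stepLaw P i) * Finset.univ.sup w := by
          rw [lintegral_mul_const _ (by fun_prop), ofReal_integral_eq_lintegral_ofReal
            (integrable_exp_neg i) (Eventually.of_forall fun p => (Real.exp_pos _).le)]
      _ ≤ _ := by
          gcongr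
          exact hq i
  have hsup : Finset.univ.sup w = 0 := by
    have h1 : Finset.univ.sup w ≤ ENNReal.ofReal q * Finset.univ.sup w :=
      Finset.sup_le fun i _ => hwle i
    have hfin : Finset.univ.sup w ≠ ∞ := by
      rw [← lt_top_iff_ne_top, Finset.sup_lt_iff ENNReal.zero_lt_top]
      exact fun j _ => (hwfin j).lt_top
    by_contra hne
    have h2 : ENNReal.ofReal q * Finset.univ.sup w < 1 * Finset.univ.sup w :=
      ENNReal.mul_lt_mul_left hne hfin (by simpa using hq1)
    rw [one_mul] at h2
    exact absurd h1 (not_le.2 h2)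
  have hwi : w i = 0 := le_antisymm (hsup ▸ Finset.le_sup (f := w) (Finset.mem_univ i)) zero_le
  rw [show w i = ∫⁻ t, ‖y i t‖ₑ * ENNReal.ofReal (Real.exp (-t)) from rfl,
    lintegral_eq_zero_iff (show Measurable fun t => ‖y i t‖ₑ * ENNReal.ofReal (Real.exp (-t)) from
      (hym i).enorm.mul (by fun_prop))] at hwi
  filter_upwards [hwi, hyz i] with t h1 h2 hmem
  rw [h2 hmem]
  have h3 : ENNReal.ofReal (Real.exp (-t)) ≠ 0 := by simp [Real.exp_pos]
  simpa [h3] using h1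

include hd h0 in
-- The right-hand side depends on `z` only up to null sets, so vanishing almost everywhere on [0, t]
-- forces the value at t to be 0.
lemma eq_zero_of_renewal {z : Fin d → ℝ → ℝ}
    (hz : ∀ i t, 0 ≤ t → IntervalIntegrable (z i) volume 0 t)
    (heq : ∀ i t, 0 ≤ t → z i t =
      ∑ j ∈ Finset.univ.erase i, ∫ u in (0 : ℝ)..t, z j (t - u) * M.densityTo P i j u)
    (i : Fin d) {t : ℝ} (ht : 0 ≤ t) : z i t = 0 := by
  rw [heq i t ht]
  refine Finset.sum_eq_zero fun j _ => ?_
  have hj := ae_eq_zero_of_renewal hd h0 ht (fun i => hz i t ht)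
    (fun i r hr _ => heq i r hr) j
  refine intervalIntegral.integral_zero_ae ?_
  have := (Measure.measurePreserving_sub_left (volume : Measure ℝ) t).quasiMeasurePreserving.ae hj
  filter_upwards [this] with u hu hmem
  rw [Set.uIoc_of_le ht] at hmem
  rw [hu ⟨sub_nonneg.2 hmem.2, sub_le_self t hmem.1.le⟩, zero_mul]

end Uniqueness

end Switching

end RegimeSwitching

namespace RegimeSwitching

/-! ### Integrals of simple predictable processes -/

namespace IsFilteredBrownian

variable {Ω : Type*} [mΩ : MeasurableSpace Ω] {P : Measure Ω} [IsProbabilityMeasure P]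
  {ℱ : Filtration ℝ≥0 mΩ} {B : ℝ≥0 → Ω → ℝ} (hB : IsFilteredBrownian ℱ P B)

include hB

lemma hasLaw_increment (s t : ℝ≥0) :
    HasLaw (fun ω => B t ω - B s ω) (gaussianReal 0 (nndist t.1 s.1)) P :=
  hB.isBrownian.toIsPreBrownianReal.hasLaw_sub t s

lemma integral_increment (s t : ℝ≥0) : ∫ ω, (B t ω - B s ω) ∂P = 0 := by
  rw [(hB.hasLaw_increment s t).integral_eq, integral_id_gaussianReal]

lemma measurable (t : ℝ≥0) : Measurable (B t) := (hB.adapted t).mono (ℱ.le t) le_rfl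

lemma memLp_increment (s t : ℝ≥0) : MemLp (fun ω => B t ω - B s ω) 2 P := by
  have h := memLp_id_gaussianReal (μ := 0) (v := nndist t.1 s.1) 2
  rw [← (hB.hasLaw_increment s t).map_eq] at h
  exact h.comp_of_map (hB.hasLaw_increment s t).aemeasurable

lemma integral_increment_sq {s t : ℝ≥0} (h : s ≤ t) :
    ∫ ω, (B t ω - B s ω) ^ 2 ∂P = (t : ℝ) - s := by
  have h1 := (hB.hasLaw_increment s t).variance_eq
  rw [variance_id_gaussianReal, variance_eq_integral (hB.hasLaw_increment s t).aemeasurable,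
    hB.integral_increment] at h1
  simp only [sub_zero] at h1
  rw [h1, coe_nndist, Real.dist_eq, abs_of_nonneg]
  · rfl
  · exact sub_nonneg.2 h

lemma indepFun_increment {s t : ℝ≥0} (h : s ≤ t) {Z : Ω → ℝ} (hZ : Measurable[ℱ s] Z) :
    IndepFun Z (fun ω => B t ω - B s ω) P := by
  have := (hB.indep_increment s t h).symm
  exact indep_of_indep_of_le_left this hZ.comap_le

lemma integral_mul_increment {s t : ℝ≥0} (h : s ≤ t) {Z : Ω → ℝ} (hZ : Measurable[ℱ s] Z) :
    ∫ ω, Z ω * (B t ω - B s ω) ∂P = 0 := by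
  rw [(hB.indepFun_increment h hZ).integral_fun_mul_eq_mul_integral
    (hZ.mono (ℱ.le s) le_rfl).aestronglyMeasurable (hB.memLp_increment s t).1,
    hB.integral_increment, mul_zero]

lemma integral_mul_increment_sq {s t : ℝ≥0} (h : s ≤ t) {Z : Ω → ℝ} (hZ : Measurable[ℱ s] Z) :
    ∫ ω, Z ω * (B t ω - B s ω) ^ 2 ∂P = (∫ ω, Z ω ∂P) * ((t : ℝ) - s) := by
  have hind : IndepFun Z (fun ω => (B t ω - B s ω) ^ 2) P :=
    (hB.indepFun_increment h hZ).comp measurable_id (φ := id) (ψ := fun x => x ^ 2) (by fun_prop)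
  rw [hind.integral_fun_mul_eq_mul_integral
    (hZ.mono (ℱ.le s) le_rfl).aestronglyMeasurable
    ((hB.memLp_increment s t).1.pow 2), hB.integral_increment_sq h]

section StepSum

variable {q : ℕ → ℝ≥0} (hq : Monotone q) {ζ : ℕ → Ω → ℝ} (hζ : ∀ k, Measurable[ℱ (q k)] (ζ k))
  (hb : ∀ k, ∃ C : ℝ, ∀ ω, |ζ k ω| ≤ C)

include hq hζ in
lemma measurable_stepSum (n : ℕ) :
    Measurable[ℱ (q n)] fun ω => ∑ k ∈ Finset.range n, ζ k ω * (B (q (k + 1)) ω - B (q k) ω) := by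
  refine Finset.measurable_fun_sum _ fun k hk => ?_
  have hk' : k + 1 ≤ n := Finset.mem_range.1 hk
  have m1 : Measurable[ℱ (q n)] (ζ k) := (hζ k).mono (ℱ.mono (hq (by omega))) le_rfl
  have m2 : Measurable[ℱ (q n)] (B (q (k + 1))) :=
    (hB.adapted _).mono (ℱ.mono (hq hk')) le_rfl
  have m3 : Measurable[ℱ (q n)] (B (q k)) := (hB.adapted _).mono (ℱ.mono (hq (by omega))) le_rfl
  exact m1.mul (m2.sub m3)

include hζ hb in
lemma memLp_mul_increment (k : ℕ) (s t : ℝ≥0) :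
    MemLp (fun ω => ζ k ω * (B t ω - B s ω)) 2 P := by
  obtain ⟨C, hC⟩ := hb k
  refine (hB.memLp_increment s t).of_le_mul (c := C)
    (((hζ k).mono (ℱ.le _) le_rfl).aestronglyMeasurable.mul (hB.memLp_increment s t).1)
    (Eventually.of_forall fun ω => ?_)
  rw [norm_mul]
  exact mul_le_mul_of_nonneg_right (hC ω) (norm_nonneg _)

include hζ hb in
lemma memLp_stepSum (n : ℕ) :
    MemLp (fun ω => ∑ k ∈ Finset.range n, ζ k ω * (B (q (k + 1)) ω - B (q k) ω)) 2 P :=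
  memLp_finsetSum _ fun k _ => hB.memLp_mul_increment hζ hb k _ _

include hq hζ hb in
lemma integral_mul_stepSum (n : ℕ) {Z : Ω → ℝ} (hZ : Measurable[ℱ (q 0)] Z) (hZ2 : MemLp Z 2 P) :
    ∫ ω, Z ω * ∑ k ∈ Finset.range n, ζ k ω * (B (q (k + 1)) ω - B (q k) ω) ∂P = 0 := by
  simp_rw [Finset.mul_sum]
  have hi : ∀ k, Integrable (fun ω => Z ω * (ζ k ω * (B (q (k + 1)) ω - B (q k) ω))) P := fun k =>
    hZ2.integrable_mul (hB.memLp_mul_increment hζ hb k _ _)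
  rw [integral_finsetSum _ fun k _ => hi k]
  refine Finset.sum_eq_zero fun k _ => ?_
  simp_rw [← mul_assoc]
  exact hB.integral_mul_increment (hq (Nat.le_succ k))
    ((hZ.mono (ℱ.mono (hq (Nat.zero_le k))) le_rfl).mul (hζ k))

include hq hζ hb in
-- The Itô isometry: the partial sum and the next coefficient are known at time `q n`, while the
-- next increment is centred and independent of that past, so the cross terms vanish.
lemma integral_stepSum_sq (n : ℕ) :
    ∫ ω, (∑ k ∈ Finset.range n, ζ k ω * (B (q (k + 1)) ω - B (q k) ω)) ^ 2 ∂P =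
      ∑ k ∈ Finset.range n, (∫ ω, ζ k ω ^ 2 ∂P) * ((q (k + 1) : ℝ) - q k) := by
  induction n with
  | zero => simp
  | succ n ih =>
    rw [Finset.sum_range_succ, ← ih]
    set I := fun ω => ∑ k ∈ Finset.range n, ζ k ω * (B (q (k + 1)) ω - B (q k) ω) with hI
    have hI2 : MemLp I 2 P := hB.memLp_stepSum hζ hb n
    have hZ2 := hB.memLp_mul_increment hζ hb n (q n) (q (n + 1))
    have hIm : Measurable[ℱ (q n)] I := hB.measurable_stepSum hq hζ n
    have e : ∀ ω, (∑ k ∈ Finset.range (n + 1), ζ k ω * (B (q (k + 1)) ω - B (q k) ω)) ^ 2 =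
        I ω ^ 2 + (2 * (I ω * (ζ n ω * (B (q (n + 1)) ω - B (q n) ω))) +
          ζ n ω ^ 2 * (B (q (n + 1)) ω - B (q n) ω) ^ 2) := by
      intro ω
      rw [Finset.sum_range_succ, hI]
      ring
    have hcross : ∫ ω, I ω * (ζ n ω * (B (q (n + 1)) ω - B (q n) ω)) ∂P = 0 := by
      simp_rw [← mul_assoc]
      exact hB.integral_mul_increment (hq (Nat.le_succ n)) (hIm.mul (hζ n))
    have hsq : Integrable (fun ω => ζ n ω ^ 2 * (B (q (n + 1)) ω - B (q n) ω) ^ 2) P := by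
      simpa only [mul_pow] using hZ2.integrable_sq
    have hcr : Integrable (fun ω => 2 * (I ω * (ζ n ω * (B (q (n + 1)) ω - B (q n) ω)))) P :=
      (hI2.integrable_mul hZ2).const_mul 2
    have hsum : Integrable (fun ω => 2 * (I ω * (ζ n ω * (B (q (n + 1)) ω - B (q n) ω))) +
        ζ n ω ^ 2 * (B (q (n + 1)) ω - B (q n) ω) ^ 2) P := hcr.add hsq
    simp_rw [e]
    rw [integral_add hI2.integrable_sq hsum, integral_add hcr hsq, integral_const_mul,
      hcross, hB.integral_mul_increment_sq (hq (Nat.le_succ n)) ((hζ n).pow_const 2)]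
    ring

end StepSum

end IsFilteredBrownian

/-! ### Itô isometry on an interval (u, v] and on events of ℱ_u -/

namespace SimplePredictable

variable {Ω : Type*} [mΩ : MeasurableSpace Ω] {P : Measure Ω} [IsProbabilityMeasure P]
  {ℱ : Filtration ℝ≥0 mΩ} {B : ℝ≥0 → Ω → ℝ} (S : SimplePredictable ℱ)

/-- The partition of `S`, restricted to the interval `[u, v]`. -/
noncomputable def clamp (u v : ℝ≥0) (k : ℕ) : ℝ≥0 := max u (min (S.p k) v)

lemma monotone_clamp (u v : ℝ≥0) : Monotone (S.clamp u v) := fun _ _ h =>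
  max_le_max le_rfl (min_le_min (S.mono h) le_rfl)

/-- `∫ S² dx` over `(u, v]`. -/
noncomputable def energy (u v : ℝ≥0) (ω : Ω) : ℝ :=
  ∑ k ∈ Finset.range S.n, S.ξ k ω ^ 2 * ((S.clamp u v (k + 1) : ℝ) - S.clamp u v k)

lemma clamp_eq_of_lt {u v : ℝ≥0} (huv : u ≤ v) {k : ℕ} (h : v < S.p k) : S.clamp u v k = v := by
  rw [clamp, min_eq_right h.le, max_eq_right huv]

lemma clamp_sub_eq_zero {u v : ℝ≥0} (huv : u ≤ v) {k : ℕ} (h : v < S.p k) :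
    S.clamp u v (k + 1) = S.clamp u v k := by
  rw [S.clamp_eq_of_lt huv h, S.clamp_eq_of_lt huv (h.trans_le (S.mono (Nat.le_succ k)))]

/-- Clamping the partition to [u, v] makes the difference a step sum. A coefficient with `p k > v`
has to be replaced by 0, since it need not be known at the clamped time v; its clamped increment is
zero anyway. -/
lemma integral_sub_integral {u v : ℝ≥0} (huv : u ≤ v) (ω : Ω) :
    S.integral B v ω - S.integral B u ω = ∑ k ∈ Finset.range S.n,
      (if S.p k ≤ v then S.ξ k ω else 0) * (B (S.clamp u v (k + 1)) ω - B (S.clamp u v k) ω) := by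
  have key : ∀ p : ℝ≥0, B (min p v) ω - B (min p u) ω = B (max u (min p v)) ω - B u ω := by
    intro p
    rcases le_total p u with h | h
    · rw [min_eq_left h, min_eq_left (h.trans huv), max_eq_left h, sub_self, sub_self]
    · rw [min_eq_right h, max_eq_right (le_min h huv)]
  rw [integral, integral, ← Finset.sum_sub_distrib]
  refine Finset.sum_congr rfl fun k _ => ?_
  split_ifs with h
  · rw [clamp, clamp]
    linear_combination S.ξ k ω * (key (S.p (k + 1)) - key (S.p k))
  · push Not at h
    have h' := h.trans_le (S.mono (Nat.le_succ k))
    rw [min_eq_right h.le, min_eq_right h'.le, min_eq_right (huv.trans h.le),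
      min_eq_right (huv.trans h'.le)]
    ring

lemma measurable_coeff {u v : ℝ≥0} (k : ℕ) :
    Measurable[ℱ (S.clamp u v k)] fun ω => if S.p k ≤ v then S.ξ k ω else 0 := by
  by_cases h : S.p k ≤ v
  · simp only [h, if_true]
    refine (S.measurable_ξ k).mono (ℱ.mono ?_) le_rfl
    rw [clamp, min_eq_left h]
    exact le_max_right _ _
  · simp only [h, if_false]
    exact measurable_const

lemma bounded_coeff {v : ℝ≥0} (k : ℕ) :
    ∃ C : ℝ, ∀ ω, |if S.p k ≤ v then S.ξ k ω else 0| ≤ C := by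
  obtain ⟨C, hC⟩ := S.bounded_ξ k
  refine ⟨C, fun ω => ?_⟩
  split_ifs
  · exact hC ω
  · rw [abs_zero]
    exact (abs_nonneg _).trans (hC ω)

lemma integral_zero_time (ω : Ω) : S.integral B 0 ω = 0 := by
  simp [integral]

section Brownian

variable (hB : IsFilteredBrownian ℱ P B)

include hB

lemma memLp_integral_sub {u v : ℝ≥0} (huv : u ≤ v) :
    MemLp (fun ω => S.integral B v ω - S.integral B u ω) 2 P := by
  simp_rw [S.integral_sub_integral huv]
  exact hB.memLp_stepSum S.measurable_coeff S.bounded_coeff S.n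

lemma memLp_integral (v : ℝ≥0) : MemLp (S.integral B v) 2 P := by
  simpa only [integral_zero_time, sub_zero] using S.memLp_integral_sub hB (zero_le (a := v))

lemma measurable_integral (v : ℝ≥0) : Measurable[ℱ v] (S.integral B v) := by
  unfold integral
  refine Finset.measurable_fun_sum _ fun k _ => ?_
  have hadp : ∀ p, Measurable[ℱ v] (B (min p v)) := fun p =>
    (hB.adapted _).mono (ℱ.mono (min_le_right p v)) le_rfl
  by_cases h : S.p k ≤ v
  · exact ((S.measurable_ξ k).mono (ℱ.mono h) le_rfl).mul ((hadp _).sub (hadp _))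
  · push Not at h
    have h' := h.trans_le (S.mono (Nat.le_succ k))
    simp only [min_eq_right h.le, min_eq_right h'.le, sub_self, mul_zero]
    exact measurable_const

lemma integral_mul_sub_eq_zero {u v : ℝ≥0} (huv : u ≤ v) {Z : Ω → ℝ} (hZ : Measurable[ℱ u] Z)
    (hZ2 : MemLp Z 2 P) : ∫ ω, Z ω * (S.integral B v ω - S.integral B u ω) ∂P = 0 := by
  simp_rw [S.integral_sub_integral huv]
  exact hB.integral_mul_stepSum (S.monotone_clamp u v) S.measurable_coeff S.bounded_coeff S.n
    (hZ.mono (ℱ.mono (le_max_left _ _)) le_rfl) hZ2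

lemma setIntegral_sub_eq_zero {u v : ℝ≥0} (huv : u ≤ v) {A : Set Ω} (hA : MeasurableSet[ℱ u] A) :
    ∫ ω in A, (S.integral B v ω - S.integral B u ω) ∂P = 0 := by
  have hm : MeasurableSet A := ℱ.le u A hA
  have h1 := S.integral_mul_sub_eq_zero hB huv (Z := A.indicator fun _ => 1)
    (measurable_const.indicator hA) (memLp_indicator_const 2 hm 1 (Or.inr (measure_ne_top _ _)))
  rw [← integral_indicator hm, ← h1]
  congr 1
  ext ω
  by_cases hω : ω ∈ A <;> simp [hω]

/-- The clamped times are at least u, so the indicator of `A` can be absorbed into the coefficients.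
-/
lemma setIntegral_sub_sq {u v : ℝ≥0} (huv : u ≤ v) {A : Set Ω} (hA : MeasurableSet[ℱ u] A) :
    ∫ ω in A, (S.integral B v ω - S.integral B u ω) ^ 2 ∂P = ∫ ω in A, S.energy u v ω ∂P := by
  have hm : MeasurableSet A := ℱ.le u A hA
  have h1 := hB.integral_stepSum_sq (S.monotone_clamp u v)
    (ζ := fun k => A.indicator fun ω => if S.p k ≤ v then S.ξ k ω else 0)
    (fun k => (S.measurable_coeff k).indicator (ℱ.mono (le_max_left _ _) A hA))
    (fun k => by
      obtain ⟨C, hC⟩ := S.bounded_coeff (v := v) k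
      refine ⟨C, fun ω => ?_⟩
      by_cases hω : ω ∈ A
      · simpa only [Set.indicator_of_mem hω] using hC ω
      · rw [Set.indicator_of_notMem hω, abs_zero]
        exact (abs_nonneg _).trans (hC ω)) S.n
  have hint : ∀ k, Integrable (fun ω => S.ξ k ω ^ 2 *
      ((S.clamp u v (k + 1) : ℝ) - S.clamp u v k)) P := by
    intro k
    obtain ⟨C, hC⟩ := S.bounded_ξ k
    refine Integrable.mul_const ?_ _
    refine Integrable.of_bound
      (((S.measurable_ξ k).mono (ℱ.le _) le_rfl).pow_const 2).aestronglyMeasurable (C ^ 2)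
      (Eventually.of_forall fun ω => ?_)
    rw [norm_pow]
    exact pow_le_pow_left₀ (norm_nonneg _) (hC ω) 2
  unfold energy
  rw [integral_finsetSum _ fun k _ => (hint k).integrableOn, ← integral_indicator hm]
  trans ∫ ω, (∑ k ∈ Finset.range S.n, A.indicator (fun ω => if S.p k ≤ v then S.ξ k ω else 0) ω *
      (B (S.clamp u v (k + 1)) ω - B (S.clamp u v k) ω)) ^ 2 ∂P
  · congr 1
    ext ω
    by_cases hω : ω ∈ A
    · simp only [Set.indicator_of_mem hω, S.integral_sub_integral huv]
    · simp [Set.indicator_of_notMem hω]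
  · rw [h1]
    refine Finset.sum_congr rfl fun k _ => ?_
    rw [integral_mul_const]
    by_cases h : S.p k ≤ v
    · rw [← integral_indicator hm]
      congr 2
      ext ω
      by_cases hω : ω ∈ A <;> simp [hω, h]
    · rw [S.clamp_sub_eq_zero huv (not_le.1 h), sub_self, mul_zero, mul_zero]

end Brownian

lemma energy_nonneg (u v : ℝ≥0) (ω : Ω) : 0 ≤ S.energy u v ω :=
  Finset.sum_nonneg fun k _ => mul_nonneg (sq_nonneg _)
    (sub_nonneg.2 (NNReal.coe_le_coe.2 (S.monotone_clamp u v (Nat.le_succ k))))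

lemma exists_bound : ∃ C : ℝ, 0 ≤ C ∧ ∀ k < S.n, ∀ ω, S.ξ k ω ^ 2 ≤ C := by
  choose C hC using S.bounded_ξ
  refine ⟨∑ k ∈ Finset.range S.n, C k ^ 2, Finset.sum_nonneg fun k _ => sq_nonneg _,
    fun k hk ω => ?_⟩
  calc S.ξ k ω ^ 2 = |S.ξ k ω| ^ 2 := (sq_abs _).symm
    _ ≤ C k ^ 2 := pow_le_pow_left₀ (abs_nonneg _) (hC k ω) 2
    _ ≤ _ := Finset.single_le_sum (f := fun k => C k ^ 2) (fun _ _ => sq_nonneg _)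
        (Finset.mem_range.2 hk)

lemma energy_le {C : ℝ} (hC0 : 0 ≤ C) (hC : ∀ k < S.n, ∀ ω, S.ξ k ω ^ 2 ≤ C) {u v : ℝ≥0}
    (huv : u ≤ v) (ω : Ω) : S.energy u v ω ≤ C * ((v : ℝ) - u) := by
  calc S.energy u v ω ≤ ∑ k ∈ Finset.range S.n,
        C * ((S.clamp u v (k + 1) : ℝ) - S.clamp u v k) := by
        refine Finset.sum_le_sum fun k hk => ?_
        exact mul_le_mul_of_nonneg_right (hC k (Finset.mem_range.1 hk) ω)
          (sub_nonneg.2 (NNReal.coe_le_coe.2 (S.monotone_clamp u v (Nat.le_succ k))))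
    _ = C * ((S.clamp u v S.n : ℝ) - S.clamp u v 0) := by
        rw [← Finset.mul_sum, Finset.sum_range_sub fun k => (S.clamp u v k : ℝ)]
    _ ≤ C * ((v : ℝ) - u) := by
        refine mul_le_mul_of_nonneg_left (sub_le_sub ?_ ?_) hC0
        · exact NNReal.coe_le_coe.2 (max_le huv (min_le_right _ _))
        · exact NNReal.coe_le_coe.2 (le_max_left _ _)

lemma measurable_energy (u v : ℝ≥0) : Measurable (S.energy u v) :=
  Finset.measurable_fun_sum _ fun k _ =>
    (((S.measurable_ξ k).mono (ℱ.le _) le_rfl).pow_const 2).mul_const _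

lemma integrable_energy {u v : ℝ≥0} (huv : u ≤ v) : Integrable (S.energy u v) P := by
  obtain ⟨C, hC0, hC⟩ := S.exists_bound
  refine Integrable.of_bound (S.measurable_energy u v).aestronglyMeasurable (C * ((v : ℝ) - u))
    (Eventually.of_forall fun ω => ?_)
  rw [Real.norm_of_nonneg (S.energy_nonneg u v ω)]
  exact S.energy_le hC0 hC huv ω

lemma eval_sq (x : ℝ) (ω : Ω) :
    S.eval x ω ^ 2 = ∑ k ∈ Finset.range S.n,
      (Set.Ioc (S.p k : ℝ) (S.p (k + 1))).indicator (fun _ => S.ξ k ω ^ 2) x := by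
  rw [eval, sq, Finset.sum_mul_sum]
  refine Finset.sum_congr rfl fun k hk => ?_
  rw [Finset.sum_eq_single k]
  · by_cases hx : x ∈ Set.Ioc (S.p k : ℝ) (S.p (k + 1))
    · simp only [Set.indicator_of_mem hx, sq]
    · simp only [Set.indicator_of_notMem hx, mul_zero]
  · intro l _ hl
    by_cases hx : x ∈ Set.Ioc (S.p k : ℝ) (S.p (k + 1))
    · have : x ∉ Set.Ioc (S.p l : ℝ) (S.p (l + 1)) := by
        intro hx'
        rcases lt_or_gt_of_ne hl with h | h
        · have : (S.p (l + 1) : ℝ) ≤ S.p k := NNReal.coe_le_coe.2 (S.mono h)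
          linarith [hx.1, hx'.2]
        · have : (S.p (k + 1) : ℝ) ≤ S.p l := NNReal.coe_le_coe.2 (S.mono h)
          linarith [hx.2, hx'.1]
      rw [Set.indicator_of_notMem this, mul_zero]
    · rw [Set.indicator_of_notMem hx, zero_mul]
  · exact fun h => absurd hk h

lemma lintegral_eval_sq {u v : ℝ≥0} (huv : u ≤ v) (ω : Ω) :
    ∫⁻ x in Set.Ioc (u : ℝ) v, ‖S.eval x ω‖ₑ ^ 2 = ENNReal.ofReal (S.energy u v ω) := by
  have e1 : ∀ x, ‖S.eval x ω‖ₑ ^ 2 = ENNReal.ofReal (S.eval x ω ^ 2) := fun x => by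
    rw [← enorm_pow, Real.enorm_of_nonneg (sq_nonneg _)]
  have hi : ∀ k, Integrable ((Set.Ioc (S.p k : ℝ) (S.p (k + 1))).indicator
      (fun _ => S.ξ k ω ^ 2)) (volume.restrict (Set.Ioc (u : ℝ) v)) := fun k =>
    (integrable_const _).indicator measurableSet_Ioc
  have hval : ∫ x in Set.Ioc (u : ℝ) v, S.eval x ω ^ 2 = S.energy u v ω := by
    simp_rw [S.eval_sq]
    rw [integral_finsetSum _ fun k _ => hi k, energy]
    refine Finset.sum_congr rfl fun k _ => ?_
    rw [integral_indicator measurableSet_Ioc, Measure.restrict_restrict measurableSet_Ioc,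
      setIntegral_const, smul_eq_mul, mul_comm, Set.Ioc_inter_Ioc, Real.volume_real_Ioc]
    congr 1
    have hp : (S.p k : ℝ) ≤ S.p (k + 1) := NNReal.coe_le_coe.2 (S.mono (Nat.le_succ k))
    have huv' : (u : ℝ) ≤ v := NNReal.coe_le_coe.2 huv
    simp only [clamp, NNReal.coe_max, NNReal.coe_min]
    simp only [max_def, min_def]
    split_ifs <;> linarith
  rw [← hval, ofReal_integral_eq_lintegral_ofReal]
  · simp_rw [e1]
  · simp_rw [S.eval_sq]
    exact integrable_finsetSum _ fun k _ => hi k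
  · exact Eventually.of_forall fun x => sq_nonneg _

lemma measurable_eval : Measurable fun q : ℝ × Ω => S.eval q.1 q.2 := by
  unfold eval
  refine Finset.measurable_fun_sum _ fun k _ => ?_
  have : (fun q : ℝ × Ω => (Set.Ioc (S.p k : ℝ) (S.p (k + 1))).indicator (fun _ => S.ξ k q.2) q.1)
      = (Prod.fst ⁻¹' (Set.Ioc (S.p k : ℝ) (S.p (k + 1)))).indicator fun q => S.ξ k q.2 := by
    ext q
    simp [Set.indicator]
  rw [this]
  exact (((S.measurable_ξ k).mono (ℱ.le _) le_rfl).comp measurable_snd).indicator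
    (measurable_fst measurableSet_Ioc)

/-- Subtract the deterministic step function with the values `a k`. -/
def subConst (a : ℕ → ℝ) : SimplePredictable ℱ where
  n := S.n
  p := S.p
  mono := S.mono
  ξ k ω := S.ξ k ω - a k
  measurable_ξ k := (S.measurable_ξ k).sub measurable_const
  bounded_ξ k := by
    obtain ⟨C, hC⟩ := S.bounded_ξ k
    exact ⟨C + |a k|, fun ω => (abs_sub _ _).trans (add_le_add (hC ω) le_rfl)⟩

lemma subConst_eval (a : ℕ → ℝ) (x : ℝ) (ω : Ω) :
    (S.subConst a).eval x ω = S.eval x ω - ∑ k ∈ Finset.range S.n,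
      (Set.Ioc (S.p k : ℝ) (S.p (k + 1))).indicator (fun _ => a k) x := by
  rw [eval, eval, ← Finset.sum_sub_distrib]
  refine Finset.sum_congr rfl fun k _ => ?_
  by_cases hx : x ∈ Set.Ioc (S.p k : ℝ) (S.p (k + 1))
  · simp only [subConst, Set.indicator_of_mem hx]
  · simp only [subConst, Set.indicator_of_notMem hx, sub_self]

lemma subConst_integral (a : ℕ → ℝ) (t : ℝ≥0) (ω : Ω) :
    (S.subConst a).integral B t ω = S.integral B t ω - ∑ k ∈ Finset.range S.n,
      a k * (B (min (S.p (k + 1)) t) ω - B (min (S.p k) t) ω) := by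
  rw [integral, integral, ← Finset.sum_sub_distrib]
  refine Finset.sum_congr rfl fun k _ => ?_
  simp only [subConst]
  ring

end SimplePredictable

end RegimeSwitching

namespace RegimeSwitching

namespace SimplePredictable

variable {Ω : Type*} [mΩ : MeasurableSpace Ω] {P : Measure Ω} [IsProbabilityMeasure P]
  {ℱ : Filtration ℝ≥0 mΩ} {B : ℝ≥0 → Ω → ℝ} (S : SimplePredictable ℱ)

/-! ### Integrals on a decreasing family of events -/

section Localized

variable (hB : IsFilteredBrownian ℱ P B) {A : ℝ≥0 → Set Ω} (hA : ∀ u, MeasurableSet[ℱ u] (A u))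
  (hanti : Antitone A)

include hB hA hanti

/-- Enlarge `A v` to `A u`, an event known at time u; then the increment over (u, v] is orthogonal
to the integral up to u. -/
lemma setIntegral_sq_le {u v : ℝ≥0} (huv : u ≤ v) :
    ∫ ω in A v, S.integral B v ω ^ 2 ∂P ≤
      ∫ ω in A u, S.integral B u ω ^ 2 ∂P + ∫ ω in A u, S.energy u v ω ∂P := by
  have hm : MeasurableSet (A u) := ℱ.le u _ (hA u)
  have hu := S.memLp_integral hB u
  have hv := S.memLp_integral hB v
  have hd := S.memLp_integral_sub hB huv
  have h1 : ∫ ω in A v, S.integral B v ω ^ 2 ∂P ≤ ∫ ω in A u, S.integral B v ω ^ 2 ∂P :=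
    setIntegral_mono_set hv.integrable_sq.integrableOn (Eventually.of_forall fun _ => sq_nonneg _)
      (hanti huv).eventuallyLE
  have h2 : ∫ ω in A u, S.integral B u ω * (S.integral B v ω - S.integral B u ω) ∂P = 0 := by
    have := S.integral_mul_sub_eq_zero hB huv (Z := (A u).indicator (S.integral B u))
      ((S.measurable_integral hB u).indicator (hA u)) (hu.indicator hm)
    rw [← integral_indicator hm, ← this]
    congr 1
    ext ω
    by_cases hω : ω ∈ A u <;> simp [hω]
  have hcr : Integrable (fun ω => 2 * (S.integral B u ω *
      (S.integral B v ω - S.integral B u ω))) P := (hu.integrable_mul hd).const_mul 2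
  have hsum : Integrable (fun ω => 2 * (S.integral B u ω *
      (S.integral B v ω - S.integral B u ω)) + (S.integral B v ω - S.integral B u ω) ^ 2) P :=
    hcr.add hd.integrable_sq
  have h3 : ∫ ω in A u, S.integral B v ω ^ 2 ∂P =
      ∫ ω in A u, S.integral B u ω ^ 2 ∂P + ∫ ω in A u, S.energy u v ω ∂P := by
    have e : ∀ ω, S.integral B v ω ^ 2 = S.integral B u ω ^ 2 + (2 * (S.integral B u ω *
        (S.integral B v ω - S.integral B u ω)) + (S.integral B v ω - S.integral B u ω) ^ 2) :=
      fun ω => by ring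
    simp_rw [e]
    rw [integral_add hu.integrable_sq.integrableOn hsum.integrableOn,
      integral_add hcr.integrableOn hd.integrable_sq.integrableOn, integral_const_mul, h2,
      S.setIntegral_sub_sq hB huv (hA u)]
    ring
  exact h1.trans h3.le

/-- Passing from `A u` back to `A v` in the energy term loses at most C δ P(A u \ A v). These losses
telescope, so the total error is at most C δ for any number of steps. -/
lemma setIntegral_sq_le_sum {C : ℝ} (hC0 : 0 ≤ C) (hC : ∀ k < S.n, ∀ ω, S.ξ k ω ^ 2 ≤ C)
    {δ : ℝ≥0} (n : ℕ) :
    ∫ ω in A (n * δ), S.integral B (n * δ) ω ^ 2 ∂P ≤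
      ∑ l ∈ Finset.range n, ∫ ω in A ((l + 1 : ℕ) * δ), S.energy (l * δ) ((l + 1 : ℕ) * δ) ω ∂P +
        C * δ * (P.real (A 0) - P.real (A (n * δ))) := by
  induction n with
  | zero => simp [integral_zero_time]
  | succ n ih =>
    have hle : (n : ℝ≥0) * δ ≤ (n + 1 : ℕ) * δ := by gcongr; simp
    have h1 := S.setIntegral_sq_le hB hA hanti hle
    set u := (n : ℝ≥0) * δ with hu
    set v := ((n + 1 : ℕ) : ℝ≥0) * δ with hv
    have hmv : MeasurableSet (A v) := ℱ.le v _ (hA v)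
    have hmu : MeasurableSet (A u) := ℱ.le u _ (hA u)
    have hvu : (v : ℝ) - u = δ := by rw [hu, hv]; push_cast; ring
    have hint := S.integrable_energy (P := P) hle
    have h2 : ∫ ω in A u, S.energy u v ω ∂P =
        ∫ ω in A v, S.energy u v ω ∂P + ∫ ω in A u \ A v, S.energy u v ω ∂P := by
      rw [← setIntegral_union Set.disjoint_sdiff_right (hmu.diff hmv) hint.integrableOn
        hint.integrableOn, Set.union_sdiff_cancel (hanti hle)]
    have h3 : ∫ ω in A u \ A v, S.energy u v ω ∂P ≤ C * δ * (P.real (A u) - P.real (A v)) := by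
      calc _ ≤ ∫ ω in A u \ A v, C * δ ∂P := by
            refine setIntegral_mono hint.integrableOn (integrable_const _) fun ω => ?_
            have := S.energy_le hC0 hC hle ω
            rwa [hvu] at this
        _ = _ := by
            rw [setIntegral_const, smul_eq_mul, measureReal_sdiff (hanti hle) hmv, mul_comm]
    rw [Finset.sum_range_succ]
    linarith

/-- An Itô estimate stopped when the path leaves the decreasing events, obtained without stopping
times: the energy over (u, v] is taken on `A v`, so it only sees points of `U`, and the mesh then
tends to 0. -/
lemma setIntegral_sq_le_lintegral {U : Set (ℝ × Ω)} (hU : MeasurableSet U)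
    (hAU : ∀ u ω x, 0 < x → x ≤ ((u : ℝ≥0) : ℝ) → ω ∈ A u → (x, ω) ∈ U) (s : ℝ≥0) :
    ENNReal.ofReal (∫ ω in A s, S.integral B s ω ^ 2 ∂P) ≤
      ∫⁻ x in Set.Ioc (0 : ℝ) s, ∫⁻ ω, U.indicator (fun q => ‖S.eval q.1 q.2‖ₑ ^ 2) (x, ω) ∂P := by
  obtain ⟨C, hC0, hC⟩ := S.exists_bound
  set Φ : ℝ × Ω → ℝ≥0∞ := U.indicator fun q => ‖S.eval q.1 q.2‖ₑ ^ 2 with hΦ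
  have hΦm : Measurable Φ := (S.measurable_eval.enorm.pow_const 2).indicator hU
  have hstep : ∀ u v : ℝ≥0, u ≤ v → ENNReal.ofReal (∫ ω in A v, S.energy u v ω ∂P) ≤
      ∫⁻ x in Set.Ioc (u : ℝ) v, ∫⁻ ω, Φ (x, ω) ∂P := by
    intro u v huv
    have hm : MeasurableSet (A v) := ℱ.le v _ (hA v)
    rw [ofReal_integral_eq_lintegral_ofReal (S.integrable_energy huv).integrableOn
      (Eventually.of_forall fun ω => S.energy_nonneg u v ω),
      lintegral_lintegral_swap (f := fun x ω => Φ (x, ω)) hΦm.aemeasurable]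
    refine (setLIntegral_mono' hm fun ω hω => ?_).trans (setLIntegral_le_lintegral _ _)
    rw [← S.lintegral_eval_sq huv]
    refine setLIntegral_mono' measurableSet_Ioc fun x hx => ?_
    have hmem : (x, ω) ∈ U := hAU v ω x (u.2.trans_lt hx.1) hx.2 hω
    rw [hΦ, Set.indicator_of_mem hmem]
  have hN : ∀ N : ℕ, ENNReal.ofReal (∫ ω in A s, S.integral B s ω ^ 2 ∂P) ≤
      (∫⁻ x in Set.Ioc (0 : ℝ) s, ∫⁻ ω, Φ (x, ω) ∂P) +
        ENNReal.ofReal (C * s * (1 / ((N : ℝ) + 1))) := by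
    intro N
    -- With N + 1 equal steps the discretisation error is at most C s / (N + 1).
    set δ : ℝ≥0 := s / (N + 1 : ℕ) with hδ
    have hs : ((N + 1 : ℕ) : ℝ≥0) * δ = s := by
      rw [hδ, mul_div_cancel₀]
      exact Nat.cast_ne_zero.2 (Nat.succ_ne_zero N)
    have hδr : (δ : ℝ) = s * (1 / ((N : ℝ) + 1)) := by
      rw [hδ]; push_cast; ring
    have h1 := S.setIntegral_sq_le_sum hB hA hanti hC0 hC (δ := δ) (N + 1)
    rw [hs] at h1
    have hsum : ∀ n : ℕ, ENNReal.ofReal (∑ l ∈ Finset.range n,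
        ∫ ω in A ((l + 1 : ℕ) * δ), S.energy (l * δ) ((l + 1 : ℕ) * δ) ω ∂P) ≤
        ∫⁻ x in Set.Ioc (0 : ℝ) ((n : ℝ≥0) * δ : ℝ≥0), ∫⁻ ω, Φ (x, ω) ∂P := by
      intro n
      induction n with
      | zero => simp
      | succ n ih =>
        have hle : (n : ℝ≥0) * δ ≤ (n + 1 : ℕ) * δ := by gcongr; simp
        rw [Finset.sum_range_succ]
        refine ENNReal.ofReal_add_le.trans ((add_le_add ih (hstep _ _ hle)).trans ?_)
        rw [← lintegral_union measurableSet_Ioc (Set.Ioc_disjoint_Ioc_of_le le_rfl),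
          Set.Ioc_union_Ioc_eq_Ioc (NNReal.coe_nonneg _) (NNReal.coe_le_coe.2 hle)]
    have h2 := hsum (N + 1)
    rw [hs] at h2
    refine (ENNReal.ofReal_le_ofReal h1).trans (ENNReal.ofReal_add_le.trans (add_le_add h2 ?_))
    refine ENNReal.ofReal_le_ofReal ?_
    rw [mul_assoc C s, ← hδr]
    refine mul_le_of_le_one_right (by positivity) ?_
    linarith [measureReal_le_one (μ := P) (s := A 0), measureReal_nonneg (μ := P) (s := A s)]
  refine ge_of_tendsto' (x := atTop) (f := fun N : ℕ =>
    (∫⁻ x in Set.Ioc (0 : ℝ) s, ∫⁻ ω, Φ (x, ω) ∂P) +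
        ENNReal.ofReal (C * s * (1 / ((N : ℝ) + 1)))) ?_ hN
  have h1 : Tendsto (fun N : ℕ => C * s * (1 / ((N : ℝ) + 1))) atTop (𝓝 (C * s * 0)) :=
    tendsto_one_div_add_atTop_nhds_zero_nat.const_mul _
  have h2 := ENNReal.tendsto_ofReal h1
  rw [mul_zero, ENNReal.ofReal_zero] at h2
  simpa using h2.const_add (∫⁻ x in Set.Ioc (0 : ℝ) s, ∫⁻ ω, Φ (x, ω) ∂P)

end Localized

end SimplePredictable

/-! ### Jensen's inequality on an event -/

section Jensen

variable {Ω : Type*} [mΩ : MeasurableSpace Ω]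

lemma sq_integral_le {κ : Measure Ω} [IsProbabilityMeasure κ] {f : Ω → ℝ} (hf : MemLp f 2 κ) :
    (∫ ω, f ω ∂κ) ^ 2 ≤ ∫ ω, f ω ^ 2 ∂κ := by
  have h := variance_nonneg f κ
  rw [variance_eq_sub hf] at h
  simpa using h

lemma sq_setIntegral_le {P : Measure Ω} [IsProbabilityMeasure P] {A : Set Ω} (hA : P A ≠ 0)
    {f : Ω → ℝ} (hf : MemLp f 2 P) : (∫ ω in A, f ω ∂P) ^ 2 ≤ ∫ ω in A, f ω ^ 2 ∂P := by
  have := cond_isProbabilityMeasure hA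
  have hf' : MemLp f 2 (cond P A) := by
    rw [ProbabilityTheory.cond]
    exact (hf.restrict A).smul_measure (ENNReal.inv_ne_top.2 hA)
  have h := sq_integral_le hf'
  rw [Switching.integral_cond, Switching.integral_cond] at h
  have hp : 0 < P.real A := ENNReal.toReal_pos hA (measure_ne_top _ _)
  have hp1 : P.real A ≤ 1 := measureReal_le_one
  have h0 : 0 ≤ ∫ ω in A, f ω ^ 2 ∂P := integral_nonneg fun _ => sq_nonneg _
  rw [mul_pow, inv_mul_eq_div, inv_pow, inv_mul_eq_div, div_le_div_iff₀ (by positivity) hp] at h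
  have h2 : (∫ ω in A, f ω ∂P) ^ 2 ≤ (∫ ω in A, f ω ^ 2 ∂P) * P.real A := by
    rw [sq (P.real A), ← mul_assoc] at h
    exact le_of_mul_le_mul_right h hp
  exact h2.trans (mul_le_of_le_one_right h0 hp1)

end Jensen

end RegimeSwitching

namespace RegimeSwitching

/-! ### The event `{ε(0) = i, N(s) = 0}` in terms of the path of `ε` -/

namespace Switching

variable {d : ℕ} {Ω : Type*} [mΩ : MeasurableSpace Ω] (M : Switching d Ω)

/-- Right-continuity of ε and J 1 ≠ J 0 make a switching up to time s visible at s or at one of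
countably many dense earlier times. This description serves twice: for membership in ℱ_s and for
independence from B. -/
lemma exists_countable_noSwitch (s : ℝ≥0) : ∃ C : Set ℝ≥0, C.Countable ∧ (∀ q ∈ C, q ≤ s) ∧
    ∀ i, M.noSwitch i s = {ω | ∀ q ∈ C, M.state q ω = i} := by
  obtain ⟨D, hDc, hD⟩ := TopologicalSpace.exists_countable_dense ℝ≥0
  refine ⟨insert s (D ∩ Set.Iic s), (hDc.mono Set.inter_subset_left).insert s, ?_, fun i => ?_⟩
  · rintro q (rfl | hq)
    exacts [le_rfl, hq.2]
  rw [M.noSwitch_eq i s.coe_nonneg, start_eq]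
  ext ω
  have hdense : ∀ a b : ℝ, 0 ≤ a → a < b → ∃ q ∈ D, a < (q : ℝ) ∧ (q : ℝ) < b := by
    intro a b ha hab
    obtain ⟨q, hqD, hq1, hq2⟩ := hD.exists_between
      (show (⟨a, ha⟩ : ℝ≥0) < ⟨b, ha.trans hab.le⟩ from hab)
    exact ⟨q, hqD, hq1, hq2⟩
  constructor
  · rintro ⟨h1, h2⟩ q hq
    have hqs : q ≤ s := by
      rcases hq with rfl | hq
      exacts [le_rfl, hq.2]
    have : M.count q ω = 0 :=
      (M.count_eq_zero_iff q.2 ω).2 (lt_of_le_of_lt (NNReal.coe_le_coe.2 hqs) h2)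
    rw [state, this]
    exact h1
  · intro hω
    have hstate : ∀ {n : ℕ} {q : ℝ≥0}, M.τ n ω ≤ q → (q : ℝ) < M.τ (n + 1) ω →
        q ∈ insert s (D ∩ Set.Iic s) → M.J n ω = i := by
      intro n q h1 h2 hq
      have := hω q hq
      rwa [state, M.count_eq h1 h2] at this
    have h0 := M.tau_one_pos ω
    have hz := M.τ_zero ω
    by_cases hs : (s : ℝ) < M.τ 1 ω
    · exact ⟨hstate (n := 0) (by rw [hz]; exact s.2) hs (Set.mem_insert _ _), hs⟩
    · exfalso
      push Not at hs
      obtain ⟨q, hqD, hq1, hq2⟩ := hdense 0 (M.τ 1 ω) le_rfl h0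
      have hJ0 : M.J 0 ω = i := hstate (n := 0) (by rw [hz]; exact hq1.le) hq2
        (Or.inr ⟨hqD, NNReal.coe_le_coe.1 (hq2.le.trans hs)⟩)
      have hJ1 : M.J 1 ω = i := by
        rcases hs.eq_or_lt with he | hlt
        -- If τ 1 = s, no time strictly before s shows the new regime; hence s itself belongs to the
        -- countable set.
        · exact hstate (n := 1) (q := s) hs (he ▸ M.tau_lt_succ 1 ω) (Set.mem_insert _ _)
        · obtain ⟨r, hrD, hr1, hr2⟩ := hdense (M.τ 1 ω) (min (M.τ 2 ω) s) h0.le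
            (lt_min (M.tau_lt_succ 1 ω) hlt)
          exact hstate (n := 1) hr1.le (hr2.trans_le (min_le_left _ _))
            (Or.inr ⟨hrD, NNReal.coe_le_coe.1 (hr2.le.trans (min_le_right _ _))⟩)
      exact M.J_succ_ne 0 ω (hJ1.trans hJ0.symm)

lemma measurableSet_noSwitch_filtration {ℱ : Filtration ℝ≥0 mΩ}
    (hM : Adapted ℱ fun (t : ℝ≥0) ω => M.state t ω) (i : Fin d) (s : ℝ≥0) :
    MeasurableSet[ℱ s] (M.noSwitch i s) := by
  obtain ⟨C, hC, hCs, hCeq⟩ := M.exists_countable_noSwitch s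
  rw [hCeq i]
  have : {ω | ∀ q ∈ C, M.state q ω = i} = ⋂ q ∈ C, {ω | M.state q ω = i} := by
    ext ω; simp
  rw [this]
  refine MeasurableSet.biInter hC fun q hq => ?_
  exact ((hM q).mono (ℱ.mono (hCs q hq)) le_rfl) (measurableSet_singleton i)

lemma exists_measurableSet_noSwitch_path (i : Fin d) (s : ℝ≥0) :
    ∃ T : Set (ℝ≥0 → Fin d), MeasurableSet T ∧
      M.noSwitch i s = (fun ω (t : ℝ≥0) => M.state t ω) ⁻¹' T := by
  obtain ⟨C, hC, hCs, hCeq⟩ := M.exists_countable_noSwitch s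
  refine ⟨⋂ q ∈ C, {e | e q = i}, MeasurableSet.biInter hC fun q _ =>
    measurableSet_eq_fun (measurable_pi_apply q) measurable_const, ?_⟩
  rw [hCeq i]
  ext ω
  simp

lemma antitone_noSwitch (i : Fin d) : Antitone fun u : ℝ≥0 => M.noSwitch i u := by
  intro u v huv
  simp only [M.noSwitch_eq i u.coe_nonneg, M.noSwitch_eq i v.coe_nonneg]
  exact Set.inter_subset_inter_right _ fun ω hω => lt_of_le_of_lt (NNReal.coe_le_coe.2 huv) hω

end Switching

/-! ### The Wiener part has mean zero on `{ε(0) = i, N(s) = 0}` -/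

namespace JumpDiffusion

variable {d : ℕ} {Ω : Type*} [mΩ : MeasurableSpace Ω] {P : Measure Ω} [IsProbabilityMeasure P]
  {ℱ : Filtration ℝ≥0 mΩ} (D : JumpDiffusion d P ℱ)

/-- The event is measurable with respect to the path of ε, hence independent of B, even for
increments before s. -/
lemma setIntegral_increment_noSwitch (i : Fin d) (s u v : ℝ≥0) :
    ∫ ω in D.M.noSwitch i s, (D.B v ω - D.B u ω) ∂P = 0 := by
  obtain ⟨T, hT, hTeq⟩ := D.M.exists_measurableSet_noSwitch_path i s
  have hm : MeasurableSet (D.M.noSwitch i s) :=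
    ℱ.le s _ (D.M.measurableSet_noSwitch_filtration D.adapted_state i s)
  have hφ : Measurable fun b : ℝ≥0 → ℝ => b v - b u := by fun_prop
  have hψ : Measurable (T.indicator fun _ : ℝ≥0 → Fin d => (1 : ℝ)) :=
    measurable_const.indicator hT
  have hind : IndepFun (fun ω => D.B v ω - D.B u ω)
      ((D.M.noSwitch i s).indicator fun _ => (1 : ℝ)) P := by
    have h1 := D.indep.comp hφ hψ
    rw [hTeq]
    exact h1
  have h2 := hind.integral_fun_mul_eq_mul_integral
    (D.brownian.memLp_increment u v).1 (measurable_const.indicator hm).aestronglyMeasurable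
  rw [D.brownian.integral_increment, zero_mul] at h2
  rw [← integral_indicator hm, ← h2]
  congr 1
  ext ω
  by_cases hω : ω ∈ D.M.noSwitch i s <;> simp [hω]

/-- The set of `(x, ω)` with `x > 0`, `ε(0) = i` and no switching up to the time `x`. -/
def unswitched (i : Fin d) : Set (ℝ × Ω) := {q | 0 < q.1 ∧ D.M.J 0 q.2 = i ∧ q.1 < D.M.τ 1 q.2}

lemma measurableSet_unswitched (i : Fin d) : MeasurableSet (D.unswitched i) := by
  refine MeasurableSet.inter (measurableSet_lt measurable_const measurable_fst) ?_
  refine MeasurableSet.inter ?_ (measurableSet_lt measurable_fst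
    ((D.M.measurable_τ 1).comp measurable_snd))
  exact ((D.M.measurable_J 0).comp measurable_snd) (measurableSet_singleton i)

lemma mem_unswitched {i : Fin d} {u : ℝ} (hu : 0 ≤ u) {ω : Ω} {x : ℝ} (hx : 0 < x) (hxu : x ≤ u)
    (hω : ω ∈ D.M.noSwitch i u) : (x, ω) ∈ D.unswitched i := by
  rw [D.M.noSwitch_eq i hu, D.M.start_eq] at hω
  exact ⟨hx, hω.1, hxu.trans_lt hω.2⟩

/-- Until the first switching out of i, σ† coincides with σ_i, so the distance of `S` to the
deterministic σ_i there is part of its distance to σ†. -/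
lemma lintegral_unswitched_le (S : SimplePredictable ℱ) (i : Fin d) {s t : ℝ≥0} (hst : s ≤ t) :
    ∫⁻ x in Set.Ioc (0 : ℝ) s, ∫⁻ ω, (D.unswitched i).indicator
        (fun q => ‖S.eval q.1 q.2 - D.σ i q.1‖ₑ ^ 2) (x, ω) ∂P ≤
      eLpNorm (fun q : Ω × ℝ => S.eval q.2 q.1 - D.M.switched D.σ q.2 q.1) 2
        (P.prod (volume.restrict (Set.Ioc 0 (t : ℝ)))) ^ 2 := by
  have hΦm : Measurable ((D.unswitched i).indicator
      (fun q => ‖S.eval q.1 q.2 - D.σ i q.1‖ₑ ^ 2)) :=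
    ((S.measurable_eval.sub ((D.measurable_σ i).comp measurable_fst)).enorm.pow_const 2).indicator
      (D.measurableSet_unswitched i)
  have h2 : eLpNorm (fun q : Ω × ℝ => S.eval q.2 q.1 - D.M.switched D.σ q.2 q.1) 2
      (P.prod (volume.restrict (Set.Ioc 0 (t : ℝ)))) ^ 2 =
      ∫⁻ q, ‖S.eval q.2 q.1 - D.M.switched D.σ q.2 q.1‖ₑ ^ 2
        ∂(P.prod (volume.restrict (Set.Ioc 0 (t : ℝ)))) := by
    have := eLpNorm_nnreal_pow_eq_lintegral (p := 2) (μ := P.prod (volume.restrict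
      (Set.Ioc 0 (t : ℝ)))) (f := fun q : Ω × ℝ => S.eval q.2 q.1 - D.M.switched D.σ q.2 q.1)
      two_ne_zero
    simpa only [NNReal.coe_ofNat, ENNReal.coe_ofNat, ENNReal.rpow_ofNat] using this
  rw [h2]
  calc _ ≤ ∫⁻ x in Set.Ioc (0 : ℝ) t, ∫⁻ ω, (D.unswitched i).indicator
        (fun q => ‖S.eval q.1 q.2 - D.σ i q.1‖ₑ ^ 2) (x, ω) ∂P :=
        lintegral_mono_set (Set.Ioc_subset_Ioc_right (NNReal.coe_le_coe.2 hst))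
    _ = ∫⁻ q, (D.unswitched i).indicator (fun q => ‖S.eval q.1 q.2 - D.σ i q.1‖ₑ ^ 2) q.swap
        ∂(P.prod (volume.restrict (Set.Ioc 0 (t : ℝ)))) :=
        (lintegral_prod_symm' _ (hΦm.comp measurable_swap)).symm
    _ ≤ _ := by
        refine lintegral_mono fun q => ?_
        by_cases hq : q.swap ∈ D.unswitched i
        · rw [Set.indicator_of_mem hq]
          obtain ⟨h3, h4, h5⟩ := hq
          simp only [Prod.fst_swap, Prod.snd_swap] at h3 h4 h5 ⊢
          rw [D.M.switched_apply D.σ (n := 0) (by rw [D.M.τ_zero]; exact h3.le) h5, h4,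
            D.M.τ_zero, sub_zero]
        · rw [Set.indicator_of_notMem hq]
          exact zero_le

lemma enorm_sub_sq_le (x y z : ℝ) : ‖x - z‖ₑ ^ 2 ≤ 2 * ‖x - y‖ₑ ^ 2 + 2 * ‖y - z‖ₑ ^ 2 := by
  have e : ∀ r : ℝ, ‖r‖ₑ ^ 2 = ENNReal.ofReal (r ^ 2) := fun r => by
    rw [← enorm_pow, Real.enorm_of_nonneg (sq_nonneg _)]
  rw [e, e, e, show (2 : ℝ≥0∞) = ENNReal.ofReal 2 by simp, ← ENNReal.ofReal_mul zero_le_two,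
    ← ENNReal.ofReal_mul zero_le_two, ← ENNReal.ofReal_add (by positivity) (by positivity)]
  refine ENNReal.ofReal_le_ofReal ?_
  nlinarith [sq_nonneg ((x - y) - (y - z))]

/-- Jensen's inequality under the conditional law given A, which lies in the unswitched set for each
time x ≤ s. -/
lemma enorm_sub_mean_sq_le (S : SimplePredictable ℱ) (i : Fin d) {s : ℝ≥0}
    (hs : P (D.M.noSwitch i s) ≠ 0) {x : ℝ} (hx : 0 < x) (hxs : x ≤ s) :
    ‖D.σ i x - ∫ ω, S.eval x ω ∂(cond P (D.M.noSwitch i s))‖ₑ ^ 2 ≤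
      (P (D.M.noSwitch i s))⁻¹ * ∫⁻ ω, (D.unswitched i).indicator
        (fun q => ‖S.eval q.1 q.2 - D.σ i q.1‖ₑ ^ 2) (x, ω) ∂P := by
  set A := D.M.noSwitch i s with hAdef
  have hA : MeasurableSet A := ℱ.le s _ (D.M.measurableSet_noSwitch_filtration D.adapted_state i s)
  have := cond_isProbabilityMeasure hs
  have hSm : Measurable (S.eval x) := S.measurable_eval.comp measurable_prodMk_left
  have hS : MemLp (S.eval x) 2 (cond P A) := by
    refine memLp_finsetSum _ fun k _ => ?_
    obtain ⟨C, hC⟩ := S.bounded_ξ k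
    by_cases hk : x ∈ Set.Ioc (S.p k : ℝ) (S.p (k + 1))
    · simp only [Set.indicator_of_mem hk]
      exact MemLp.of_bound ((S.measurable_ξ k).mono (ℱ.le _) le_rfl).aestronglyMeasurable C
        (Eventually.of_forall hC)
    · simp only [Set.indicator_of_notMem hk]
      exact MemLp.zero
  have hd : MemLp (fun ω => S.eval x ω - D.σ i x) 2 (cond P A) := hS.sub (memLp_const _)
  have e : ∀ r : ℝ, ‖r‖ₑ ^ 2 = ENNReal.ofReal (r ^ 2) := fun r => by
    rw [← enorm_pow, Real.enorm_of_nonneg (sq_nonneg _)]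
  have h1 : D.σ i x - ∫ ω, S.eval x ω ∂(cond P A) =
      -∫ ω, (S.eval x ω - D.σ i x) ∂(cond P A) := by
    rw [integral_sub (hS.integrable one_le_two) (integrable_const _)]
    simp
  calc _ ≤ ENNReal.ofReal (∫ ω, (S.eval x ω - D.σ i x) ^ 2 ∂(cond P A)) := by
        rw [h1, e, neg_sq]
        exact ENNReal.ofReal_le_ofReal (sq_integral_le hd)
    _ = ∫⁻ ω, ‖S.eval x ω - D.σ i x‖ₑ ^ 2 ∂(cond P A) := by
        rw [ofReal_integral_eq_lintegral_ofReal hd.integrable_sq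
          (Eventually.of_forall fun _ => sq_nonneg _)]
        simp_rw [e]
    _ = (P A)⁻¹ * ∫⁻ ω in A, ‖S.eval x ω - D.σ i x‖ₑ ^ 2 ∂P := by
        rw [ProbabilityTheory.cond, lintegral_smul_measure, smul_eq_mul]
    _ ≤ _ := by
        refine mul_le_mul_right ?_ _
        rw [← lintegral_indicator hA]
        refine lintegral_mono fun ω => ?_
        by_cases hω : ω ∈ A
        · rw [Set.indicator_of_mem hω,
            Set.indicator_of_mem (D.mem_unswitched s.2 hx hxs hω)]
        · rw [Set.indicator_of_notMem hω]
          exact zero_le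

/-- The heart of the Wiener part: centring the coefficients given A does not change the integral
over A, and afterwards the localized L² estimate applies. In the constant, one 2 is for the distance
of `S` to σ_i and 2 / P(A) for the distance of σ_i to the conditional mean. -/
lemma sq_setIntegral_noSwitch_le (S : SimplePredictable ℱ) (i : Fin d) {s t : ℝ≥0} (hst : s ≤ t)
    (hs : P (D.M.noSwitch i s) ≠ 0) :
    ENNReal.ofReal ((∫ ω in D.M.noSwitch i s, S.integral D.B t ω ∂P) ^ 2) ≤
      (2 + 2 * (P (D.M.noSwitch i s))⁻¹) *
        eLpNorm (fun q : Ω × ℝ => S.eval q.2 q.1 - D.M.switched D.σ q.2 q.1) 2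
          (P.prod (volume.restrict (Set.Ioc 0 (t : ℝ)))) ^ 2 := by
  set A := D.M.noSwitch i s with hAdef
  have hAs := D.M.measurableSet_noSwitch_filtration D.adapted_state i s
  have hB := D.brownian
  set a : ℕ → ℝ := fun k => ∫ ω, S.ξ k ω ∂(cond P A) with ha
  set R := S.subConst a with hR
  have hprob := cond_isProbabilityMeasure hs
  have hint : ∀ r : ℝ≥0, Integrable (S.integral D.B r) P := fun r =>
    (S.memLp_integral hB r).integrable one_le_two
  -- A is known at time s, so the part of the integral after s has mean zero on A.
  have h1 : ∫ ω in A, S.integral D.B t ω ∂P = ∫ ω in A, S.integral D.B s ω ∂P := by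
    have := S.setIntegral_sub_eq_zero hB hst hAs
    rw [integral_sub (hint t).integrableOn (hint s).integrableOn] at this
    linarith
  have hinc : ∀ k, Integrable (fun ω => a k * (D.B (min (S.p (k + 1)) s) ω -
      D.B (min (S.p k) s) ω)) P := fun k =>
    ((hB.memLp_increment _ _).integrable one_le_two).const_mul _
  -- The subtracted integral is a deterministic combination of increments, each with mean zero on A.
  have h2 : ∫ ω in A, R.integral D.B s ω ∂P = ∫ ω in A, S.integral D.B s ω ∂P := by
    simp_rw [hR, S.subConst_integral a]
    rw [integral_sub (hint s).integrableOn
      (integrable_finsetSum _ fun k _ => (hinc k).integrableOn),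
      integral_finsetSum _ fun k _ => (hinc k).integrableOn]
    simp_rw [integral_const_mul, hAdef, D.setIntegral_increment_noSwitch i s]
    simp
  -- The subtracted step function is the conditional mean of `S` at time x given A.
  have hmean : ∀ x, ∑ k ∈ Finset.range S.n,
      (Set.Ioc (S.p k : ℝ) (S.p (k + 1))).indicator (fun _ => a k) x =
      ∫ ω, S.eval x ω ∂(cond P A) := by
    intro x
    unfold SimplePredictable.eval
    rw [integral_finsetSum]
    · refine Finset.sum_congr rfl fun k _ => ?_
      by_cases hx : x ∈ Set.Ioc (S.p k : ℝ) (S.p (k + 1))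
      · simp only [Set.indicator_of_mem hx, ha]
      · simp only [Set.indicator_of_notMem hx, integral_zero]
    · intro k _
      obtain ⟨C, hC⟩ := S.bounded_ξ k
      by_cases hx : x ∈ Set.Ioc (S.p k : ℝ) (S.p (k + 1))
      · simp only [Set.indicator_of_mem hx]
        exact Integrable.of_bound ((S.measurable_ξ k).mono (ℱ.le _) le_rfl).aestronglyMeasurable C
          (Eventually.of_forall hC)
      · simp only [Set.indicator_of_notMem hx]
        exact integrable_zero _ _ _
  set Φ : ℝ × Ω → ℝ≥0∞ := (D.unswitched i).indicator
    (fun q => ‖S.eval q.1 q.2 - D.σ i q.1‖ₑ ^ 2) with hΦ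
  have hΦm : Measurable Φ :=
    ((S.measurable_eval.sub ((D.measurable_σ i).comp measurable_fst)).enorm.pow_const 2).indicator
      (D.measurableSet_unswitched i)
  have hpt : ∀ x ∈ Set.Ioc (0 : ℝ) s, ∫⁻ ω, (D.unswitched i).indicator
      (fun q => ‖R.eval q.1 q.2‖ₑ ^ 2) (x, ω) ∂P ≤
      (2 + 2 * (P A)⁻¹) * ∫⁻ ω, Φ (x, ω) ∂P := by
    intro x hx
    have hm : Measurable fun ω => Φ (x, ω) := hΦm.comp measurable_prodMk_left
    calc _ ≤ ∫⁻ ω, (2 * Φ (x, ω) +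
          2 * ‖D.σ i x - ∫ ω, S.eval x ω ∂(cond P A)‖ₑ ^ 2) ∂P := by
          refine lintegral_mono fun ω => ?_
          by_cases hω : (x, ω) ∈ D.unswitched i
          · rw [Set.indicator_of_mem hω, hΦ, Set.indicator_of_mem hω, hR]
            simp only [S.subConst_eval a, hmean]
            exact enorm_sub_sq_le _ _ _
          · rw [Set.indicator_of_notMem hω]
            exact zero_le
      _ = 2 * ∫⁻ ω, Φ (x, ω) ∂P +
          2 * ‖D.σ i x - ∫ ω, S.eval x ω ∂(cond P A)‖ₑ ^ 2 := by
          rw [lintegral_add_left (hm.const_mul 2), lintegral_const_mul _ hm, lintegral_const,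
            measure_univ, mul_one]
      _ ≤ 2 * ∫⁻ ω, Φ (x, ω) ∂P + 2 * ((P A)⁻¹ * ∫⁻ ω, Φ (x, ω) ∂P) := by
          gcongr
          exact D.enorm_sub_mean_sq_le S i hs hx.1 hx.2
      _ = _ := by ring
  rw [h1, ← h2]
  calc _ ≤ ENNReal.ofReal (∫ ω in A, R.integral D.B s ω ^ 2 ∂P) :=
        ENNReal.ofReal_le_ofReal (sq_setIntegral_le hs (R.memLp_integral hB s))
    _ ≤ ∫⁻ x in Set.Ioc (0 : ℝ) s, ∫⁻ ω, (D.unswitched i).indicator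
        (fun q => ‖R.eval q.1 q.2‖ₑ ^ 2) (x, ω) ∂P :=
        R.setIntegral_sq_le_lintegral hB (A := fun u => D.M.noSwitch i u)
          (fun u => D.M.measurableSet_noSwitch_filtration D.adapted_state i u)
          (D.M.antitone_noSwitch i) (D.measurableSet_unswitched i)
          (fun u ω x hx hxu hω => D.mem_unswitched u.2 hx hxu hω) s
    _ ≤ ∫⁻ x in Set.Ioc (0 : ℝ) s, (2 + 2 * (P A)⁻¹) * ∫⁻ ω, Φ (x, ω) ∂P :=
        setLIntegral_mono' measurableSet_Ioc hpt
    _ = (2 + 2 * (P A)⁻¹) * ∫⁻ x in Set.Ioc (0 : ℝ) s, ∫⁻ ω, Φ (x, ω) ∂P :=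
        lintegral_const_mul _ hΦm.lintegral_prod_right'
    _ ≤ _ := by
        gcongr
        exact D.lintegral_unswitched_le S i hst

lemma memLp_W (t : ℝ≥0) : MemLp (D.W t) 2 P := by
  obtain ⟨hm, S, -, hS⟩ := D.isIto t
  obtain ⟨k, hk⟩ := (hS.eventually (gt_mem_nhds ENNReal.zero_lt_top)).exists
  have h1 := (S k).memLp_integral D.brownian t
  have h2 : MemLp (fun ω => (S k).integral D.B t ω - D.W t ω) 2 P := ⟨h1.1.sub hm, hk⟩
  have h3 := h1.sub h2
  refine h3.congr_norm hm (Eventually.of_forall fun ω => ?_)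
  simp

/-- L² convergence carries the integrals over A of the approximations to that of W, while the
preceding bound sends them to 0. -/
lemma setIntegral_W_noSwitch (i : Fin d) {s t : ℝ≥0} (hst : s ≤ t)
    (hs : P (D.M.noSwitch i s) ≠ 0) : ∫ ω in D.M.noSwitch i s, D.W t ω ∂P = 0 := by
  obtain ⟨hm, S, hH, hS⟩ := D.isIto t
  have hWi : Integrable (D.W t) P := (D.memLp_W t).integrable one_le_two
  have hlim1 : Tendsto (fun k => ∫ ω in D.M.noSwitch i s, (S k).integral D.B t ω ∂P) atTop
      (𝓝 (∫ ω in D.M.noSwitch i s, D.W t ω ∂P)) := by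
    refine tendsto_setIntegral_of_L1' _ hWi.aestronglyMeasurable
      (Eventually.of_forall fun k => ((S k).memLp_integral D.brownian t).integrable one_le_two)
      ?_ _
    refine tendsto_of_tendsto_of_tendsto_of_le_of_le tendsto_const_nhds hS (fun k => zero_le)
      fun k => ?_
    exact eLpNorm_le_eLpNorm_of_exponent_le one_le_two
      (((S k).memLp_integral D.brownian t).1.sub hm)
  have hlim2 : Tendsto (fun k => ENNReal.ofReal
      ((∫ ω in D.M.noSwitch i s, (S k).integral D.B t ω ∂P) ^ 2)) atTop (𝓝 0) := by
    have hfin : (2 + 2 * (P (D.M.noSwitch i s))⁻¹) ≠ ∞ :=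
      ENNReal.add_ne_top.2 ⟨by simp, ENNReal.mul_ne_top (by simp) (ENNReal.inv_ne_top.2 hs)⟩
    have h1 := ENNReal.Tendsto.const_mul (a := 2 + 2 * (P (D.M.noSwitch i s))⁻¹)
      (ENNReal.Tendsto.pow (n := 2) hH) (Or.inr hfin)
    simp only [ne_eq, OfNat.ofNat_ne_zero, not_false_eq_true, zero_pow, mul_zero] at h1
    exact tendsto_of_tendsto_of_tendsto_of_le_of_le tendsto_const_nhds h1 (fun k => zero_le)
      fun k => D.sq_setIntegral_noSwitch_le (S k) i hst hs
  have h3 := tendsto_nhds_unique (ENNReal.tendsto_ofReal (hlim1.pow 2)) hlim2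
  rw [ENNReal.ofReal_eq_zero] at h3
  exact pow_eq_zero_iff two_ne_zero |>.1 (le_antisymm h3 (sq_nonneg _))

end JumpDiffusion

end RegimeSwitching

namespace RegimeSwitching

/-! ### The system of renewal equations for the conditional means -/

namespace JumpDiffusion

variable {d : ℕ} {Ω : Type*} [mΩ : MeasurableSpace Ω] {P : Measure Ω} [IsProbabilityMeasure P]
  {ℱ : Filtration ℝ≥0 mΩ} (D : JumpDiffusion d P ℱ)

lemma noSwitch_zero (i : Fin d) : D.M.noSwitch i 0 = D.M.start i := by
  rw [D.M.noSwitch_eq i le_rfl, Set.inter_eq_left]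
  exact fun ω _ => D.M.tau_one_pos ω

lemma measureReal_noSwitch (i : Fin d) {s : ℝ} (hs : 0 ≤ s) :
    P.real (D.M.noSwitch i s) = P.real (D.M.start i) * D.M.survival P i s := by
  rw [D.M.noSwitch_eq i hs, Switching.survival_eq_div,
    mul_div_cancel₀ _ (Switching.measureReal_start_pos (D.start_ne_zero i)).ne']

lemma survival_zero (i : Fin d) : D.M.survival P i 0 = 1 := by
  have h1 := D.measureReal_noSwitch i le_rfl
  rw [noSwitch_zero] at h1
  have h2 := (Switching.measureReal_start_pos (D.start_ne_zero i)).ne'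
  exact (mul_right_cancel₀ h2 (by rw [one_mul, mul_comm, ← h1])).symm

lemma condMean_zero (i : Fin d) (t : ℝ) : D.condMean i 0 t = D.mean i t := by
  rw [condMean, mean, noSwitch_zero]

lemma condA_zero (i : Fin d) {t : ℝ} (ht : 0 ≤ t) : D.condA i 0 t = D.a i t := by
  rw [condA, a, intervalIntegral.integral_same, zero_add]
  refine intervalIntegral.integral_congr_ae (Eventually.of_forall fun u hu => ?_)
  rw [Set.uIoc_of_le ht] at hu
  rw [Switching.condSurvival_eq_div i (D.start_ne_zero i) hu.1.le,
    Switching.condDensity_eq_div i (D.start_ne_zero i) hu.1, survival_zero, div_one, div_one]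

section

variable (hh : ∀ i t, 0 ≤ t → IntervalIntegrable (fun u => D.h i u * D.M.density P i u) volume 0 t)

include hh

lemma integrable_X {t : ℝ} (ht : 0 ≤ t) : Integrable (D.X t) P :=
  (Switching.integrable_telegraph_add_jump D.integrable_c D.measurable_h
    (Switching.integrable_jump D.differentiable D.measurable_h hh) D.semiMarkov D.start_ne_zero
    ht).add ((D.memLp_W ⟨t, ht⟩).integrable one_le_two)

lemma setIntegral_X_noSwitch (i : Fin d) {s t : ℝ} (hs : 0 ≤ s) (hst : s ≤ t)
    (hpos : P (D.M.noSwitch i s) ≠ 0) :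
    ∫ ω in D.M.noSwitch i s, D.X t ω ∂P =
      ∫ ω in D.M.noSwitch i s, (D.M.telegraph D.c t ω + D.M.jump D.h t ω) ∂P := by
  have ht := hs.trans hst
  have hW := D.setIntegral_W_noSwitch i (s := ⟨s, hs⟩) (t := ⟨t, ht⟩) hst hpos
  have h1 := Switching.integrable_telegraph_add_jump D.integrable_c D.measurable_h
    (Switching.integrable_jump D.differentiable D.measurable_h hh) D.semiMarkov D.start_ne_zero ht
  have h2 : Integrable (D.W t) P := (D.memLp_W ⟨t, ht⟩).integrable one_le_two
  unfold X
  rw [integral_add h1.integrableOn h2.integrableOn]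
  exact (congrArg _ hW).trans (add_zero _)

lemma mean_eq_switchMean (i : Fin d) {t : ℝ} (ht : 0 ≤ t) :
    D.mean i t = D.M.switchMean P D.c D.h i t := by
  have h := D.setIntegral_X_noSwitch hh i le_rfl ht (by
    rw [noSwitch_zero]; exact D.start_ne_zero i)
  rw [noSwitch_zero] at h
  rw [mean, Switching.switchMean, Switching.integral_cond, Switching.integral_cond, h]

/-- The representation of the conditional means through the means `μ_j`. -/
lemma condMean_eq (i : Fin d) {s t : ℝ} (hs : 0 ≤ s) (hst : s ≤ t)
    (hpos : 0 < D.M.survival P i s) :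
    (∀ j, IntervalIntegrable (fun u => D.mean j (t - u) * D.M.condDensityTo P i j s u)
      volume s t) ∧
    D.condMean i s t = D.condA i s t +
      ∑ j ∈ Finset.univ.erase i, ∫ u in s..t, D.mean j (t - u) * D.M.condDensityTo P i j s u := by
  have hi := D.start_ne_zero i
  have hPi := Switching.measureReal_start_pos hi
  have hreal := D.measureReal_noSwitch i hs
  have hne : P (D.M.noSwitch i s) ≠ 0 := by
    intro h0
    rw [measureReal_def, h0, ENNReal.toReal_zero] at hreal
    exact (mul_pos hPi hpos).ne hreal
  obtain ⟨h1, h2⟩ := Switching.setIntegral_switch D.differentiable D.integrable_c D.measurable_h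
    D.measurable_c hh D.semiMarkov D.start_ne_zero hs hst i
  -- The half-open interval excludes u = s, where the conditional density is not controlled.
  have hcongr : ∀ j, Set.EqOn (fun u => D.M.switchMean P D.c D.h j (t - u) * D.M.densityTo P i j u /
      D.M.survival P i s) (fun u => D.mean j (t - u) * D.M.condDensityTo P i j s u)
      (Set.uIoc s t) := by
    intro j u hu
    rw [Set.uIoc_of_le hst] at hu
    simp only [D.mean_eq_switchMean hh j (sub_nonneg.2 hu.2),
      Switching.condDensityTo_eq_div i j hi hu.1, mul_div_assoc]
  refine ⟨fun j => ((h1 j).div_const _).congr (hcongr j), ?_⟩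
  have hsum : ∀ j, ∫ u in s..t, D.mean j (t - u) * D.M.condDensityTo P i j s u =
      (∫ u in s..t, D.M.switchMean P D.c D.h j (t - u) * D.M.densityTo P i j u) /
        D.M.survival P i s := by
    intro j
    rw [← intervalIntegral.integral_div]
    exact intervalIntegral.integral_congr_ae (Eventually.of_forall fun u hu => (hcongr j hu).symm)
  have hA : D.condA i s t = (∫ u in (0 : ℝ)..s, D.c i u) +
      (∫ u in s..t, (D.c i u * D.M.survival P i u + D.h i u * D.M.density P i u)) /
        D.M.survival P i s := by
    rw [condA, ← intervalIntegral.integral_div]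
    congr 1
    refine intervalIntegral.integral_congr_ae (Eventually.of_forall fun u hu => ?_)
    rw [Set.uIoc_of_le hst] at hu
    rw [Switching.condSurvival_eq_div i hi hu.1.le, Switching.condDensity_eq_div i hi hu.1, add_div,
      mul_div_assoc, mul_div_assoc]
  rw [condMean, Switching.integral_cond, D.setIntegral_X_noSwitch hh i hs hst hne, hreal]
  rw [← D.M.noSwitch_eq i hs] at h2
  simp_rw [hsum]
  rw [h2, hA, ← Finset.sum_div]
  field_simp

/-- The case s = 0 of `condMean_eq`, since τ 1 > 0 gives F̄_i(0) = 1 and conditioning on N(0) = 0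
adds nothing. -/
lemma solvesVolterra_mean : D.SolvesVolterra D.mean where
  locallyIntegrable i t ht := by
    refine (Switching.intervalIntegrable_switchMean D.differentiable D.integrable_c D.measurable_h
      hh D.semiMarkov D.start_ne_zero ht i).congr fun u hu => ?_
    rw [Set.uIoc_of_le ht] at hu
    exact (D.mean_eq_switchMean hh i hu.1.le).symm
  integrable i j t _ ht := by
    refine ((D.condMean_eq hh i le_rfl ht (by rw [survival_zero]; exact one_pos)).1 j).congr
      fun u hu => ?_
    rw [Set.uIoc_of_le ht] at hu
    simp only [Switching.condDensityTo_eq_div i j (D.start_ne_zero i) hu.1, survival_zero, div_one]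
  eq i t ht := by
    have h := (D.condMean_eq hh i le_rfl ht (by rw [survival_zero]; exact one_pos)).2
    rw [condMean_zero, D.condA_zero i ht] at h
    rw [h]
    congr 1
    refine Finset.sum_congr rfl fun j _ => intervalIntegral.integral_congr_ae
      (Eventually.of_forall fun u hu => ?_)
    rw [Set.uIoc_of_le ht] at hu
    simp only [Switching.condDensityTo_eq_div i j (D.start_ne_zero i) hu.1, survival_zero, div_one]

end

lemma SolvesVolterra.unique {m m' : Fin d → ℝ → ℝ} (hm : D.SolvesVolterra m)
    (hm' : D.SolvesVolterra m') (i : Fin d) {t : ℝ} (ht : 0 ≤ t) : m i t = m' i t := by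
  have h := Switching.eq_zero_of_renewal D.differentiable D.start_ne_zero
    (z := fun i t => m i t - m' i t)
    (fun i t ht => (hm.locallyIntegrable i t ht).sub (hm'.locallyIntegrable i t ht))
    (fun i t ht => ?_) i ht
  · exact sub_eq_zero.1 h
  · rw [hm.eq i t ht, hm'.eq i t ht, add_sub_add_left_eq_sub, ← Finset.sum_sub_distrib]
    refine Finset.sum_congr rfl fun j hj => ?_
    rw [← intervalIntegral.integral_sub (hm.integrable i j t (Finset.ne_of_mem_erase hj) ht)
      (hm'.integrable i j t (Finset.ne_of_mem_erase hj) ht)]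
    simp_rw [sub_mul]

end JumpDiffusion

end RegimeSwitching

open RegimeSwitching in
theorem proposition2p1 {d : ℕ} {Ω : Type*} [mΩ : MeasurableSpace Ω] (P : Measure Ω)
    [IsProbabilityMeasure P] (ℱ : Filtration ℝ≥0 mΩ) (D : JumpDiffusion d P ℱ)
    (hh : ∀ i t, 0 ≤ t → IntervalIntegrable (fun u => D.h i u * D.M.density P i u) volume 0 t) :
    ((∀ i t, 0 ≤ t → Integrable (D.X t) (cond P (D.M.start i))) ∧ D.SolvesVolterra D.mean) ∧
    ∀ m : Fin d → ℝ → ℝ, D.SolvesVolterra m →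
      ∀ i s t, 0 ≤ s → s ≤ t → 0 < D.M.survival P i s →
        Integrable (D.X t) (cond P (D.M.noSwitch i s)) ∧
        (∀ j, j ≠ i →
          IntervalIntegrable (fun u => m j (t - u) * D.M.condDensityTo P i j s u) volume s t) ∧
        D.condMean i s t = D.condA i s t +
          ∑ j ∈ Finset.univ.erase i, ∫ u in s..t, m j (t - u) * D.M.condDensityTo P i j s u := by
  refine ⟨⟨fun i t ht => Switching.integrable_cond (D.start_ne_zero i) (D.integrable_X hh ht),
    D.solvesVolterra_mean hh⟩, fun m hm i s t hs hst hpos => ?_⟩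
  have hne : P (D.M.noSwitch i s) ≠ 0 := by
    intro h0
    have h1 := D.measureReal_noSwitch i hs
    rw [measureReal_def, h0, ENNReal.toReal_zero] at h1
    exact (mul_pos (Switching.measureReal_start_pos (D.start_ne_zero i)) hpos).ne h1
  obtain ⟨h1, h2⟩ := D.condMean_eq hh i hs hst hpos
  -- By uniqueness `m` agrees with the mean at every nonnegative time, and only such times t - u
  -- occur.
  have hcongr : ∀ j, Set.EqOn (fun u => D.mean j (t - u) * D.M.condDensityTo P i j s u)
      (fun u => m j (t - u) * D.M.condDensityTo P i j s u) (Set.uIoc s t) := by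
    intro j u hu
    rw [Set.uIoc_of_le hst] at hu
    simp only [JumpDiffusion.SolvesVolterra.unique D (D.solvesVolterra_mean hh) hm j
      (sub_nonneg.2 hu.2)]
  refine ⟨Switching.integrable_cond hne (D.integrable_X hh (hs.trans hst)),
    fun j _ => (h1 j).congr (hcongr j), h2.trans ?_⟩
  congr 1
  exact Finset.sum_congr rfl fun j _ => intervalIntegral.integral_congr_ae
    (Eventually.of_forall fun u hu => hcongr j hu)
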